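/- All graphs are finite and loopless; parallel edges are allowed. A graph is planar if it has an embedding in the sphere, given combinatorially by a rotation system (a cyclic order of the edges at each vertex) of genus $0$, that is, one with $|V|-|E|+|F|=2$ on each connected component that has an edge, where the faces $F$ are those traced out by the rotation system. For $X\subseteq V(G)$ let $d(X)$ be the number of edges with exactly one end in $X$. A graph $G$ is $k$-edge-connected if $d(X)\ge k$ for every nonempty proper subset $X$ of $V(G)$, and odd-$k$-edge-connected if $d(X)\ge k$ for every $X\subseteq V(G)$ such that $d(X)$ is odd. A modulo $5$-orientation of $G$ is an orientation with $d^+(v)-d^-(v)\equiv 0\pmod 5$ for every vertex $v$. A circular $5/2$-flow of $G$ is an orientation of $G$ together with an integer-valued function $f$ on $E(G)$ with values in $\{\pm 2,\pm 3\}$, such that at every vertex the sum of $f$ over the outgoing edges equals the sum of $f$ over the incoming edges. Theorem. Every odd-$11$-edge-connected planar graph has a modulo $5$-orientation. In particular, every $10$-edge-connected planar graph has a modulo $5$-orientation, and hence a circular $5/2$-flow. -/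

import Mathlib

/-!
Multigraphs are Mathlib's `Graph α β`. All notions below are meant for finite loopless multigraphs
(parallel edges allowed).
-/

namespace Graph

variable {α β : Type*}

/-! ### Edge cuts and edge-connectivity -/

/-- The edge cut `[X, Xᶜ]`: the edges with one end in `X` and the other end outside `X`. -/
def edgeCut (G : Graph α β) (X : Set α) : Set β :=
  {e | ∃ x y, G.IsLink e x y ∧ x ∈ X ∧ y ∉ X}

/-- `d(X) = |[X, Xᶜ]|`. -/
noncomputable def cutSize (G : Graph α β) (X : Set α) : ℕ := (G.edgeCut X).ncard

/-- `G` is `k`-edge-connected: every nonempty proper vertex subset `X` has `d(X) ≥ k`. -/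
def IsEdgeConnected (G : Graph α β) (k : ℕ) : Prop :=
  ∀ X : Set α, X ⊂ G.vertexSet → X.Nonempty → k ≤ G.cutSize X

/-- `G` is odd-`k`-edge-connected: every edge cut of odd size has size at least `k`. -/
def IsOddEdgeConnected (G : Graph α β) (k : ℕ) : Prop :=
  ∀ X : Set α, X ⊆ G.vertexSet → Odd (G.cutSize X) → k ≤ G.cutSize X

/-! ### Planarity, through rotation systems of genus zero -/

/-- A dart: an edge together with one of the two directions in which it can be traversed. -/
@[ext]
structure Dart (G : Graph α β) where
  edge : β
  tail : α
  head : α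
  isLink : G.IsLink edge tail head

/-- The other dart of the same edge. -/
def Dart.reverse {G : Graph α β} (d : G.Dart) : G.Dart := ⟨d.edge, d.head, d.tail, d.isLink.symm⟩

/-- The involution that exchanges the two darts of each edge. -/
def flip (G : Graph α β) : Equiv.Perm G.Dart where
  toFun := Dart.reverse
  invFun := Dart.reverse
  left_inv _ := rfl
  right_inv _ := rfl

/-- A rotation system (a combinatorial embedding of `G` in an oriented surface): a permutation
of the darts which, around each vertex, arranges the darts leaving that vertex in a single cyclic
order. -/
structure RotationSystem (G : Graph α β) where
  next : Equiv.Perm G.Dart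
  sameCycle_iff : ∀ d d' : G.Dart, next.SameCycle d d' ↔ d.tail = d'.tail

namespace RotationSystem

variable {G : Graph α β} (R : G.RotationSystem)

/-- The face permutation: traverse a dart to its head, and leave along the next dart in the
rotation there. Its cycles are the boundary walks of the faces. -/
def facePerm : Equiv.Perm G.Dart := R.next * G.flip

/-- The number of vertices of positive degree (each is a cycle of the rotation). -/
noncomputable def numVertices : ℕ := Nat.card (Quotient (Equiv.Perm.SameCycle.setoid R.next))

/-- The number of faces, counted in each connected component that has an edge separately. -/
noncomputable def numFaces : ℕ := Nat.card (Quotient (Equiv.Perm.SameCycle.setoid R.facePerm))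

/-- The number of connected components that have an edge: the orbits of the darts under the group
generated by the rotation and the flip. -/
noncomputable def numComponents : ℕ :=
  Nat.card (MulAction.orbitRel.Quotient (Subgroup.closure {R.next, G.flip}) G.Dart)

/-- The surface is a sphere for every component: `|V| - |E| + |F| = 2 c`. (Each component satisfies
`|V| - |E| + |F| = 2 - 2 g` with a genus `g ≥ 0`, so equality for the sum means that all the
genera are zero. Isolated vertices carry no darts and are irrelevant for planarity.) -/
def IsPlane : Prop :=
  (R.numVertices : ℤ) - (G.edgeSet.ncard : ℤ) + (R.numFaces : ℤ) = 2 * (R.numComponents : ℤ)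

end RotationSystem

/-- A finite loopless multigraph is planar if it has a rotation system of genus zero, that is,
a combinatorial embedding in the sphere. -/
def IsPlanar (G : Graph α β) : Prop := ∃ R : G.RotationSystem, R.IsPlane

/-! ### Orientations and flows -/

/-- An orientation: each edge gets one of its ends as tail and the other one as head. -/
structure Orientation (G : Graph α β) where
  tail : G.edgeSet → α
  head : G.edgeSet → α
  isLink : ∀ e : G.edgeSet, G.IsLink e (tail e) (head e)

namespace Orientation

variable {G : Graph α β} (D : G.Orientation)

/-- The out-degree `d⁺(v)`. -/
noncomputable def outDegree (v : α) : ℕ := {e : G.edgeSet | D.tail e = v}.ncard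

/-- The in-degree `d⁻(v)`. -/
noncomputable def inDegree (v : α) : ℕ := {e : G.edgeSet | D.head e = v}.ncard

/-- A modulo `m`-orientation: `d⁺(v) - d⁻(v) ≡ 0 (mod m)` at each vertex. -/
def IsModulo (m : ℕ) : Prop :=
  ∀ v ∈ G.vertexSet, (D.outDegree v : ℤ) - (D.inDegree v : ℤ) ≡ 0 [ZMOD m]

/-- An integer flow on the orientation: at each vertex the outflow equals the inflow. -/
def IsFlow (f : G.edgeSet → ℤ) : Prop :=
  ∀ v ∈ G.vertexSet,
    ∑ᶠ e ∈ {e : G.edgeSet | D.tail e = v}, f e = ∑ᶠ e ∈ {e : G.edgeSet | D.head e = v}, f e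

end Orientation

/-- `G` has a modulo `m`-orientation. -/
def HasModuloOrientation (G : Graph α β) (m : ℕ) : Prop := ∃ D : G.Orientation, D.IsModulo m

/-- `G` has a circular `a/b`-flow (for `a ≥ 2b > 0`): an integer flow with all values in
`{±b, ±(b+1), …, ±(a-b)}`. -/
def HasCircularFlow (G : Graph α β) (a b : ℕ) : Prop :=
  ∃ (D : G.Orientation) (f : G.edgeSet → ℤ),
    D.IsFlow f ∧ ∀ e, (b : ℤ) ≤ |f e| ∧ |f e| ≤ (a : ℤ) - (b : ℤ)

end Graph

set_option linter.unusedSectionVars false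
set_option linter.unusedSimpArgs false

/-! The proof works with a stronger property that survives induction. A multigraph is called
strongly connected modulo five if every zero-sum boundary with values in `ZMod 5` is the net
out-degree of some orientation. If `X` has this property, then a balanced orientation of the graph
with `X` contracted extends to the whole graph, since `X` can absorb any zero-sum error. An
orientation also survives undoing a lift, where edges `xv`, `vy` were replaced by one edge `xy`: the
new edge is rerouted through `v`.

The core is `stronglyConn_of_dense`: a planar multigraph is strongly connected as soon as every
vertex partition into `t` parts has at least `bound t` crossing edges. Here `bound t` is `(11t -
19)/2` rounded up, raised to 4 and 8 at `t = 2, 3`, because triple edges and triangles with seven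
edges meet the linear bound and still fail. In a vertex-minimal counterexample no set of at least
two vertices is strongly connected, or it could be contracted. Hence every proper subset with at
least two vertices has a partition with too few crossing edges, and refining partitions by these
shows that all partitions but the trivial and the discrete one have slack. The slack pays for one or
two lifts before a contraction, which excludes heavy triangles, four-cycles and five-cycles that
have suitable common neighbours outside. Density and Euler's inequality give the faces a positive
total charge. Heavy triangles are the only faces of positive charge, and the excluded configurations
let them send it away so that every face ends with charge at most 0, a contradiction.

The theorem follows by induction on the number of edges (`balanced_of_oddConn`). Loops and cut
vertices split off. At a vertex of even degree two edges on a common face are lifted, and uncrossing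
11-edge cuts shows that some such lift keeps all odd cuts at size at least 11. If all degrees are
odd, they are at least 11. A smallest nonempty set with at most 10 leaving edges is then dense,
hence strongly connected, and is contracted.

Planarity is used in MacLane's form, as a family of cycles with sum zero that spans the cycle space
and uses each edge at most twice. This form makes deletion, contraction and lifting linear algebra.
A rotation system of genus zero provides such a family by comparing dimensions. Finally, a modulo
5-orientation is turned into an integer flow with values 2 and -3 by Hall's theorem. -/

namespace PlanarFlow

open Finset

section

variable {V : Type*} [DecidableEq V]

/-! ### Sums of signs modulo five -/

/-- `SignSum k a`: the residue `a` is a sum of `k` terms, each equal to `1` or `-1`. -/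
def SignSum : ℕ → ZMod 5 → Prop
  | 0, a => a = 0
  | k + 1, a => SignSum k (a - 1) ∨ SignSum k (a + 1)

instance SignSum.decidable : ∀ (k : ℕ) (a : ZMod 5), Decidable (SignSum k a)
  | 0, a => inferInstanceAs (Decidable (a = 0))
  | k + 1, a =>
    have := SignSum.decidable k (a - 1)
    have := SignSum.decidable k (a + 1)
    inferInstanceAs (Decidable (SignSum k (a - 1) ∨ SignSum k (a + 1)))

theorem SignSum.neg {k : ℕ} : ∀ {a : ZMod 5}, SignSum k a → SignSum k (-a) := by
  induction k with
  | zero => intro a h; simp only [SignSum] at *; simp [h]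
  | succ k ih =>
    intro a h
    rcases h with h | h
    · right; have := ih h; rwa [neg_sub', sub_neg_eq_add] at this
    · left; have := ih h; rwa [neg_add'] at this

theorem SignSum.split {k l : ℕ} :
    ∀ {a : ZMod 5}, SignSum (k + l) a → ∃ b, SignSum k b ∧ SignSum l (a - b) := by
  induction k with
  | zero => intro a h; exact ⟨0, rfl, by simpa using h⟩
  | succ k ih =>
    intro a h
    rw [Nat.succ_add] at h
    rcases h with h | h
    · obtain ⟨b, hb, hb'⟩ := ih h
      refine ⟨b + 1, Or.inl (by simpa using hb), ?_⟩
      rwa [show a - (b + 1) = a - 1 - b by ring]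
    · obtain ⟨b, hb, hb'⟩ := ih h
      refine ⟨b - 1, Or.inr (by simpa using hb), ?_⟩
      rwa [show a - (b - 1) = a + 1 - b by ring]

/-- When a contracted set is expanded again, the net flow between it and an outside vertex must be
distributed over the edges to its single vertices. -/
theorem SignSum.split_sum {ι : Type*} [DecidableEq ι] (X : Finset ι) (k : ι → ℕ) :
    ∀ {a : ZMod 5}, SignSum (∑ x ∈ X, k x) a →
      ∃ h : ι → ZMod 5, (∀ x ∈ X, SignSum (k x) (h x)) ∧ ∑ x ∈ X, h x = a := by
  induction X using Finset.induction_on with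
  | empty => intro a h; exact ⟨0, by simp, by simpa [SignSum] using h.symm⟩
  | insert i X hi ih =>
    intro a h
    rw [sum_insert hi] at h
    obtain ⟨b, hb, hb'⟩ := h.split
    obtain ⟨f, hf, hs⟩ := ih hb'
    refine ⟨Function.update f i b, ?_, ?_⟩
    · intro x hx
      rcases eq_or_ne x i with rfl | hne
      · simpa using hb
      · simpa [hne] using hf x ((mem_insert.1 hx).resolve_left hne)
    · rw [sum_insert hi, Function.update_self, sum_congr rfl
        (fun x hx => Function.update_of_ne (ne_of_mem_of_not_mem hx hi) _ _), hs]
      ring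

/-- Four signs sum to 0, ±2 or ±4, which are all five residues. -/
theorem signSum_of_four_le {k : ℕ} (hk : 4 ≤ k) : ∀ a : ZMod 5, SignSum k a := by
  induction k, hk using Nat.le_induction with
  | base => decide
  | succ k _ ih => intro a; exact Or.inl (ih _)

/-- Three signs sum to ±1 or ±3, so a triple edge misses only the value 0. -/
theorem signSum_three : ∀ a : ZMod 5, a ≠ 0 → SignSum 3 a := by decide

theorem exists_signSum (k : ℕ) : SignSum k (k : ZMod 5) := by
  induction k with
  | zero => simp [SignSum]
  | succ k ih => left; simpa using ih

/-- For `k ≤ 4` the `k + 1` sums `-k, -k + 2, …, k` are distinct modulo five, so `4 - k` residues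
are missed. For larger `k` the truncated subtraction gives the correct value 0. -/
theorem card_not_signSum (k : ℕ) (c : ZMod 5) :
    (univ.filter fun u : ZMod 5 => ¬ SignSum k (u + c)).card ≤ 4 - k := by
  by_cases hk : 4 ≤ k
  · rw [filter_eq_empty_iff.2]
    · simp
    · intro u _; simpa using signSum_of_four_le hk _
  · have : k = 0 ∨ k = 1 ∨ k = 2 ∨ k = 3 := by omega
    rcases this with rfl | rfl | rfl | rfl <;> revert c <;> decide

/-! ### Realizing boundaries -/

/-- An orientation of the multigraph with multiplicities `m` on the vertex set `X` has net
out-degrees `β` modulo five; `g x y` is the net number of edges oriented from `x` to `y`. -/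
def Realizes (m : V → V → ℕ) (X : Finset V) (β : V → ZMod 5) : Prop :=
  ∃ g : V → V → ZMod 5, (∀ x y, g x y = - g y x) ∧
    (∀ x ∈ X, ∀ y ∈ X, x ≠ y → SignSum (m x y) (g x y)) ∧ ∀ x ∈ X, ∑ y ∈ X, g x y = β x

/-- Strong connectivity modulo five: every zero-sum boundary is realized. -/
def StronglyConn (m : V → V → ℕ) (X : Finset V) : Prop :=
  ∀ β : V → ZMod 5, ∑ x ∈ X, β x = 0 → Realizes m X β

/-- Flow of value `t` along the single edge from `a` to `b`. -/
def edgeFlow (a b : V) (t : ZMod 5) (u w : V) : ZMod 5 :=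
  (if u = a ∧ w = b then t else 0) - (if u = b ∧ w = a then t else 0)

theorem edgeFlow_antisymm (a b : V) (t : ZMod 5) (u w : V) :
    edgeFlow a b t u w = - edgeFlow a b t w u := by
  simp only [edgeFlow, and_comm, neg_sub]

theorem sum_edgeFlow {a b : V} {X : Finset V} (ha : a ∈ X) (hb : b ∈ X) (t : ZMod 5) (u : V) :
    ∑ w ∈ X, edgeFlow a b t u w = (if u = a then t else 0) - (if u = b then t else 0) := by
  simp only [edgeFlow, sum_sub_distrib]
  congr 1
  · by_cases h : u = a <;> simp [h, hb]
  · by_cases h : u = b <;> simp [h, ha]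

/-- The multiplicity function of a single edge. -/
def pairInd (a b u w : V) : ℕ := if (u = a ∧ w = b) ∨ (u = b ∧ w = a) then 1 else 0

theorem pairInd_symm (a b u w : V) : pairInd a b u w = pairInd a b w u := by
  unfold pairInd
  congr 1
  exact propext ⟨by tauto, by tauto⟩

/-- The second multiplicity function arises from the first by lifting a pair of edges `xv`, `vy`
to an edge `xy`. -/
def IsLift (m m' : V → V → ℕ) (x v y : V) : Prop :=
  ∀ u w, m u w + pairInd x y u w = m' u w + pairInd x v u w + pairInd v y u w

/-- One copy of the edge `xy` is replaced by the path `x v y` in the same direction. This keeps the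
net degrees of `x` and `y`, and `v` gains one edge in and one edge out. -/
theorem Realizes.of_lift {m m' : V → V → ℕ} (hsym : ∀ u w, m u w = m w u) {x v y : V}
    (hl : IsLift m m' x v y) (hxv : x ≠ v) (hvy : v ≠ y) (hxy : x ≠ y) {A : Finset V}
    (hx : x ∈ A) (hv : v ∈ A) (hy : y ∈ A) {β : V → ZMod 5} (h : Realizes m' A β) :
    Realizes m A β := by
  obtain ⟨g, hg, hm, hs⟩ := h
  have e1 : m' x y = m x y + 1 := by
    have := hl x y
    simp [pairInd, hxv, hxy, hvy.symm, hxy.symm] at this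
    omega
  have e2 : m x v = m' x v + 1 := by
    have := hl x v
    simpa [pairInd, hxv, hxy, hvy] using this
  have e3 : m v y = m' v y + 1 := by
    have := hl v y
    simpa [pairInd, hxv.symm, hxy.symm, hvy] using this
  -- The sign `ε` is the direction of the copy of `xy` that came from the lift.
  have key : ∃ ε : ZMod 5, (ε = 1 ∨ ε = -1) ∧ SignSum (m x y) (g x y - ε) := by
    have := hm x hx y hy hxy
    rw [e1] at this
    rcases this with h | h
    · exact ⟨1, Or.inl rfl, h⟩
    · exact ⟨-1, Or.inr rfl, by simpa using h⟩
  obtain ⟨ε, hε, hadm⟩ := key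
  have hstep : ∀ {k : ℕ} {a : ZMod 5}, SignSum k a → SignSum (k + 1) (a + ε) := by
    intro k a h
    rcases hε with rfl | rfl
    · exact Or.inl (by simpa using h)
    · exact Or.inr (by simpa using h)
  set G : V → V → ZMod 5 := fun u w =>
    g u w - edgeFlow x y ε u w + edgeFlow x v ε u w + edgeFlow v y ε u w with hG
  have hanti : ∀ u w, G u w = - G w u := by
    intro u w
    simp only [hG]
    rw [hg u w, edgeFlow_antisymm x y _ u w, edgeFlow_antisymm x v _ u w,
      edgeFlow_antisymm v y _ u w]
    ring
  have c1 : SignSum (m x y) (G x y) := by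
    simpa [hG, edgeFlow, hxv, hvy, hxy, hxv.symm, hvy.symm, hxy.symm] using hadm
  have c2 : SignSum (m x v) (G x v) := by
    rw [e2]
    simpa [hG, edgeFlow, hxv, hvy, hxy, hxv.symm, hvy.symm, hxy.symm]
      using hstep (hm x hx v hv hxv)
  have c3 : SignSum (m v y) (G v y) := by
    rw [e3]
    simpa [hG, edgeFlow, hxv, hvy, hxy, hxv.symm, hvy.symm, hxy.symm]
      using hstep (hm v hv y hy hvy)
  have rev : ∀ {u w}, SignSum (m u w) (G u w) → SignSum (m w u) (G w u) := by
    intro u w h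
    rw [hsym, hanti]; exact h.neg
  refine ⟨G, hanti, ?_, ?_⟩
  · intro u hu w hw huw
    by_cases d1 : u = x ∧ w = y
    · rw [d1.1, d1.2]; exact c1
    by_cases d2 : u = y ∧ w = x
    · rw [d2.1, d2.2]; exact rev c1
    by_cases d3 : u = x ∧ w = v
    · rw [d3.1, d3.2]; exact c2
    by_cases d4 : u = v ∧ w = x
    · rw [d4.1, d4.2]; exact rev c2
    by_cases d5 : u = v ∧ w = y
    · rw [d5.1, d5.2]; exact c3
    by_cases d6 : u = y ∧ w = v
    · rw [d6.1, d6.2]; exact rev c3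
    have h2 := hl u w
    simp only [pairInd, d1, d2, d3, d4, d5, d6, or_self, if_false, add_zero] at h2
    simpa [hG, edgeFlow, d1, d2, d3, d4, d5, d6, h2] using hm u hu w hw huw
  · intro u hu
    simp only [hG, sum_add_distrib, sum_sub_distrib, sum_edgeFlow hx hy, sum_edgeFlow hx hv,
      sum_edgeFlow hv hy, hs u hu]
    ring

/-! ### Contraction of a vertex set to one of its elements -/

/-- The multiplicities after contracting `X` to the vertex `r`. -/
def contract (m : V → V → ℕ) (X : Finset V) (r u w : V) : ℕ :=
  ∑ x ∈ (if u = r then X else {u}), ∑ y ∈ (if w = r then X else {w}), m x y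

theorem contract_symm {m : V → V → ℕ} (hsym : ∀ u w, m u w = m w u) (X : Finset V) (r u w : V) :
    contract m X r u w = contract m X r w u := by
  unfold contract
  rw [sum_comm]
  exact sum_congr rfl fun _ _ => sum_congr rfl fun _ _ => hsym _ _

/-- The orientation of the contracted graph fixes all edges not inside `X`. What is still missing at
the vertices of `X` has sum zero, because the contracted vertex has the right net degree, so an
orientation inside `X` supplies it. -/
theorem Realizes.of_contract {m : V → V → ℕ} (hsym : ∀ u w, m u w = m w u) {A X : Finset V}
    (hXA : X ⊆ A) {r : V} (hr : r ∈ X) (hX : StronglyConn m X) {β β' : V → ZMod 5}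
    (hβr : β' r = ∑ x ∈ X, β x) (hβ : ∀ u ∈ A, u ∉ X → β' u = β u)
    (h : Realizes (contract m X r) (insert r (A \ X)) β') : Realizes m A β := by
  obtain ⟨g, hg, hm, hs⟩ := h
  have hrA : r ∉ A \ X := by simp [hr]
  have hne : ∀ y ∈ A \ X, y ≠ r := fun y hy e => hrA (e ▸ hy)
  have h1 : ∀ y, ∃ k : V → ZMod 5, y ∈ A \ X →
      (∀ x ∈ X, SignSum (m x y) (k x)) ∧ ∑ x ∈ X, k x = g r y := by
    intro y
    by_cases hy : y ∈ A \ X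
    · have := hm r (mem_insert_self _ _) y (mem_insert_of_mem hy) (hne y hy).symm
      simp only [contract, hne y hy, if_true, if_false, sum_singleton] at this
      obtain ⟨k, hk⟩ := this.split_sum
      exact ⟨k, fun _ => hk⟩
    · exact ⟨0, fun h => absurd h hy⟩
  choose k hk using h1
  obtain ⟨gX, hgX, hmX, hsX⟩ := hX (fun x => β x - ∑ y ∈ A \ X, k y x) (by
    rw [sum_sub_distrib, sum_comm, sum_congr rfl (fun y hy => (hk y hy).2), ← hβr,
      ← hs r (mem_insert_self _ _), sum_insert hrA]
    -- Antisymmetry gives `2 * g r r = 0`, and 2 is invertible modulo five. Diagonal values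
    -- therefore never contribute to the row sums.
    have : g r r = 0 := by
      have := hg r r
      have h2 : (2 : ZMod 5) * g r r = 0 := by linear_combination this
      revert h2; generalize g r r = a; revert a; decide
    rw [this]; ring)
  refine ⟨fun x y => if x ∈ X then (if y ∈ X then gX x y else k y x)
      else (if y ∈ X then - k x y else g x y), ?_, ?_, ?_⟩
  · intro x y
    by_cases hx : x ∈ X <;> by_cases hy : y ∈ X <;> simp only [hx, hy, if_true, if_false, neg_neg]
    · exact hgX x y
    · exact hg x y
  · intro x hx y hy hxy
    by_cases hxX : x ∈ X <;> by_cases hyX : y ∈ X <;> simp only [hxX, hyX, if_true, if_false]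
    · exact hmX x hxX y hyX hxy
    · exact (hk y (by simp [hy, hyX])).1 x hxX
    · rw [hsym]; exact ((hk x (by simp [hx, hxX])).1 y hyX).neg
    · have hx' : x ∈ A \ X := by simp [hx, hxX]
      have hy' : y ∈ A \ X := by simp [hy, hyX]
      have := hm x (mem_insert_of_mem hx') y (mem_insert_of_mem hy') hxy
      simpa [contract, hne x hx', hne y hy'] using this
  · intro x hx
    rw [← sum_sdiff hXA]
    by_cases hxX : x ∈ X
    · simp only [hxX, if_true]
      rw [sum_congr rfl (fun y hy => if_neg (mem_sdiff.1 hy).2),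
        sum_congr rfl (fun y (hy : y ∈ X) => if_pos hy), hsX x hxX]
      ring
    · have hx' : x ∈ A \ X := by simp [hx, hxX]
      simp only [hxX, if_false]
      rw [sum_congr rfl (fun y hy => if_neg (mem_sdiff.1 hy).2),
        sum_congr rfl (fun y (hy : y ∈ X) => if_pos hy), sum_neg_distrib, (hk x hx').2,
        ← hβ x hx hxX, ← hs x (mem_insert_of_mem hx'), sum_insert hrA, hg x r]
      ring

theorem StronglyConn.of_contract {m : V → V → ℕ} (hsym : ∀ u w, m u w = m w u) {A X : Finset V}
    (hXA : X ⊆ A) {r : V} (hr : r ∈ X) (hX : StronglyConn m X)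
    (h : StronglyConn (contract m X r) (insert r (A \ X))) : StronglyConn m A := by
  intro β hβ
  have hrA : r ∉ A \ X := by simp [hr]
  refine Realizes.of_contract hsym hXA hr hX
    (β' := fun u => if u = r then ∑ x ∈ X, β x else β u) (by simp) ?_ (h _ ?_)
  · intro u _ huX
    rw [if_neg]; rintro rfl; exact huX hr
  · rw [sum_insert hrA, if_pos rfl, sum_congr rfl
      (fun y hy => if_neg (fun e : y = r => hrA (e ▸ hy))), add_comm, sum_sdiff hXA, hβ]

/-- A strongly connected set has an edge across each of its cuts. -/
theorem StronglyConn.exists_edge {m : V → V → ℕ} {X Y : Finset V} (h : StronglyConn m X)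
    (hYX : Y ⊆ X) (hY : Y.Nonempty) (hne : Y ≠ X) : ∃ x ∈ Y, ∃ y ∈ X \ Y, 0 < m x y := by
  by_contra! hcon
  obtain ⟨a, ha⟩ := hY
  obtain ⟨b, hb⟩ : (X \ Y).Nonempty := by
    rw [sdiff_nonempty]; intro h'; exact hne (hYX.antisymm h')
  have hbY := (mem_sdiff.1 hb).2
  have hbX := (mem_sdiff.1 hb).1
  have hab : a ≠ b := fun e => hbY (e ▸ ha)
  -- This boundary forces a net flow of 1 out of `Y`, which is impossible if no edge leaves `Y`.
  obtain ⟨g, hg, hm, hs⟩ := h (fun u => (if u = a then 1 else 0) - (if u = b then 1 else 0)) (by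
    simp [hYX ha, hbX])
  have h1 : ∑ x ∈ Y, ∑ y ∈ X, g x y = 1 := by
    rw [sum_congr rfl (fun x hx => hs x (hYX hx))]
    simp [ha, hbY]
  have h2 : ∑ x ∈ Y, ∑ y ∈ X \ Y, g x y = 0 := by
    refine sum_eq_zero fun x hx => sum_eq_zero fun y hy => ?_
    have hxy : x ≠ y := fun e => (mem_sdiff.1 hy).2 (e ▸ hx)
    have := hm x (hYX hx) y (mem_sdiff.1 hy).1 hxy
    rwa [Nat.le_zero.1 (hcon x hx y hy)] at this
  have h3 : ∑ x ∈ Y, ∑ y ∈ Y, g x y = 0 := by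
    have e : ∑ x ∈ Y, ∑ y ∈ Y, g x y = - ∑ x ∈ Y, ∑ y ∈ Y, g x y := by
      conv_lhs => rw [sum_comm]
      rw [← sum_neg_distrib]
      refine sum_congr rfl fun x _ => ?_
      rw [← sum_neg_distrib]
      exact sum_congr rfl fun y _ => hg y x
    generalize ∑ x ∈ Y, ∑ y ∈ Y, g x y = a at e
    revert a; decide
  have h4 : ∑ x ∈ Y, ∑ y ∈ X, g x y =
      ∑ x ∈ Y, ∑ y ∈ X \ Y, g x y + ∑ x ∈ Y, ∑ y ∈ Y, g x y := by
    rw [← sum_add_distrib]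
    exact sum_congr rfl fun x _ => (sum_sdiff hYX).symm
  rw [h1, h2, h3] at h4
  revert h4; decide

theorem stronglyConn_singleton (m : V → V → ℕ) (a : V) : StronglyConn m {a} := by
  intro β hβ
  refine ⟨0, by simp, ?_, ?_⟩
  · intro x hx y hy hxy
    exact absurd ((mem_singleton.1 hx).trans (mem_singleton.1 hy).symm) hxy
  · intro x hx
    rw [mem_singleton.1 hx]; simpa using hβ.symm

theorem exists_antisymm_signSum [Finite V] {m : V → V → ℕ} (hsym : ∀ u w, m u w = m w u) :
    ∃ g : V → V → ZMod 5, (∀ x y, g x y = - g y x) ∧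
      ∀ x y, x ≠ y → SignSum (m x y) (g x y) := by
  obtain ⟨n, ⟨e⟩⟩ := Finite.exists_equiv_fin V
  -- All edges are directed upwards in an enumeration of the vertices.
  refine ⟨fun x y => if e x < e y then m x y else if e y < e x then - m y x else 0, ?_, ?_⟩
  · intro x y
    rcases lt_trichotomy (e x) (e y) with h | h | h
    · simp [h, h.not_gt]
    · simp [h]
    · simp [h, h.not_gt]
  · intro x y hxy
    rcases lt_trichotomy (e x) (e y) with h | h | h
    · simpa [h] using exists_signSum _
    · exact absurd (e.injective h) hxy
    · simp only [h.not_gt, h, if_true, if_false]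
      rw [hsym]; exact (exists_signSum _).neg

theorem stronglyConn_pair {m : V → V → ℕ} {a b : V} (hab : a ≠ b) (h : 4 ≤ m a b)
    (h' : 4 ≤ m b a) : StronglyConn m {a, b} := by
  intro β hβ
  rw [sum_pair hab] at hβ
  refine ⟨edgeFlow a b (β a), edgeFlow_antisymm _ _ _, ?_, ?_⟩
  · intro x hx y hy hxy
    simp only [mem_insert, mem_singleton] at hx hy
    rcases hx with rfl | rfl <;> rcases hy with rfl | rfl
    · exact absurd rfl hxy
    · exact signSum_of_four_le h _
    · exact signSum_of_four_le h' _
    · exact absurd rfl hxy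
  · intro x hx
    rw [sum_edgeFlow (by simp) (by simp)]
    simp only [mem_insert, mem_singleton] at hx
    rcases hx with rfl | rfl
    · simp [hab]
    · simp [hab.symm]; linear_combination -hβ

end

section

variable {V : Type*} [DecidableEq V]

/-! ### Cycles of parallel classes -/

/-- The function `g` lives on the chords and vanishes on the cycle, while `t i` is the flow along
the `i`-th class of the cycle. A length of at least three keeps the two directions of a class apart.
-/
theorem realizes_cycle {n : ℕ} {m : V → V → ℕ} (hsym : ∀ u w, m u w = m w u)
    {x : Fin (n + 3) → V} (hx : Function.Injective x) {g : V → V → ZMod 5}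
    (hg : ∀ u w, g u w = - g w u)
    (hadm : ∀ i j, i ≠ j → j ≠ i + 1 → i ≠ j + 1 → SignSum (m (x i) (x j)) (g (x i) (x j)))
    (hzero : ∀ i, g (x i) (x (i + 1)) = 0) {t : Fin (n + 3) → ZMod 5}
    (ht : ∀ i, SignSum (m (x i) (x (i + 1))) (t i)) {β : V → ZMod 5}
    (hβ : ∀ i, t i - t (i - 1) + ∑ j, g (x i) (x j) = β (x i)) :
    Realizes m (univ.image x) β := by
  have h2 : ∀ i : Fin (n + 3), i + 1 + 1 ≠ i := by
    intro i h
    rw [add_assoc] at h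
    have := congrArg Fin.val (add_eq_left.1 h)
    simp [Fin.val_add, Nat.mod_eq_of_lt] at this
  have hval : ∀ i j, ∑ k, edgeFlow (x k) (x (k + 1)) (t k) (x i) (x j) =
      (if j = i + 1 then t i else 0) - (if i = j + 1 then t j else 0) := by
    intro i j
    simp only [edgeFlow, hx.eq_iff, sum_sub_distrib]
    congr 1
    · rw [sum_eq_single i]
      · simp
      · intro k _ hk; simp [hk.symm]
      · simp
    · rw [sum_eq_single j]
      · simp
      · intro k _ hk; simp [hk.symm]
      · simp
  set G : V → V → ZMod 5 := fun u w => g u w + ∑ k, edgeFlow (x k) (x (k + 1)) (t k) u w with hG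
  have hanti : ∀ u w, G u w = - G w u := by
    intro u w
    simp only [hG]
    rw [hg u w, neg_add, ← sum_neg_distrib]
    congr 1
    exact sum_congr rfl fun k _ => edgeFlow_antisymm _ _ _ _ _
  have hnext : ∀ i, SignSum (m (x i) (x (i + 1))) (G (x i) (x (i + 1))) := by
    intro i
    simp only [hG]
    rw [hzero, hval, if_pos rfl, if_neg (h2 i).symm]
    simpa using ht i
  refine ⟨G, hanti, ?_, ?_⟩
  · intro u hu w hw huw
    obtain ⟨i, -, rfl⟩ := mem_image.1 hu
    obtain ⟨j, -, rfl⟩ := mem_image.1 hw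
    by_cases h1 : j = i + 1
    · rw [h1]; exact hnext i
    by_cases h3 : i = j + 1
    · rw [h3, hsym, hanti]; exact (hnext j).neg
    · simp only [hG]
      rw [hval, if_neg h1, if_neg h3]
      simpa using hadm i j (fun e => huw (congrArg x e)) h1 h3
  · intro u hu
    obtain ⟨i, -, rfl⟩ := mem_image.1 hu
    rw [sum_image hx.injOn, ← hβ i]
    simp only [hG, hval, sum_add_distrib, sum_sub_distrib]
    have h4 : ∀ j, (i = j + 1) ↔ (j = i - 1) := fun j => by
      rw [eq_sub_iff_add_eq, eq_comm]
    simp [h4]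
    ring

theorem exists_cyclic_potential {n : ℕ} (γ : Fin (n + 1) → ZMod 5) (h : ∑ i, γ i = 0) :
    ∃ t : Fin (n + 1) → ZMod 5, ∀ i, t i - t (i - 1) = γ i := by
  refine ⟨fun i => ∑ j with j ≤ i, γ j, fun i => ?_⟩
  refine Fin.cases ?_ (fun k => ?_) i
  · have h0 : (0 : Fin (n + 1)) - 1 = Fin.last n := by
      rw [zero_sub, neg_eq_iff_eq_neg, eq_comm, neg_eq_iff_add_eq_zero]; simp
    simp only [h0]
    rw [filter_true_of_mem (s := univ) (p := fun j => j ≤ Fin.last n)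
      (fun j _ => Fin.le_last j), h]
    simp [filter_eq']
  · have h1 : k.succ - 1 = k.castSucc := by
      rw [sub_eq_iff_eq_add]; simp
    simp only [h1]
    have : (univ.filter fun j => j ≤ k.succ) =
        insert k.succ (univ.filter fun j => j ≤ k.castSucc) := by
      ext j
      simp only [mem_filter, mem_univ, true_and, mem_insert, Fin.le_def, Fin.ext_iff]
      simp; omega
    rw [this, sum_insert]
    · ring
    · simp [Fin.le_def]

/-- Class `i` forbids at most `4 - k i` of the five shifts, so fewer than five are forbidden in
total. -/
theorem exists_shift_signSum {ι : Type*} [Fintype ι] (k : ι → ℕ) (c : ι → ZMod 5)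
    (h : ∑ i, (4 - k i) ≤ 4) : ∃ u, ∀ i, SignSum (k i) (u + c i) := by
  by_contra! hcon
  have : (univ : Finset (ZMod 5)) ⊆
      univ.biUnion fun i => univ.filter fun u => ¬ SignSum (k i) (u + c i) := by
    intro u _
    simpa using hcon u
  have h1 := card_le_card this
  have h2 := h1.trans (card_biUnion_le)
  have h3 := h2.trans (sum_le_sum fun i _ => card_not_signSum (k i) (c i))
  have h4 := h3.trans h
  revert h4; decide

/-- Fixing admissible values off a cycle, the boundary left for the cycle is a cyclic difference. -/
theorem exists_cycle_base [Finite V] {n : ℕ} {m : V → V → ℕ} (hsym : ∀ u w, m u w = m w u)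
    {x : Fin (n + 3) → V} (hx : Function.Injective x) {β : V → ZMod 5}
    (hβ : ∑ u ∈ univ.image x, β u = 0) :
    ∃ (g : V → V → ZMod 5) (t : Fin (n + 3) → ZMod 5), (∀ u w, g u w = - g w u) ∧
      (∀ i j, i ≠ j → j ≠ i + 1 → i ≠ j + 1 → SignSum (m (x i) (x j)) (g (x i) (x j))) ∧
      (∀ i, g (x i) (x (i + 1)) = 0) ∧ ∀ i, t i - t (i - 1) + ∑ j, g (x i) (x j) = β (x i) := by
  classical
  rw [sum_image hx.injOn] at hβ
  obtain ⟨g₀, hg₀, hm₀⟩ := exists_antisymm_signSum hsym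
  let P : V → V → Prop := fun u w => ∃ i, (u = x i ∧ w = x (i + 1)) ∨ (w = x i ∧ u = x (i + 1))
  have hP : ∀ u w, P u w ↔ P w u := fun u w => exists_congr fun i => or_comm
  set g : V → V → ZMod 5 := fun u w => if P u w then 0 else g₀ u w with hgdef
  have hg : ∀ u w, g u w = - g w u := by
    intro u w
    simp only [hgdef, hP u w]
    split_ifs
    · simp
    · exact hg₀ u w
  obtain ⟨t, ht⟩ := exists_cyclic_potential (fun i => β (x i) - ∑ j, g (x i) (x j)) (by
    rw [sum_sub_distrib, hβ, zero_sub, neg_eq_zero]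
    have e : ∑ i, ∑ j, g (x i) (x j) = - ∑ i, ∑ j, g (x i) (x j) := by
      conv_lhs => rw [sum_comm]
      rw [← sum_neg_distrib]
      refine sum_congr rfl fun i _ => ?_
      rw [← sum_neg_distrib]
      exact sum_congr rfl fun j _ => hg _ _
    generalize ∑ i, ∑ j, g (x i) (x j) = a at e
    revert a; decide)
  refine ⟨g, t, hg, ?_, ?_, ?_⟩
  · intro i j hij h1 h2
    have : ¬ P (x i) (x j) := by
      rintro ⟨k, ⟨a, b⟩ | ⟨a, b⟩⟩
      · rw [← hx a] at b; exact h1 (hx b)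
      · rw [← hx a] at b; exact h2 (hx b)
    simp only [hgdef, this, if_false]
    exact hm₀ _ _ (fun e => hij (hx e))
  · intro i
    have : P (x i) (x (i + 1)) := ⟨i, Or.inl ⟨rfl, rfl⟩⟩
    simp only [hgdef, this, if_true]
  · intro i
    linear_combination ht i

/-- A cycle whose multiplicities fall short of four by at most four in total is strongly
connected. -/
theorem stronglyConn_cycle [Finite V] {n : ℕ} {m : V → V → ℕ} (hsym : ∀ u w, m u w = m w u)
    {x : Fin (n + 3) → V} (hx : Function.Injective x)
    (h : ∑ i, (4 - m (x i) (x (i + 1))) ≤ 4) : StronglyConn m (univ.image x) := by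
  intro β hβ
  obtain ⟨g, t, hg, h1, h2, h3⟩ := exists_cycle_base hsym hx hβ
  -- Sending `u` more units around the whole cycle does not change the boundary.
  obtain ⟨u, hu⟩ := exists_shift_signSum _ t h
  refine realizes_cycle hsym hx hg h1 h2 hu fun i => ?_
  linear_combination h3 i

/-- Reversing a single edge changes the sum by 2 or -2. -/
theorem SignSum.exists_neighbor {k : ℕ} (hk : 0 < k) {c : ZMod 5} (h : SignSum k c) :
    ∃ δ : ZMod 5, δ ≠ 0 ∧ SignSum k (c + δ) := by
  obtain ⟨k, rfl⟩ := Nat.exists_eq_succ_of_ne_zero hk.ne'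
  rcases h with h | h
  · exact ⟨-2, by decide, Or.inr (by convert h using 1; ring)⟩
  · exact ⟨2, by decide, Or.inl (by convert h using 1; ring)⟩

/-- A five-cycle of triple edges with a chord is strongly connected. -/
theorem stronglyConn_five_cycle_chord [Finite V] {m : V → V → ℕ} (hsym : ∀ u w, m u w = m w u)
    {x : Fin 5 → V} (hx : Function.Injective x) (h : ∀ i, 3 ≤ m (x i) (x (i + 1)))
    (k : Fin 5) (hk : 0 < m (x k) (x (k + 2))) : StronglyConn m (univ.image x) := by
  intro β hβ
  obtain ⟨g, t, hg, h1, h2, h3⟩ := exists_cycle_base (n := 2) hsym hx hβ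
  have hadm : ∀ i (a : ZMod 5), a ≠ 0 → SignSum (m (x i) (x (i + 1))) a := by
    intro i a ha
    rcases (h i).eq_or_lt with e | e
    · rw [← e]; exact signSum_three a ha
    · exact signSum_of_four_le e a
  -- A triple edge forbids only one shift. If all five shifts are forbidden, the values of `t`
  -- exhaust `ZMod 5`, and their sum is `0 + 1 + 2 + 3 + 4 = 0`.
  have hsum : ∀ t : Fin 5 → ZMod 5, (∀ u, ∃ i, u + t i = 0) → ∑ i, t i = 0 := by
    intro t ht
    have hs : Function.Surjective t := fun a => by
      obtain ⟨i, hi⟩ := ht (-a)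
      exact ⟨i, by linear_combination hi⟩
    have hb : Function.Bijective t :=
      (Fintype.bijective_iff_surjective_and_card t).2 ⟨hs, by simp [ZMod.card]⟩
    rw [hb.sum_comp (fun a => a)]
    decide
  by_cases c1 : ∃ u, ∀ i, u + t i ≠ 0
  · obtain ⟨u, hu⟩ := c1
    refine realizes_cycle (n := 2) hsym hx hg h1 h2 (fun i => hadm i _ (hu i)) fun i => ?_
    linear_combination h3 i
  have f1 : ∀ k : Fin 5, k ≠ k + 2 := by decide
  have f2 : ∀ k : Fin 5, k + 2 ≠ k + 1 := by decide
  have f3 : ∀ k : Fin 5, k ≠ k + 2 + 1 := by decide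
  have f4 : ∀ i k : Fin 5, ¬ (i = k ∧ i + 1 = k + 2) := by decide
  have f5 : ∀ i k : Fin 5, ¬ (i = k + 2 ∧ i + 1 = k) := by decide
  have f6 : ∀ δ : ZMod 5, δ ≠ 0 → - δ - δ ≠ 0 := by decide
  obtain ⟨δ, hδ, hδ'⟩ := (h1 k (k + 2) (f1 k) (f2 k) (f3 k)).exists_neighbor hk
  -- Reversing an edge of the chord sends `δ` more from `x k` to `x (k + 2)`, which the two cycle
  -- edges between them compensate. The sum of the cycle values changes by `-2δ ≠ 0`, so `t` and
  -- `t'` cannot both be blocked.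
  set t' : Fin 5 → ZMod 5 := fun i => t i - (if i = k then δ else 0) - (if i = k + 1 then δ else 0)
    with ht'
  by_cases c2 : ∃ u, ∀ i, u + t' i ≠ 0
  · obtain ⟨u, hu⟩ := c2
    refine realizes_cycle (n := 2) hsym hx
      (g := fun a b => g a b + edgeFlow (x k) (x (k + 2)) δ a b) ?_ ?_ ?_
      (fun i => hadm i _ (hu i)) fun i => ?_
    · intro a b
      rw [hg a b, edgeFlow_antisymm]; ring
    · intro i j hij a b
      simp only [edgeFlow, hx.eq_iff]
      by_cases d1 : i = k ∧ j = k + 2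
      · obtain ⟨rfl, rfl⟩ := d1
        have : i ≠ i + 2 := hij
        simpa [this] using hδ'
      by_cases d2 : i = k + 2 ∧ j = k
      · obtain ⟨rfl, rfl⟩ := d2
        have : j ≠ j + 2 := hij.symm
        simp only [this, and_false, if_false, and_self, if_true, zero_sub]
        rw [hsym, hg, ← neg_add]; exact hδ'.neg
      · simpa [d1, d2] using h1 i j hij a b
    · intro i
      have d1 : ¬ (i = k ∧ i + 1 = k + 2) := f4 i k
      have d2 : ¬ (i = k + 2 ∧ i + 1 = k) := f5 i k
      simp [edgeFlow, hx.eq_iff, d1, d2, h2]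
    · have e := sum_edgeFlow (X := univ.image x) (mem_image_of_mem x (mem_univ k))
        (mem_image_of_mem x (mem_univ (k + 2))) δ (x i)
      rw [sum_image hx.injOn] at e
      rw [sum_add_distrib, e, ← h3 i]
      simp only [ht', hx.eq_iff]
      have e1 : (i - 1 = k) ↔ (i = k + 1) := sub_eq_iff_eq_add
      have e2 : (i - 1 = k + 1) ↔ (i = k + 2) := by
        rw [sub_eq_iff_eq_add, add_assoc]; rfl
      simp only [e1, e2]
      ring
  · push Not at c1 c2
    have s1 := hsum t c1
    have s2 := hsum t' c2
    simp only [ht', sum_sub_distrib, s1] at s2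
    simp at s2
    exact absurd s2 (f6 δ hδ)

end

section

variable {V E : Type*} [Fintype V] [DecidableEq V] [Fintype E] [DecidableEq E]

/-! ### Two-covers of the cycle space -/

/-- A family of vectors, in which each coordinate occurs at most twice, with sum zero, that spans
the space described by `Z`. -/
structure Covers (Z : (E → ZMod 2) → Prop) {k : ℕ} (b : Fin k → E → ZMod 2) : Prop where
  mem : ∀ i, Z (b i)
  sum_eq : ∑ i, b i = 0
  span : ∀ z, Z z → ∃ c : Fin k → ZMod 2, z = ∑ i, c i • b i
  two : ∀ e, (univ.filter fun i => b i e ≠ 0).card ≤ 2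

theorem zmod_two_eq_one : ∀ {a : ZMod 2}, a ≠ 0 → a = 1 := by decide

theorem fun_add_self {W : Type*} (f : W → ZMod 2) : f + f = 0 := by
  ext w; exact CharTwo.add_self_eq_zero _

/-- This is the union of two faces. Since the members sum to zero, `ℓ` is nonzero on none or on
exactly two of them; in the second case one member is replaced by the sum of the two and the other
one by zero. -/
theorem Covers.merge {Z : (E → ZMod 2) → Prop} (hadd : ∀ y z, Z y → Z z → Z (y + z))
    {k : ℕ} {b : Fin k → E → ZMod 2} (h : Covers Z b) (ℓ : (E → ZMod 2) →ₗ[ZMod 2] ZMod 2)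
    (hℓ : (univ.filter fun i => ℓ (b i) ≠ 0).card ≤ 2) :
    ∃ b' : Fin k → E → ZMod 2, Covers (fun z => Z z ∧ ℓ z = 0) b' := by
  by_cases h0 : ∀ i, ℓ (b i) = 0
  · exact ⟨b, fun i => ⟨h.mem i, h0 i⟩, h.sum_eq, fun z hz => h.span z hz.1, h.two⟩
  push Not at h0
  obtain ⟨i, hi⟩ := h0
  have hsum : ∑ l, ℓ (b l) = 0 := by rw [← map_sum, h.sum_eq, map_zero]
  obtain ⟨j, hji, hj⟩ : ∃ j, j ≠ i ∧ ℓ (b j) ≠ 0 := by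
    by_contra! hcon
    rw [sum_eq_single i (fun l _ hl => hcon l hl) (by simp)] at hsum
    exact hi hsum
  have honly : ∀ l, l ≠ i → l ≠ j → ℓ (b l) = 0 := by
    intro l hli hlj
    by_contra hl
    have : ({i, j, l} : Finset (Fin k)).card ≤ 2 := by
      refine (card_le_card ?_).trans hℓ
      intro a ha
      simp only [mem_insert, mem_singleton] at ha
      rcases ha with rfl | rfl | rfl <;> simp [*]
    rw [card_eq_three.2 ⟨i, j, l, hji.symm, hli.symm, hlj.symm, rfl⟩] at this
    omega
  have hi1 := zmod_two_eq_one hi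
  have hj1 := zmod_two_eq_one hj
  -- Adding `δ l • b j` turns `b i` into `b i + b j` and `b j` into 0.
  set δ : Fin k → ZMod 2 := fun l => (if l = i then 1 else 0) + (if l = j then 1 else 0) with hδ
  have hδi : δ i = 1 := by simp [hδ, hji.symm]
  have hδj : δ j = 1 := by simp [hδ, hji]
  have hδo : ∀ l, l ≠ i → l ≠ j → δ l = 0 := fun l h1 h2 => by simp [hδ, h1, h2]
  have hcomb : ∀ c : Fin k → ZMod 2, ∑ l, c l • (b l + δ l • b j) =
      ∑ l, c l • b l + (c i + c j) • b j := by
    intro c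
    simp only [smul_add, sum_add_distrib, smul_smul, ← sum_smul]
    congr 2
    simp [hδ, mul_add, sum_add_distrib]
  refine ⟨fun l => b l + δ l • b j, ?_, ?_, ?_, ?_⟩
  · intro l
    constructor
    · by_cases hl : δ l = 0
      · simpa [hl] using h.mem l
      · simpa [zmod_two_eq_one hl] using hadd _ _ (h.mem l) (h.mem j)
    · rw [map_add, map_smul, hj1]
      by_cases h1 : l = i
      · rw [h1, hi1, hδi]; decide
      by_cases h2 : l = j
      · rw [h2, hj1, hδj]; decide
      · rw [honly l h1 h2, hδo l h1 h2]; decide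
  · have := hcomb 1
    simp only [Pi.one_apply, one_smul] at this
    rw [this, h.sum_eq, show (1 + 1 : ZMod 2) = 0 by decide]; simp
  · rintro z ⟨hz, hz0⟩
    obtain ⟨c, rfl⟩ := h.span z hz
    refine ⟨c, ?_⟩
    have : c i + c j = 0 := by
      rw [map_sum] at hz0
      simp only [map_smul, smul_eq_mul] at hz0
      rw [← hz0, ← sum_pair hji.symm]
      symm
      rw [← sum_subset (subset_univ {i, j})]
      · rw [sum_pair hji.symm, sum_pair hji.symm, hi1, hj1, mul_one, mul_one]
      · intro l _ hl
        simp only [mem_insert, mem_singleton, not_or] at hl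
        rw [honly l hl.1 hl.2, mul_zero]
    rw [hcomb, this, zero_smul, add_zero]
  · intro e
    refine le_trans ?_ (h.two e)
    by_cases hie : b i e = 0
    -- If `b i` avoids `e`, then at `e` the new member `i` takes the place of the old member `j`,
    -- and the new member `j` is zero.
    · refine card_le_card_of_injOn (fun l => if l = i then j else l) ?_ ?_
      · intro l hl
        simp only [coe_filter, mem_univ, true_and, Set.mem_ofPred_eq, Pi.add_apply,
          Pi.smul_apply, smul_eq_mul] at hl ⊢
        by_cases h1 : l = i
        · simpa [h1, hie, hδi] using hl
        · by_cases h2 : l = j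
          · rw [h2, hδj, one_mul, CharTwo.add_self_eq_zero] at hl; exact absurd rfl hl
          · simpa [h1, hδo l h1 h2] using hl
      · intro l hl l' hl' hll
        have hlj : ∀ a, a ∈ (univ.filter fun l => (b l + δ l • b j) e ≠ 0) → a ≠ j := by
          rintro a ha rfl
          simp [hδj, CharTwo.add_self_eq_zero] at ha
        have n1 := hlj l (by simpa using hl)
        have n2 := hlj l' (by simpa using hl')
        simp only at hll
        split_ifs at hll with h1 h2 h2
        · rw [h1, h2]
        · exact absurd hll.symm n2
        · exact absurd hll n1
        · exact hll
    · refine card_le_card ?_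
      intro l hl
      simp only [mem_filter, mem_univ, true_and, Pi.add_apply, Pi.smul_apply, smul_eq_mul] at hl ⊢
      by_cases h1 : l = i
      · rwa [h1]
      by_cases h2 : l = j
      · rw [h2, hδj, one_mul, CharTwo.add_self_eq_zero] at hl; exact absurd rfl hl
      · simpa [hδo l h1 h2] using hl

/-- Setting the coordinates outside `F` to zero. -/
def restrict (F : Finset E) : (E → ZMod 2) →ₗ[ZMod 2] (E → ZMod 2) where
  toFun z e := if e ∈ F then z e else 0
  map_add' y z := by ext e; by_cases h : e ∈ F <;> simp [h]
  map_smul' c z := by ext e; by_cases h : e ∈ F <;> simp [h]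

theorem restrict_apply (F : Finset E) (z : E → ZMod 2) (e : E) :
    restrict F z e = if e ∈ F then z e else 0 := rfl

theorem Covers.map_restrict {Z Z' : (E → ZMod 2) → Prop} {k : ℕ} {b : Fin k → E → ZMod 2}
    (h : Covers Z b) (F : Finset E) (h1 : ∀ z, Z z → Z' (restrict F z))
    (h2 : ∀ z', Z' z' → ∃ z, Z z ∧ restrict F z = z') :
    Covers Z' fun i => restrict F (b i) where
  mem i := h1 _ (h.mem i)
  sum_eq := by rw [← map_sum, h.sum_eq, map_zero]
  span z' hz' := by
    obtain ⟨z, hz, rfl⟩ := h2 z' hz'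
    obtain ⟨c, rfl⟩ := h.span z hz
    exact ⟨c, by rw [map_sum]; simp only [map_smul]⟩
  two e := by
    refine (card_le_card ?_).trans (h.two e)
    intro i hi
    rw [mem_filter] at hi ⊢
    refine ⟨mem_univ _, fun h0 => hi.2 ?_⟩
    rw [restrict_apply, h0, ite_self]

/-- The mod 2 boundary of a set of edges. -/
def bdry (s t : E → V) : (E → ZMod 2) →ₗ[ZMod 2] (V → ZMod 2) where
  toFun z v := ∑ e, ((if s e = v then z e else 0) + (if t e = v then z e else 0))
  map_add' y z := by
    ext v
    simp only [Pi.add_apply, ← sum_add_distrib]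
    refine sum_congr rfl fun e _ => ?_
    split_ifs <;> ring
  map_smul' c z := by
    ext v
    simp only [Pi.smul_apply, smul_eq_mul, RingHom.id_apply, mul_sum]
    refine sum_congr rfl fun e _ => ?_
    split_ifs <;> ring

theorem bdry_apply (s t : E → V) (z : E → ZMod 2) (v : V) :
    bdry s t z v = ∑ e, ((if s e = v then z e else 0) + (if t e = v then z e else 0)) := rfl

theorem bdry_single (s t : E → V) (e : E) :
    bdry s t (Pi.single e 1) = Pi.single (s e) 1 + Pi.single (t e) 1 := by
  ext v
  rw [bdry_apply, sum_eq_single e]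
  · simp [Pi.single_apply, eq_comm]
  · intro f _ hf; simp [hf]
  · simp

theorem bdry_congr {s t s' t' : E → V} {z : E → ZMod 2}
    (h : ∀ e, z e ≠ 0 → s e = s' e ∧ t e = t' e) : bdry s t z = bdry s' t' z := by
  ext v
  simp only [bdry_apply]
  refine sum_congr rfl fun e _ => ?_
  by_cases h0 : z e = 0
  · simp [h0]
  · rw [(h e h0).1, (h e h0).2]

/-- The cycle space of the multigraph with edge set `S`. -/
def IsCycle (s t : E → V) (S : Finset E) (z : E → ZMod 2) : Prop :=
  (∀ e ∉ S, z e = 0) ∧ bdry s t z = 0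

theorem IsCycle.add {s t : E → V} {S : Finset E} {y z : E → ZMod 2} (hy : IsCycle s t S y)
    (hz : IsCycle s t S z) : IsCycle s t S (y + z) :=
  ⟨fun e he => by simp [hy.1 e he, hz.1 e he], by rw [map_add, hy.2, hz.2, add_zero]⟩

theorem isCycle_sum {s t : E → V} {S : Finset E} {ι : Type*} (C : Finset ι) (b : ι → E → ZMod 2)
    (c : ι → ZMod 2) (h : ∀ i ∈ C, IsCycle s t S (b i)) : IsCycle s t S (∑ i ∈ C, c i • b i) := by
  constructor
  · intro e he
    rw [Finset.sum_apply]
    exact sum_eq_zero fun i hi => by simp [(h i hi).1 e he]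
  · rw [map_sum]
    exact sum_eq_zero fun i hi => by rw [map_smul, (h i hi).2, smul_zero]

/-- The multigraph with edge set `S` has a two-cover of its cycle space. By MacLane's criterion this
describes planarity. -/
def PlanarEdges (s t : E → V) (S : Finset E) : Prop :=
  ∃ (k : ℕ) (b : Fin k → E → ZMod 2), Covers (IsCycle s t S) b

/-- Deleting `e` merges the faces on its two sides: the functional is the coordinate at `e`. -/
theorem PlanarEdges.erase {s t : E → V} {S : Finset E} (h : PlanarEdges s t S) (e : E) :
    PlanarEdges s t (S.erase e) := by
  obtain ⟨k, b, hb⟩ := h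
  obtain ⟨b', hb'⟩ := hb.merge (fun _ _ => IsCycle.add) (LinearMap.proj e) (hb.two e)
  refine ⟨k, b', ?_⟩
  convert hb' using 2 with z
  simp only [LinearMap.proj_apply, IsCycle, mem_erase, not_and_or, not_not]
  constructor
  · rintro ⟨h1, h2⟩
    exact ⟨⟨fun f hf => h1 f (Or.inr hf), h2⟩, h1 e (Or.inl rfl)⟩
  · rintro ⟨⟨h1, h2⟩, h3⟩
    refine ⟨?_, h2⟩
    rintro f (rfl | hf)
    · exact h3
    · exact h1 f hf

theorem PlanarEdges.mono {s t : E → V} {S S' : Finset E} (h : PlanarEdges s t S) (hS : S' ⊆ S) :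
    PlanarEdges s t S' := by
  have : ∀ F : Finset E, PlanarEdges s t (S \ F) := by
    intro F
    induction F using Finset.induction_on with
    | empty => simpa using h
    | insert e F _ ih =>
      have := ih.erase e
      rwa [← sdiff_insert] at this
  have h1 := this (S \ S')
  rwa [Finset.sdiff_sdiff_eq_self hS] at h1

/-- The edge `e` joins `a` and `b`. -/
def Joins (s t : E → V) (e : E) (a b : V) : Prop := (s e = a ∧ t e = b) ∨ (s e = b ∧ t e = a)

theorem Joins.symm {s t : E → V} {e : E} {a b : V} (h : Joins s t e a b) : Joins s t e b a :=
  Or.symm h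

theorem Joins.bdry_single {s t : E → V} {e : E} {a b : V} (h : Joins s t e a b) :
    bdry s t (Pi.single e 1) = Pi.single a 1 + Pi.single b 1 := by
  rw [PlanarFlow.bdry_single]
  rcases h with ⟨rfl, rfl⟩ | ⟨rfl, rfl⟩
  · rfl
  · rw [add_comm]

/-- Every cut of `X` is crossed by an edge of `S`. -/
def ConnectedOn (s t : E → V) (S : Finset E) (X : Finset V) : Prop :=
  ∀ Y ⊆ X, Y.Nonempty → Y ≠ X → ∃ e ∈ S, ∃ y ∈ Y, ∃ x ∈ X \ Y, Joins s t e y x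

theorem ConnectedOn.exists_path {s t : E → V} {S : Finset E} {X : Finset V}
    (h : ConnectedOn s t S X) {a b : V} (ha : a ∈ X) (hb : b ∈ X) :
    ∃ z : E → ZMod 2, (∀ e, z e ≠ 0 → e ∈ S ∧ s e ∈ X ∧ t e ∈ X) ∧
      bdry s t z = Pi.single a 1 + Pi.single b 1 := by
  classical
  set Y := X.filter fun b => ∃ z : E → ZMod 2, (∀ e, z e ≠ 0 → e ∈ S ∧ s e ∈ X ∧ t e ∈ X) ∧
      bdry s t z = Pi.single a 1 + Pi.single b 1 with hY
  have haY : a ∈ Y := by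
    rw [hY, mem_filter]
    refine ⟨ha, 0, by simp, ?_⟩
    rw [map_zero, fun_add_self]
  by_cases hYX : Y = X
  · rw [← hYX, hY, mem_filter] at hb
    exact hb.2
  exfalso
  obtain ⟨e, he, y, hy, x, hx, hj⟩ := h Y (filter_subset _ _) ⟨a, haY⟩ hYX
  rw [mem_sdiff] at hx
  refine hx.2 ?_
  rw [hY, mem_filter] at hy ⊢
  obtain ⟨hyX, z, hz, hzb⟩ := hy
  refine ⟨hx.1, z + Pi.single e 1, ?_, ?_⟩
  · intro f hf
    by_cases hfe : f = e
    · subst hfe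
      rcases hj with ⟨h1, h2⟩ | ⟨h1, h2⟩
      · exact ⟨he, h1 ▸ hyX, h2 ▸ hx.1⟩
      · exact ⟨he, h1 ▸ hx.1, h2 ▸ hyX⟩
    · exact hz f (by simpa [hfe] using hf)
  · rw [map_add, hzb, hj.bdry_single, add_assoc, ← add_assoc (Pi.single y 1),
      fun_add_self, zero_add]

theorem ConnectedOn.exists_bdry {s t : E → V} {S : Finset E} {X : Finset V}
    (h : ConnectedOn s t S X) (β : V → ZMod 2) (hβ : ∀ v ∉ X, β v = 0) (hsum : ∑ v ∈ X, β v = 0) :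
    ∃ z : E → ZMod 2, (∀ e, z e ≠ 0 → e ∈ S ∧ s e ∈ X ∧ t e ∈ X) ∧ bdry s t z = β := by
  rcases X.eq_empty_or_nonempty with rfl | ⟨a, ha⟩
  · refine ⟨0, by simp, ?_⟩
    rw [map_zero]; ext v; exact (hβ v (by simp)).symm
  have : ∀ b, ∃ z : E → ZMod 2, b ∈ X → (∀ e, z e ≠ 0 → e ∈ S ∧ s e ∈ X ∧ t e ∈ X) ∧
      bdry s t z = Pi.single a 1 + Pi.single b 1 := by
    intro b
    by_cases hb : b ∈ X
    · obtain ⟨z, hz⟩ := h.exists_path ha hb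
      exact ⟨z, fun _ => hz⟩
    · exact ⟨0, fun h => absurd h hb⟩
  choose z hz using this
  refine ⟨∑ b ∈ X, β b • z b, ?_, ?_⟩
  · intro e he
    rw [Finset.sum_apply] at he
    obtain ⟨b, hb, hbe⟩ := exists_ne_zero_of_sum_ne_zero he
    refine (hz b hb).1 e fun h0 => hbe ?_
    simp [h0]
  · rw [map_sum]
    have : ∑ b ∈ X, bdry s t (β b • z b) =
        ∑ b ∈ X, (β b • (Pi.single a 1 : V → ZMod 2) + β b • Pi.single b 1) :=
      sum_congr rfl fun b hb => by rw [map_smul, (hz b hb).2, smul_add]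
    rw [this, sum_add_distrib, ← sum_smul, hsum, zero_smul, zero_add]
    ext v
    rw [Finset.sum_apply]
    by_cases hv : v ∈ X
    · rw [sum_eq_single v]
      · simp
      · intro b _ hb; simp [hb.symm]
      · exact fun h => absurd hv h
    · rw [hβ v hv]
      refine sum_eq_zero fun b hb => ?_
      have : v ≠ b := fun e => hv (e ▸ hb)
      simp [this]

theorem bdry_comp (s t : E → V) (q : V → V) (z : E → ZMod 2) (v : V) :
    bdry (q ∘ s) (q ∘ t) z v = ∑ u with q u = v, bdry s t z u := by
  simp only [bdry_apply, Function.comp]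
  rw [sum_comm]
  refine sum_congr rfl fun e _ => ?_
  rw [sum_add_distrib]
  simp

/-- The map that sends `X` to `r` and fixes all other vertices. -/
def collapse (X : Finset V) (r v : V) : V := if v ∈ X then r else v

/-- The members are restricted to the surviving edges. They still span because a cycle of the
contracted graph has its old boundary inside `X` with total zero, so edges inside the connected set
`X` complete it to a cycle. -/
theorem PlanarEdges.contract {s t : E → V} {S : Finset E} (h : PlanarEdges s t S) {X : Finset V}
    {r : V} (hr : r ∈ X) (hX : ConnectedOn s t S X) :
    PlanarEdges (collapse X r ∘ s) (collapse X r ∘ t)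
      (S.filter fun e => ¬ (s e ∈ X ∧ t e ∈ X)) := by
  obtain ⟨k, b, hb⟩ := h
  set q := collapse X r with hq
  set F := S.filter fun e => ¬ (s e ∈ X ∧ t e ∈ X) with hF
  have hloop : ∀ z : E → ZMod 2, (∀ e ∉ S, z e = 0) →
      bdry (q ∘ s) (q ∘ t) (restrict F z) = bdry (q ∘ s) (q ∘ t) z := by
    intro z hz
    ext v
    simp only [bdry_apply]
    refine sum_congr rfl fun e _ => ?_
    by_cases heF : e ∈ F
    · simp [restrict_apply, heF]
    · by_cases heS : e ∈ S
      · have : s e ∈ X ∧ t e ∈ X := by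
          by_contra hc; exact heF (mem_filter.2 ⟨heS, hc⟩)
        have hst : q (s e) = q (t e) := by simp [hq, collapse, this]
        simp only [restrict_apply, heF, if_false, ite_self, Function.comp, hst,
          CharTwo.add_self_eq_zero]
      · simp [restrict_apply, heF, hz e heS]
  refine ⟨k, _, hb.map_restrict F ?_ ?_⟩
  · rintro z ⟨hz, hz'⟩
    refine ⟨fun e he => by simp [restrict_apply, he], ?_⟩
    rw [hloop z hz]
    ext v
    rw [bdry_comp, hz']
    simp
  · rintro z' ⟨hz, hz'⟩
    obtain ⟨y, hy, hyb⟩ := hX.exists_bdry (bdry s t z') (by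
      intro v hv
      have := congrFun hz' v
      rw [bdry_comp] at this
      have hfib : (univ.filter fun u => q u = v) = {v} := by
        ext u
        simp only [mem_filter, mem_univ, true_and, mem_singleton, hq, collapse]
        split_ifs with hu
        · constructor
          · rintro rfl; exact absurd hr hv
          · rintro rfl; exact absurd hu hv
        · rfl
      rwa [hfib, sum_singleton] at this) (by
      have := congrFun hz' r
      rw [bdry_comp] at this
      have hfib : (univ.filter fun u => q u = r) = X := by
        ext u
        simp only [mem_filter, mem_univ, true_and, hq, collapse]
        split_ifs with hu
        · simp [hu]
        · simp only [hu, iff_false]; rintro rfl; exact hu hr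
      rwa [hfib] at this)
    refine ⟨z' + y, ⟨?_, ?_⟩, ?_⟩
    · intro e he
      have h1 : z' e = 0 := hz e fun h => he (mem_filter.1 h).1
      have h2 : y e = 0 := by by_contra h0; exact he (hy e h0).1
      simp [h1, h2]
    · rw [map_add, hyb, fun_add_self]
    · ext e
      rw [restrict_apply]
      split_ifs with he
      · have : y e = 0 := by by_contra h0; exact (mem_filter.1 he).2 (hy e h0).2
        simp [this]
      · exact (hz e he).symm

/-- Two edges at `v` that lie in a common member of the two-cover can be lifted. -/
theorem Covers.lift {s t : E → V} {S : Finset E} {k : ℕ} {b : Fin k → E → ZMod 2}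
    (hb : Covers (IsCycle s t S) b) {e e' : E} (hne : e ≠ e') (he : e ∈ S) (he' : e' ∈ S)
    {v x x' : V} (hj : Joins s t e v x) (hj' : Joins s t e' v x') {i : Fin k} (hi : b i e ≠ 0)
    (hi' : b i e' ≠ 0) :
    PlanarEdges (Function.update s e x) (Function.update t e x') (S.erase e') := by
  set ℓ : (E → ZMod 2) →ₗ[ZMod 2] ZMod 2 :=
    (LinearMap.proj e : (E → ZMod 2) →ₗ[ZMod 2] ZMod 2) + LinearMap.proj e' with hℓ
  have hℓz : ∀ z, ℓ z = z e + z e' := fun z => rfl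
  -- On the common member `i` the functional vanishes, as 1 + 1 = 0. Besides it, each of the two
  -- edges lies in at most one member.
  have hcount : (univ.filter fun j => ℓ (b j) ≠ 0).card ≤ 2 := by
    have hsub : (univ.filter fun j => ℓ (b j) ≠ 0) ⊆
        ((univ.filter fun j => b j e ≠ 0).erase i) ∪ ((univ.filter fun j => b j e' ≠ 0).erase i) := by
      intro j hj
      simp only [hℓz, mem_filter, mem_univ, true_and, mem_union, mem_erase] at hj ⊢
      have hji : j ≠ i := by
        rintro rfl
        rw [zmod_two_eq_one hi, zmod_two_eq_one hi'] at hj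
        exact hj (by decide)
      by_cases h0 : b j e = 0
      · exact Or.inr ⟨hji, by simpa [h0] using hj⟩
      · exact Or.inl ⟨hji, h0⟩
    refine (card_le_card hsub).trans ((card_union_le _ _).trans ?_)
    rw [card_erase_of_mem (by simpa using hi), card_erase_of_mem (by simpa using hi')]
    have := hb.two e
    have := hb.two e'
    omega
  obtain ⟨b', hb'⟩ := hb.merge (fun _ _ => IsCycle.add) ℓ hcount
  -- The edge `e` is reused as the lifted edge from `x` to `x'`. It stands for the path formed by
  -- `e` and `e'`, whose boundary at `v` cancels.
  have hbd : ∀ z : E → ZMod 2, z e = z e' →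
      bdry (Function.update s e x) (Function.update t e x') (restrict (univ.erase e') z) =
        bdry s t z := by
    intro z hz
    set z₀ := restrict (univ \ {e, e'}) z with hz₀
    have h1 : z = z₀ + z e • (Pi.single e 1 + Pi.single e' 1) := by
      ext f
      by_cases f1 : f = e
      · subst f1; simp [hz₀, restrict_apply, hne]
      by_cases f2 : f = e'
      · subst f2; simp [hz₀, restrict_apply, hne.symm, hz]
      · simp [hz₀, restrict_apply, f1, f2]
    have h2 : restrict (univ.erase e') z = z₀ + z e • Pi.single e 1 := by
      ext f
      by_cases f1 : f = e
      · subst f1; simp [hz₀, restrict_apply, hne]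
      by_cases f2 : f = e'
      · subst f2; simp [hz₀, restrict_apply, hne.symm]
      · simp [hz₀, restrict_apply, f1, f2]
    rw [h2]
    conv_rhs => rw [h1]
    simp only [map_add, map_smul]
    congr 1
    · refine bdry_congr fun f hf => ?_
      have : f ≠ e := by
        rintro rfl; simp [hz₀, restrict_apply] at hf
      simp [this]
    · rw [hj.bdry_single, hj'.bdry_single, bdry_single]
      simp only [Function.update_self]
      congr 1
      rw [add_comm (Pi.single v 1) (Pi.single x 1), add_assoc, ← add_assoc (Pi.single v 1),
        fun_add_self, zero_add]
  refine ⟨k, _, hb'.map_restrict (univ.erase e') ?_ ?_⟩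
  · rintro z ⟨⟨h1, h2⟩, h3⟩
    have hz : z e = z e' := by
      rw [hℓz] at h3
      exact CharTwo.add_eq_zero.1 h3
    refine ⟨?_, by rw [hbd z hz, h2]⟩
    intro f hf
    rw [restrict_apply]
    split_ifs with hfe
    · exact h1 f fun h => hf (mem_erase.2 ⟨(mem_erase.1 hfe).1, h⟩)
    · rfl
  · rintro z' ⟨h1, h2⟩
    have hz0 : z' e' = 0 := h1 e' (by simp)
    have hr : restrict (univ.erase e') (Function.update z' e' (z' e)) = z' := by
      ext f
      by_cases f2 : f = e'
      · subst f2; simp [restrict_apply, hz0]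
      · simp [restrict_apply, f2]
    have hu : Function.update z' e' (z' e) e = Function.update z' e' (z' e) e' := by simp [hne]
    refine ⟨Function.update z' e' (z' e), ⟨⟨?_, ?_⟩, ?_⟩, hr⟩
    · intro f hf
      have hfe : f ≠ e' := fun h => hf (h ▸ he')
      rw [Function.update_of_ne hfe]
      exact h1 f (by simp [hf])
    · rw [← hbd _ hu, hr, h2]
    · rw [hℓz, hu, CharTwo.add_self_eq_zero]

theorem bdry_apply_of_loopless {s t : E → V} {z : E → ZMod 2} {v : V}
    (hv : ∀ e, z e ≠ 0 → ¬ (s e = v ∧ t e = v)) :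
    bdry s t z v = ∑ e with s e = v ∨ t e = v, z e := by
  rw [bdry_apply, sum_filter]
  refine sum_congr rfl fun e _ => ?_
  by_cases h0 : z e = 0
  · simp [h0]
  · have := hv e h0
    by_cases h1 : s e = v <;> by_cases h2 : t e = v <;> simp [h1, h2] at this ⊢

/-- If the graph stays connected without `v`, two edges at `v` lie on a cycle which has no
further edges at `v`. -/
theorem exists_cycle_through {s t : E → V} {S : Finset E} {X : Finset V} {v a b : V} (hv : v ∉ X)
    (hX : ConnectedOn s t S X) {e e' : E} (he : e ∈ S) (he' : e' ∈ S)
    (hj : Joins s t e v a) (hj' : Joins s t e' v b) (ha : a ∈ X) (hb : b ∈ X) :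
    ∃ y : E → ZMod 2, (∀ f, y f ≠ 0 → s f ≠ v ∧ t f ≠ v) ∧
      IsCycle s t S (y + Pi.single e 1 + Pi.single e' 1) := by
  obtain ⟨y, hy, hyb⟩ := hX.exists_path ha hb
  refine ⟨y, fun f hf => ?_, ?_, ?_⟩
  · obtain ⟨-, h1, h2⟩ := hy f hf
    exact ⟨fun h => hv (h ▸ h1), fun h => hv (h ▸ h2)⟩
  · intro f hf
    have h1 : y f = 0 := by by_contra h0; exact hf (hy f h0).1
    have h2 : f ≠ e := fun h => hf (h ▸ he)
    have h3 : f ≠ e' := fun h => hf (h ▸ he')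
    simp [h1, h2, h3]
  · rw [map_add, map_add, hyb, hj.bdry_single, hj'.bdry_single]
    have : ∀ p q r : V → ZMod 2, p + q + (r + p) + (r + q) = 0 := by
      intro p q r
      rw [show p + q + (r + p) + (r + q) = (p + p) + (q + q) + (r + r) by abel]
      simp [fun_add_self]
    exact this _ _ _

/-- If the graph stays connected without `v`, a proper part `I` of the edges at `v` shares a
member of the two-cover with the other edges at `v`. -/
theorem Covers.exists_shared {s t : E → V} {S : Finset E} {k : ℕ} {b : Fin k → E → ZMod 2}
    (hb : Covers (IsCycle s t S) b) (hS : ∀ e ∈ S, s e ≠ t e) {X : Finset V} {v x x' : V}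
    (hv : v ∉ X) (hX : ConnectedOn s t S X) (hx : x ∈ X) (hx' : x' ∈ X) (I : Finset E) {e e' : E}
    (he : e ∈ S) (he' : e' ∈ S) (hj : Joins s t e v x) (hj' : Joins s t e' v x') (heI : e ∈ I)
    (heI' : e' ∉ I) (hI : ∀ f ∈ I, s f = v ∨ t f = v) :
    ∃ i, ∃ f ∈ I, ∃ f' ∈ S, f' ∉ I ∧ (s f' = v ∨ t f' = v) ∧ b i f ≠ 0 ∧ b i f' ≠ 0 := by
  by_contra! hcon
  obtain ⟨y, hy, hz⟩ := exists_cycle_through hv hX he he' hj hj' hx hx'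
  have hlo : ∀ z, IsCycle s t S z → ∀ f, z f ≠ 0 → ¬ (s f = v ∧ t f = v) := by
    rintro z hz f hf ⟨h1, h2⟩
    refine hS f ?_ (h1.trans h2.symm)
    by_contra hfS; exact hf (hz.1 f hfS)
  -- If no member mixes the two kinds of edges, the edges of a member at `v` all lie in `I` or all
  -- lie outside, so it uses an even number from `I`. This parity passes to every cycle, whereas the
  -- cycle through `e` and `e'` meets `I` in `e` alone.
  have hbI : ∀ i, ∑ f ∈ I, b i f = 0 := by
    intro i
    by_cases h0 : ∃ f ∈ I, b i f ≠ 0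
    · obtain ⟨f, hf, hf0⟩ := h0
      have h1 := congrFun (hb.mem i).2 v
      rw [bdry_apply_of_loopless (hlo _ (hb.mem i))] at h1
      refine Eq.trans ?_ h1
      refine sum_subset (fun f hf => by simpa using hI f hf) ?_
      intro f' hf' hf'I
      by_cases hf'S : f' ∈ S
      · exact hcon i f hf f' hf'S hf'I (by simpa using hf') hf0
      · exact (hb.mem i).1 f' hf'S
    · push Not at h0
      exact sum_eq_zero h0
  obtain ⟨c, hc⟩ := hb.span _ hz
  have h1 : ∑ f ∈ I, (y + Pi.single e 1 + Pi.single e' 1 : E → ZMod 2) f = 0 := by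
    rw [hc]
    simp only [Finset.sum_apply, Pi.smul_apply, smul_eq_mul]
    rw [sum_comm]
    refine sum_eq_zero fun i _ => ?_
    rw [← mul_sum, hbI, mul_zero]
  have hy0 : ∑ f ∈ I, y f = 0 := by
    refine sum_eq_zero fun f hf => ?_
    by_contra h0
    have := hy f h0
    rcases hI f hf with h | h
    · exact this.1 h
    · exact this.2 h
  simp only [Pi.add_apply, sum_add_distrib, hy0, Pi.single_apply] at h1
  simp [heI, heI'] at h1

/-- At most two members contain `e`. A subfamily with sum zero contains an even number of them, so
it contains both as soon as it contains one. -/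
theorem Covers.mem_of_sum_eq_zero {Z : (E → ZMod 2) → Prop} {k : ℕ} {b : Fin k → E → ZMod 2}
    (hb : Covers Z b) {C : Finset (Fin k)} (hC : ∑ i ∈ C, b i = 0) {e : E} {i j : Fin k}
    (hi : i ∈ C) (hie : b i e ≠ 0) (hj : b j e ≠ 0) : j ∈ C := by
  by_contra hjC
  have h1 : ∑ l ∈ C, b l e = 0 := by rw [← Finset.sum_apply, hC]; rfl
  obtain ⟨l, hl, hli, hle⟩ : ∃ l ∈ C, l ≠ i ∧ b l e ≠ 0 := by
    by_contra! hl
    rw [sum_eq_single i (fun l hl' hli => hl l hl' hli) (fun h => absurd hi h)] at h1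
    exact hie h1
  have : ({i, l, j} : Finset (Fin k)).card ≤ 2 := by
    refine (card_le_card ?_).trans (hb.two e)
    intro a ha
    simp only [mem_insert, mem_singleton] at ha
    rcases ha with rfl | rfl | rfl <;> simp [*]
  rw [card_eq_three.2 ⟨i, l, j, hli.symm, fun h => hjC (h ▸ hi), fun h => hjC (h ▸ hl), rfl⟩]
    at this
  omega

/-- If the graph stays connected without `v`, then a subfamily of the two-cover with sum zero
covers all or none of the edges at `v`. -/
theorem Covers.covered_of_sum_eq_zero {s t : E → V} {S : Finset E} {k : ℕ}
    {b : Fin k → E → ZMod 2} (hb : Covers (IsCycle s t S) b) (hS : ∀ e ∈ S, s e ≠ t e)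
    {X : Finset V} {v x x' : V} (hv : v ∉ X) (hX : ConnectedOn s t S X) (hx : x ∈ X) (hx' : x' ∈ X)
    {e e' : E} (he : e ∈ S) (he' : e' ∈ S) (hj : Joins s t e v x) (hj' : Joins s t e' v x')
    {C : Finset (Fin k)} (hC : ∑ i ∈ C, b i = 0) {i : Fin k} (hi : i ∈ C) (hie : b i e ≠ 0) :
    ∃ j ∈ C, b j e' ≠ 0 := by
  by_contra! hcon
  have hne : e ≠ e' := by rintro rfl; exact hie (hcon i hi)
  obtain ⟨y, hy, hz⟩ := exists_cycle_through hv hX he he' hj hj' hx hx'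
  obtain ⟨c, hc⟩ := hb.span _ hz
  have hall := fun j => hb.mem_of_sum_eq_zero hC hi hie (j := j)
  -- The part of the expansion indexed by `C` agrees with the full cycle on the edges covered by `C`
  -- and vanishes elsewhere. If `e'` is not covered, `e` is its only edge at `v`, which contradicts
  -- even degree.
  have hzC := isCycle_sum C b c fun j _ => hb.mem j
  have h1 := congrFun hzC.2 v
  rw [bdry_apply_of_loopless, sum_eq_single e] at h1
  · have h2 : (∑ j ∈ C, c j • b j) e = (∑ j, c j • b j) e := by
      rw [Finset.sum_apply, Finset.sum_apply]
      refine sum_subset (subset_univ _) fun j _ hj => ?_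
      have : b j e = 0 := by by_contra h0; exact hj (hall j h0)
      simp [this]
    rw [h2, ← hc] at h1
    have hye : y e = 0 := by
      by_contra h0
      rcases hj with h | h
      · exact (hy e h0).1 h.1
      · exact (hy e h0).2 h.2
    simp [hye, hne] at h1
  · intro f hf hfe
    by_cases hfe' : f = e'
    · rw [hfe', Finset.sum_apply]
      exact sum_eq_zero fun j hj => by simp [hcon j hj]
    by_cases hcov : ∃ j ∈ C, b j f ≠ 0
    · have hyf : y f = 0 := by
        by_contra h0
        rcases (mem_filter.1 hf).2 with h | h
        · exact (hy f h0).1 h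
        · exact (hy f h0).2 h
      obtain ⟨j, hjC, hjf⟩ := hcov
      have hall' := fun l => hb.mem_of_sum_eq_zero hC hjC hjf (j := l)
      have h2 : (∑ j ∈ C, c j • b j) f = (∑ j, c j • b j) f := by
        rw [Finset.sum_apply, Finset.sum_apply]
        refine sum_subset (subset_univ _) fun j _ hj => ?_
        have : b j f = 0 := by by_contra h0; exact hj (hall' j h0)
        simp [this]
      rw [h2, ← hc]
      simp [hyf, hfe, hfe']
    · push Not at hcov
      rw [Finset.sum_apply]
      exact sum_eq_zero fun j hj => by simp [hcov j hj]
  · intro h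
    exfalso
    refine h (mem_filter.2 ⟨mem_univ _, ?_⟩)
    rcases hj with h | h
    · exact Or.inl h.1
    · exact Or.inr h.2
  · rintro f hf ⟨h1, h2⟩
    refine hS f ?_ (h1.trans h2.symm)
    by_contra hfS; exact hf (hzC.1 f hfS)

end

section

variable {V : Type*} [Fintype V] [DecidableEq V]

/-! ### The density condition on vertex partitions -/

/-- Twice the number of edges on `A` between different parts of the partition of `A` into the
fibres of `f`. -/
def crossing {κ : Type*} [DecidableEq κ] (m : V → V → ℕ) (A : Finset V) (f : V → κ) : ℕ :=
  ∑ x ∈ A, ∑ y ∈ A, if f x = f y then 0 else m x y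

/-- The number of edges required between the parts of a partition into `t` parts. -/
def bound (t : ℕ) : ℕ :=
  if t ≤ 1 then 0 else if t = 2 then 4 else if t = 3 then 8 else (11 * t - 18) / 2

/-- All vertex partitions have many crossing edges. -/
def Dense (m : V → V → ℕ) (A : Finset V) : Prop :=
  ∀ f : V → ℕ, 2 * bound (A.image f).card ≤ crossing m A f

theorem even_sum_sum {F : V → V → ℕ} (hsym : ∀ x y, F x y = F y x) (hdiag : ∀ x, F x x = 0)
    (A : Finset V) : Even (∑ x ∈ A, ∑ y ∈ A, F x y) := by
  induction A using Finset.induction_on with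
  | empty => simp
  | insert a A ha ih =>
    rw [sum_insert ha, sum_insert ha, hdiag, zero_add]
    have : ∑ x ∈ A, ∑ y ∈ insert a A, F x y = ∑ y ∈ A, F a y + ∑ x ∈ A, ∑ y ∈ A, F x y := by
      rw [← sum_add_distrib]
      exact sum_congr rfl fun x _ => by rw [sum_insert ha, hsym]
    rw [this, ← add_assoc]
    exact Even.add ⟨_, rfl⟩ ih

theorem even_crossing {m : V → V → ℕ} (hsym : ∀ u w, m u w = m w u) {κ : Type*} [DecidableEq κ]
    (A : Finset V) (f : V → κ) : Even (crossing m A f) := by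
  refine even_sum_sum (fun x y => ?_) (fun x => by simp) A
  rw [hsym x y]
  simp only [eq_comm]

theorem crossing_encode {κ : Type*} [DecidableEq κ] [Encodable κ] (m : V → V → ℕ) (A : Finset V)
    (f : V → κ) : crossing m A (fun v => Encodable.encode (f v)) = crossing m A f := by
  simp only [crossing, Encodable.encode_inj]

theorem card_image_encode {κ : Type*} [DecidableEq κ] [Encodable κ] (A : Finset V) (f : V → κ) :
    (A.image fun v => Encodable.encode (f v)).card = (A.image f).card := by
  rw [← card_image_of_injective (A.image f) Encodable.encode_injective, image_image]
  rfl

theorem exists_refinement (m : V → V → ℕ) (A : Finset V) (f : V → ℕ) (c : ℕ)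
    (hc : (A.filter fun v => f v = c).Nonempty) (Q : V → ℕ) :
    ∃ f' : V → ℕ,
      crossing m A f' = crossing m A f + crossing m (A.filter fun v => f v = c) Q ∧
      (A.image f').card + 1 = (A.image f).card + ((A.filter fun v => f v = c).image Q).card := by
  set Y := A.filter fun v => f v = c with hY
  -- The first coordinate separates the pieces of the refined part from the remaining parts.
  set F : V → ℕ × ℕ := fun v => if f v = c then (1, Q v) else (0, f v) with hF
  refine ⟨fun v => Encodable.encode (F v), ?_, ?_⟩
  · rw [crossing_encode]
    have h1 : crossing m Y Q = ∑ x ∈ A, ∑ y ∈ A,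
        if f x = c ∧ f y = c then (if Q x = Q y then 0 else m x y) else 0 := by
      simp only [crossing, hY, sum_filter]
      refine sum_congr rfl fun x _ => ?_
      by_cases hx : f x = c <;> simp [hx]
    rw [h1]
    simp only [crossing]
    rw [← sum_add_distrib]
    refine sum_congr rfl fun x _ => ?_
    rw [← sum_add_distrib]
    refine sum_congr rfl fun y _ => ?_
    by_cases hx : f x = c <;> by_cases hy : f y = c
    · simp [hF, hx, hy]
    · have : c ≠ f y := fun h => hy h.symm
      simp [hF, hx, hy, this]
    · simp [hF, hx, hy]
    · simp [hF, hx, hy]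
  · rw [card_image_encode]
    have h1 : A.image F = (Y.image Q).image (fun a => (1, a)) ∪
        ((A.filter fun v => ¬ f v = c).image f).image (fun a => (0, a)) := by
      ext p
      simp only [mem_image, mem_union, hY, mem_filter, hF]
      constructor
      · rintro ⟨v, hv, rfl⟩
        by_cases h : f v = c
        · exact Or.inl ⟨Q v, ⟨v, ⟨hv, h⟩, rfl⟩, by simp [h]⟩
        · exact Or.inr ⟨f v, ⟨v, ⟨hv, h⟩, rfl⟩, by simp [h]⟩
      · rintro (⟨_, ⟨v, ⟨hv, h⟩, rfl⟩, rfl⟩ | ⟨_, ⟨v, ⟨hv, h⟩, rfl⟩, rfl⟩)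
        · exact ⟨v, hv, by simp [h]⟩
        · exact ⟨v, hv, by simp [h]⟩
    have h2 : A.image f = insert c ((A.filter fun v => ¬ f v = c).image f) := by
      ext a
      simp only [mem_image, mem_insert, mem_filter]
      constructor
      · rintro ⟨v, hv, rfl⟩
        by_cases h : f v = c
        · exact Or.inl h
        · exact Or.inr ⟨v, ⟨hv, h⟩, rfl⟩
      · rintro (rfl | ⟨v, ⟨hv, _⟩, rfl⟩)
        · obtain ⟨v, hv⟩ := hc
          exact ⟨v, (mem_filter.1 hv).1, (mem_filter.1 hv).2⟩
        · exact ⟨v, hv, rfl⟩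
    rw [h1, h2, card_union_of_disjoint, card_image_of_injective (Y.image Q),
      card_image_of_injective (image f _), card_insert_of_notMem]
    · omega
    · simp
    · intro a b h; simpa using h
    · intro a b h; simpa using h
    · rw [disjoint_left]
      intro p hp hp'
      simp only [mem_image] at hp hp'
      obtain ⟨a, _, rfl⟩ := hp
      obtain ⟨b, _, h⟩ := hp'
      simp at h

/-- Every part other than the fibre of `c` uses up a vertex outside that fibre. -/
theorem card_image_le_card_sdiff (A : Finset V) (f : V → ℕ) (c : ℕ) :
    (A.image f).card + (A.filter fun v => f v = c).card ≤ A.card + 1 := by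
  have h1 : A.image f ⊆ insert c ((A.filter fun v => ¬ f v = c).image f) := by
    intro a ha
    obtain ⟨v, hv, rfl⟩ := mem_image.1 ha
    by_cases h : f v = c
    · simp [h]
    · exact mem_insert_of_mem (mem_image_of_mem f (mem_filter.2 ⟨hv, h⟩))
  have h2 := card_le_card h1
  have h3 := card_insert_le c ((A.filter fun v => ¬ f v = c).image f)
  have h4 := card_image_le (s := A.filter fun v => ¬ f v = c) (f := f)
  have h5 := card_filter_add_card_filter_not (s := A) (fun v => f v = c)
  omega

theorem card_fibre_lt {A : Finset V} {f : V → ℕ} (h : 2 ≤ (A.image f).card) (c : ℕ) :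
    (A.filter fun v => f v = c).card < A.card := by
  have := card_image_le_card_sdiff A f c
  omega

theorem exists_large_fibre {A : Finset V} {f : V → ℕ} (h : (A.image f).card < A.card) :
    ∃ c, 2 ≤ (A.filter fun v => f v = c).card := by
  obtain ⟨x, hx, y, hy, hne, he⟩ :=
    exists_ne_map_eq_of_card_lt_of_maps_to h (fun v hv => mem_image_of_mem f hv)
  refine ⟨f y, one_lt_card.2 ⟨x, ?_, y, ?_, hne⟩⟩
  · simp [hx, he]
  · simp [hy]

/-- Each proper subset `Y` of `A` has a partition with too few crossing edges. -/
def Sparse (m : V → V → ℕ) (A : Finset V) : Prop :=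
  ∀ Y ⊆ A, 2 ≤ Y.card → Y.card < A.card → ∃ Q : V → ℕ, 2 ≤ (Y.image Q).card ∧
    crossing m Y Q + 2 ≤ 2 * bound (Y.image Q).card

/-! ### Slack of partitions when proper subsets are sparse -/

section Gap

variable {m : V → V → ℕ} {A : Finset V} (hd : Dense m A) (hs : Sparse m A)

include hs in
theorem Sparse.exists_refinement {f : V → ℕ} (ht : 2 ≤ (A.image f).card) {c : ℕ}
    (hc : 2 ≤ (A.filter fun v => f v = c).card) :
    ∃ (q : ℕ) (f' : V → ℕ), 2 ≤ q ∧ q ≤ (A.filter fun v => f v = c).card ∧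
      (A.image f').card + 1 = (A.image f).card + q ∧
      crossing m A f' + 2 ≤ crossing m A f + 2 * bound q := by
  obtain ⟨Q, hq, hQ⟩ := hs _ (filter_subset _ _) hc (card_fibre_lt ht c)
  obtain ⟨f', h1, h2⟩ := PlanarFlow.exists_refinement m A f c
    (card_pos.1 (by omega)) Q
  exact ⟨_, f', hq, card_image_le, h2, by omega⟩

include hd hs

/-- A part with two vertices is split along a sparse partition into `q` pieces. The split adds at
most `2 * bound q - 2` to the crossing number, yet the refined partition meets the bound for more
parts. The 6 is the loss `2 * 4 - 2` at `q = 2`. -/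
theorem crossing_gap {f : V → ℕ} (ht : 2 ≤ (A.image f).card) (ht' : (A.image f).card < A.card) :
    2 * bound ((A.image f).card + 1) ≤ crossing m A f + 6 := by
  obtain ⟨c, hc⟩ := exists_large_fibre ht'
  obtain ⟨q, f', hq, -, h1, h2⟩ := hs.exists_refinement ht hc
  have h3 := hd f'
  generalize (A.image f).card = t at *
  generalize (A.image f').card = t' at *
  obtain rfl : t' = t + q - 1 := by omega
  revert h2 h3
  unfold bound
  split_ifs <;> omega

/-- From three parts on, `bound` grows by at least 5 per part, so the previous inequality leaves `2
* 5 - 6 = 4`. For two parts the growth is only 4, and a second refinement is needed. The slack of 4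
counts two edges, the price of one lift. -/
theorem crossing_gap_two (hn : 4 ≤ A.card) {f : V → ℕ} (ht : 2 ≤ (A.image f).card)
    (ht' : (A.image f).card < A.card) :
    2 * bound (A.image f).card + 4 ≤ crossing m A f := by
  have h0 := crossing_gap hd hs ht ht'
  by_cases h2 : (A.image f).card = 2
  · obtain ⟨c, hc⟩ := exists_large_fibre ht'
    obtain ⟨q, f', hq, -, h1, h3⟩ := hs.exists_refinement ht hc
    by_cases hq2 : q = 2
    · have h4 := crossing_gap hd hs (f := f') (by omega) (by omega)
      rw [show (A.image f').card = 3 by omega] at h4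
      rw [h2]
      subst hq2
      simp [bound] at *
      omega
    · have h4 := hd f'
      rw [show (A.image f').card = q + 1 by omega] at h4
      rw [h2]
      revert h3 h4
      unfold bound
      split_ifs <;> omega
  · revert h0
    unfold bound
    split_ifs <;> omega

/-- Three parts need only 16 by density, and 22 is what remains for five or more vertices after one
more sparse refinement. It serves the case of two parts with two lifts. -/
theorem crossing_of_three (hn : 5 ≤ A.card) {f : V → ℕ} (ht : (A.image f).card = 3) :
    22 ≤ crossing m A f := by
  obtain ⟨c, hc⟩ := exists_large_fibre (A := A) (f := f) (by omega)
  obtain ⟨q, f', hq, -, h1, h3⟩ := hs.exists_refinement (by omega) hc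
  by_cases hq2 : q = 2
  · have h4 := crossing_gap hd hs (f := f') (by omega) (by omega)
    rw [show (A.image f').card = 4 by omega] at h4
    subst hq2
    simp [bound] at *
    omega
  · have h4 := hd f'
    rw [show (A.image f').card = q + 2 by omega] at h4
    revert h3 h4
    unfold bound
    split_ifs <;> omega

/-- The slack that admits two lifts at different vertices before contracting `X`. -/
theorem crossing_gap_four (hn : 5 ≤ A.card) {X : Finset V} (hXA : X ⊆ A) (hX : 3 ≤ X.card)
    (hX' : X.card = 3 → crossing m X id ≤ 12) {f : V → ℕ} {c : ℕ}
    (hf : ∀ x ∈ X, f x = c) (ht : 2 ≤ (A.image f).card) {v v' : V} (hvv : v ≠ v') (hv : v ∈ A)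
    (hv' : v' ∈ A) :
    2 * bound (A.image f).card + (if f v = c then 0 else 4) + (if f v' = c then 0 else 4) ≤
      crossing m A f := by
  set Y := A.filter fun v => f v = c with hY
  have hXY : X ⊆ Y := fun x hx => mem_filter.2 ⟨hXA hx, hf x hx⟩
  have hYc : 3 ≤ Y.card := hX.trans (card_le_card hXY)
  have hYn := card_image_le_card_sdiff A f c
  rw [← hY] at hYn
  -- If the part is exactly `X` with three vertices, splitting it into singletons costs at most 12,
  -- better than what sparsity guarantees.
  by_cases h3 : Y.card = 3
  · have hXe : X = Y := eq_of_subset_of_card_le hXY (by omega)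
    obtain ⟨Q, hQ⟩ := exists_injective_nat V
    obtain ⟨f', h1, h2⟩ := exists_refinement m A f c (card_pos.1 (le_trans (by omega) hYc)) Q
    rw [card_image_of_injective _ hQ, ← hY, h3] at h2
    rw [← hY] at h1
    have h4 : crossing m Y Q ≤ 12 := by
      refine le_trans (le_of_eq ?_) (hX' (by rw [hXe, h3]))
      simp only [hXe, crossing, hQ.eq_iff, id]
    suffices 2 * bound (A.image f).card + 8 ≤ crossing m A f by split_ifs <;> omega
    by_cases ht2 : (A.image f).card = 2
    · have h5 := crossing_gap hd hs (f := f') (by omega) (by omega)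
      rw [show (A.image f').card = 4 by omega] at h5
      rw [ht2]
      simp [bound] at *
      omega
    · have h5 := hd f'
      rw [show (A.image f').card = (A.image f).card + 2 by omega] at h5
      revert h5
      unfold bound
      split_ifs <;> omega
  · obtain ⟨q, f', hq, hqY, h1, h2⟩ := hs.exists_refinement ht (c := c) (le_trans (by omega) hYc)
    rw [← hY] at hqY
    have hd' := hd f'
    by_cases ht2 : (A.image f).card = 2
    · by_cases hq2 : q = 2
      · have h5 := crossing_of_three hd hs hn (f := f') (by omega)
        rw [ht2]
        subst hq2
        simp [bound] at *
        split_ifs <;> omega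
      by_cases hlt : (A.image f').card < A.card
      · have h5 := crossing_gap hd hs (f := f') (by omega) hlt
        rw [show (A.image f').card + 1 = q + 2 by omega] at h5
        suffices 2 * bound (A.image f).card + 8 ≤ crossing m A f by split_ifs <;> omega
        rw [ht2]
        revert h2 h5
        unfold bound
        split_ifs <;> omega
      -- Here the refinement is discrete and has no slack to offer. But then the part of `X` misses
      -- at most one vertex, so at most one of the two lifts costs anything.
      · have hone : f v = c ∨ f v' = c := by
          by_contra! hcon
          have h6 : Y ⊆ (A.erase v).erase v' := by
            intro a ha
            obtain ⟨haA, hac⟩ := mem_filter.1 ha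
            refine mem_erase.2 ⟨?_, mem_erase.2 ⟨?_, haA⟩⟩
            · rintro rfl; exact hcon.2 hac
            · rintro rfl; exact hcon.1 hac
          have h7 := card_le_card h6
          rw [card_erase_of_mem (mem_erase.2 ⟨hvv.symm, hv'⟩), card_erase_of_mem hv] at h7
          omega
        suffices 2 * bound (A.image f).card + 4 ≤ crossing m A f by
          rcases hone with h | h <;> simp only [h, if_true] <;> split_ifs <;> omega
        exact crossing_gap_two hd hs (by omega) ht (by omega)
    · suffices 2 * bound (A.image f).card + 8 ≤ crossing m A f by split_ifs <;> omega
      by_cases hq3 : q ≤ 3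
      · have h5 := crossing_gap hd hs (f := f') (by omega) (by omega)
        rw [show (A.image f').card + 1 = (A.image f).card + q by omega] at h5
        revert h2 h5
        unfold bound
        split_ifs <;> omega
      · rw [show (A.image f').card = (A.image f).card + q - 1 by omega] at hd'
        revert h2 hd'
        unfold bound
        split_ifs <;> omega

end Gap

end

section

variable {V E : Type*} [Fintype V] [DecidableEq V] [Fintype E] [DecidableEq E]

/-! ### Contraction and lifting of dense planar multigraphs -/

/-- The pairs of vertices of `A` with positive multiplicity are joined by edges of a planar
multigraph whose edges are elements of `E`. -/
def PlanarSupport (E : Type*) [Fintype E] [DecidableEq E] (m : V → V → ℕ) (A : Finset V) : Prop :=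
  ∃ (s t : E → V) (S : Finset E), PlanarEdges s t S ∧
    ∀ x ∈ A, ∀ y ∈ A, x ≠ y → 0 < m x y → ∃ e ∈ S, Joins s t e x y

theorem PlanarSupport.mono {m m' : V → V → ℕ} {A A' : Finset V} (h : PlanarSupport E m A)
    (hA : A' ⊆ A) (hm : ∀ x ∈ A', ∀ y ∈ A', x ≠ y → 0 < m' x y → 0 < m x y) :
    PlanarSupport E m' A' := by
  obtain ⟨s, t, S, hS, hj⟩ := h
  exact ⟨s, t, S, hS, fun x hx y hy hxy h0 => hj x (hA hx) y (hA hy) hxy (hm x hx y hy hxy h0)⟩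

/-- Strong connectivity modulo five implies connectivity, which is all that contraction in a
two-cover needs. -/
theorem PlanarSupport.contract {m : V → V → ℕ} {A X : Finset V} (h : PlanarSupport E m A)
    (hXA : X ⊆ A) {r : V} (hr : r ∈ X) (hX : StronglyConn m X) :
    PlanarSupport E (contract m X r) (insert r (A \ X)) := by
  obtain ⟨s, t, S, hS, hj⟩ := h
  have hconn : ConnectedOn s t S X := by
    intro Y hYX hY hne
    obtain ⟨y, hy, x, hx, h0⟩ := hX.exists_edge hYX hY hne
    have hxX := (mem_sdiff.1 hx).1
    obtain ⟨e, he, hej⟩ := hj y (hXA (hYX hy)) x (hXA hxX)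
      (fun h => (mem_sdiff.1 hx).2 (h ▸ hy)) h0
    exact ⟨e, he, y, hy, x, hx, hej⟩
  refine ⟨_, _, _, hS.contract hr hconn, ?_⟩
  have hfib : ∀ u ∈ insert r (A \ X), ∀ x ∈ (if u = r then X else {u}),
      x ∈ A ∧ collapse X r x = u := by
    intro u hu x hx
    by_cases hur : u = r
    · rw [if_pos hur] at hx
      exact ⟨hXA hx, by simp [collapse, hx, hur]⟩
    · rw [if_neg hur, mem_singleton] at hx
      subst hx
      have := (mem_insert.1 hu).resolve_left hur
      rw [mem_sdiff] at this
      exact ⟨this.1, by simp [collapse, this.2]⟩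
  intro u hu w hw huw h0
  unfold PlanarFlow.contract at h0
  obtain ⟨x, hx, hx0⟩ := exists_ne_zero_of_sum_ne_zero h0.ne'
  obtain ⟨y, hy, hy0⟩ := exists_ne_zero_of_sum_ne_zero hx0
  obtain ⟨hxA, hxu⟩ := hfib u hu x hx
  obtain ⟨hyA, hyw⟩ := hfib w hw y hy
  obtain ⟨e, he, hej⟩ := hj x hxA y hyA (fun h => huw (by rw [← hxu, ← hyw, h]))
    (Nat.pos_of_ne_zero hy0)
  have hej' : Joins (collapse X r ∘ s) (collapse X r ∘ t) e u w := by
    rcases hej with ⟨h1, h2⟩ | ⟨h1, h2⟩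
    · exact Or.inl ⟨by simp [h1, hxu], by simp [h2, hyw]⟩
    · exact Or.inr ⟨by simp [h1, hyw], by simp [h2, hxu]⟩
  refine ⟨e, mem_filter.2 ⟨he, ?_⟩, hej'⟩
  rintro ⟨h1, h2⟩
  have : collapse X r (s e) = collapse X r (t e) := by simp [collapse, h1, h2]
  rcases hej' with ⟨h3, h4⟩ | ⟨h3, h4⟩
  · exact huw (h3.symm.trans (this.trans h4))
  · exact huw (h4.symm.trans (this.symm.trans h3))

theorem sum_collapse {M : Type*} [AddCommMonoid M] {A X : Finset V} (hXA : X ⊆ A) {r : V}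
    (hr : r ∈ X) (H : V → V → M) :
    ∑ u ∈ insert r (A \ X), ∑ x ∈ (if u = r then X else {u}), H u x =
      ∑ x ∈ A, H (collapse X r x) x := by
  have hrA : r ∉ A \ X := by simp [hr]
  rw [sum_insert hrA, if_pos rfl, ← sum_sdiff hXA, add_comm]
  congr 1
  · refine sum_congr rfl fun u hu => ?_
    have hur : u ≠ r := fun h => hrA (h ▸ hu)
    rw [if_neg hur, sum_singleton, collapse, if_neg (mem_sdiff.1 hu).2]
  · refine sum_congr rfl fun u hu => ?_
    rw [collapse, if_pos hu]

theorem crossing_contract {m : V → V → ℕ} {A X : Finset V} (hXA : X ⊆ A) {r : V} (hr : r ∈ X)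
    (f : V → ℕ) : crossing (contract m X r) (insert r (A \ X)) f =
      crossing m A (f ∘ collapse X r) := by
  unfold crossing contract
  have h1 : ∀ u w, (if f u = f w then 0 else
      ∑ x ∈ (if u = r then X else {u}), ∑ y ∈ (if w = r then X else {w}), m x y) =
      ∑ x ∈ (if u = r then X else {u}), ∑ y ∈ (if w = r then X else {w}),
        if f u = f w then 0 else m x y := by
    intro u w
    by_cases h : f u = f w <;> simp [h]
  simp only [h1]
  have h2 : ∀ u, ∑ w ∈ insert r (A \ X), ∑ x ∈ (if u = r then X else {u}),
      ∑ y ∈ (if w = r then X else {w}), (if f u = f w then 0 else m x y) =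
      ∑ x ∈ (if u = r then X else {u}), ∑ y ∈ A,
        (if f u = f (collapse X r y) then 0 else m x y) := by
    intro u
    rw [sum_comm]
    refine sum_congr rfl fun x _ => ?_
    exact sum_collapse hXA hr fun w y => if f u = f w then 0 else m x y
  simp only [h2]
  exact sum_collapse hXA hr fun u x =>
    ∑ y ∈ A, if f u = f (collapse X r y) then 0 else m x y

theorem image_collapse {A X : Finset V} (hXA : X ⊆ A) {r : V} (hr : r ∈ X) :
    A.image (collapse X r) = insert r (A \ X) := by
  ext u
  simp only [mem_image, mem_insert, mem_sdiff, collapse]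
  constructor
  · rintro ⟨v, hv, rfl⟩
    split_ifs with h
    · exact Or.inl rfl
    · exact Or.inr ⟨hv, h⟩
  · rintro (rfl | ⟨h1, h2⟩)
    · exact ⟨u, hXA hr, by simp [hr]⟩
    · exact ⟨u, h1, by simp [h2]⟩

theorem card_contract_lt {A X : Finset V} (hXA : X ⊆ A) (r : V) (hX : 2 ≤ X.card) :
    (insert r (A \ X)).card < A.card := by
  have h1 := card_insert_le r (A \ X)
  have h2 := card_sdiff_add_card_eq_card hXA
  omega

theorem crossing_add (m m' : V → V → ℕ) (A : Finset V) (f : V → ℕ) :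
    crossing (fun u w => m u w + m' u w) A f = crossing m A f + crossing m' A f := by
  simp only [crossing, ← sum_add_distrib]
  refine sum_congr rfl fun x _ => sum_congr rfl fun y _ => ?_
  split_ifs <;> simp

theorem crossing_pairInd {A : Finset V} {a b : V} (ha : a ∈ A) (hb : b ∈ A) (hab : a ≠ b)
    (f : V → ℕ) : crossing (pairInd a b) A f = if f a = f b then 0 else 2 := by
  have h1 : ∀ u w, (if f u = f w then 0 else pairInd a b u w) =
      (if u = a then (if w = b then (if f a = f b then 0 else 1) else 0) else 0) +
      (if u = b then (if w = a then (if f a = f b then 0 else 1) else 0) else 0) := by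
    intro u w
    by_cases h1 : u = a
    · subst h1
      by_cases h2 : w = b
      · subst h2; simp [pairInd, hab]
      · simp [pairInd, h2, hab]
    · by_cases h2 : u = b
      · subst h2
        by_cases h3 : w = a
        · subst h3; simp [pairInd, h1, eq_comm]
        · simp [pairInd, h1, h3]
      · simp [pairInd, h1, h2]
  simp only [crossing, h1, sum_add_distrib]
  simp [ha, hb]
  split_ifs <;> rfl

/-- If `x` and `y` lie in one part, the new edge `xy` is not crossing. The removed edges `xv` and
`vy` both cross when `v` is in another part, and each is counted twice. -/
theorem IsLift.crossing_eq {m m' : V → V → ℕ} {x v y : V} (hl : IsLift m m' x v y)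
    (hxv : x ≠ v) (hvy : v ≠ y) (hxy : x ≠ y) {A : Finset V} (hx : x ∈ A) (hv : v ∈ A)
    (hy : y ∈ A) {f : V → ℕ} {c : ℕ} (hfx : f x = c) (hfy : f y = c) :
    crossing m A f = crossing m' A f + if f v = c then 0 else 4 := by
  have h1 : crossing (fun u w => m u w + pairInd x y u w) A f =
      crossing (fun u w => m' u w + pairInd x v u w + pairInd v y u w) A f := by
    congr 1
    funext u w
    exact hl u w
  rw [crossing_add, crossing_add (fun u w => m' u w + pairInd x v u w), crossing_add,
    crossing_pairInd hx hy hxy, crossing_pairInd hx hv hxv, crossing_pairInd hv hy hvy, hfx,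
    hfy] at h1
  by_cases h : f v = c
  · simpa [h] using h1
  · simp [h, Ne.symm h] at h1 ⊢
    omega

/-- Lifting the edges `xv` and `vy`. -/
def lift (m : V → V → ℕ) (x v y u w : V) : ℕ :=
  m u w + pairInd x y u w - pairInd x v u w - pairInd v y u w

theorem lift_symm {m : V → V → ℕ} (hsym : ∀ u w, m u w = m w u) (x v y u w : V) :
    lift m x v y u w = lift m x v y w u := by
  unfold lift
  rw [hsym, pairInd_symm x y, pairInd_symm x v, pairInd_symm v y]

theorem isLift_lift {m : V → V → ℕ} (hsym : ∀ u w, m u w = m w u) {x v y : V} (hxv : x ≠ v)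
    (hvy : v ≠ y) (hxy : x ≠ y) (h1 : 0 < m x v) (h2 : 0 < m v y) :
    IsLift m (lift m x v y) x v y := by
  intro u w
  have h3 : pairInd x v u w + pairInd v y u w ≤ m u w := by
    have h4 := hsym v x
    have h5 := hsym y v
    unfold pairInd
    split_ifs with a b b
    · rcases a with ⟨rfl, rfl⟩ | ⟨rfl, rfl⟩ <;> rcases b with ⟨h6, h7⟩ | ⟨h6, h7⟩
      · exact absurd h6 hxv
      · exact absurd h6 hxy
      · exact absurd h7 hxy
      · exact absurd h6 hvy
    · rcases a with ⟨rfl, rfl⟩ | ⟨rfl, rfl⟩ <;> omega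
    · rcases b with ⟨rfl, rfl⟩ | ⟨rfl, rfl⟩ <;> omega
    · omega
  unfold lift
  omega

theorem lift_of_ne {m : V → V → ℕ} {x v y u w : V} (hu : u ≠ v) (hw : w ≠ v) :
    lift m x v y u w = m u w + pairInd x y u w := by
  simp [lift, pairInd, hu, hw]

theorem StronglyConn.congr {m m' : V → V → ℕ} {X : Finset V} (h : StronglyConn m X)
    (hm : ∀ x ∈ X, ∀ y ∈ X, m x y = m' x y) : StronglyConn m' X := by
  intro β hβ
  obtain ⟨g, h1, h2, h3⟩ := h β hβ
  exact ⟨g, h1, fun x hx y hy hxy => hm x hx y hy ▸ h2 x hx y hy hxy, h3⟩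

/-! ### Minimal counterexamples -/

/-- A vertex-minimal dense planar multigraph that is not strongly connected. -/
structure Critical (E : Type*) [Fintype E] [DecidableEq E] (m : V → V → ℕ) (A : Finset V) :
    Prop where
  symm : ∀ u w, m u w = m w u
  planar : PlanarSupport E m A
  dense : Dense m A
  not_conn : ¬ StronglyConn m A
  minimal : ∀ (m' : V → V → ℕ) (A' : Finset V), A'.card < A.card → (∀ u w, m' u w = m' w u) →
    PlanarSupport E m' A' → Dense m' A' → StronglyConn m' A'

namespace Critical

variable {m : V → V → ℕ} {A : Finset V} (h : Critical E m A)

include h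

/-- This is the common reduction step: after lifting, `X` is contracted and minimality is applied to
the result. Partitions of the contracted graph pull back to partitions constant on `X`, so only
these need many crossing edges. -/
theorem reduce {m' : V → V → ℕ} (hsym : ∀ u w, m' u w = m' w u)
    (hreal : ∀ β, Realizes m' A β → Realizes m A β)
    (hsupp : ∀ x ∈ A, ∀ y ∈ A, x ≠ y → 0 < m' x y → 0 < m x y) {X : Finset V} (hXA : X ⊆ A)
    (hX : 2 ≤ X.card) (hconn : StronglyConn m' X)
    (hcr : ∀ (f : V → ℕ) (c : ℕ), (∀ x ∈ X, f x = c) → 2 ≤ (A.image f).card →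
      2 * bound (A.image f).card ≤ crossing m' A f) : False := by
  obtain ⟨r, hr⟩ : X.Nonempty := card_pos.1 (by omega)
  refine h.not_conn fun β hβ => hreal β ?_
  refine StronglyConn.of_contract hsym hXA hr hconn ?_ β hβ
  refine h.minimal _ _ (card_contract_lt hXA r hX) (contract_symm hsym X r)
    ((h.planar.mono Subset.rfl hsupp).contract hXA hr hconn) ?_
  intro f
  rw [crossing_contract hXA hr, ← image_collapse hXA hr, image_image]
  by_cases ht : 2 ≤ (A.image (f ∘ collapse X r)).card
  · exact hcr _ (f r) (fun x hx => by simp [collapse, hx]) ht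
  · have : bound (A.image (f ∘ collapse X r)).card = 0 := by
      unfold bound; rw [if_pos (by omega)]
    rw [this]; omega

theorem not_stronglyConn {X : Finset V} (hXA : X ⊆ A) (hX : 2 ≤ X.card) : ¬ StronglyConn m X :=
  fun hc => h.reduce h.symm (fun _ => id) (fun _ _ _ _ _ => id) hXA hX hc fun f _ _ _ => h.dense f

/-- Crossing numbers are even, so without such a partition `Y` would be dense. Minimality would make
it strongly connected, and it could be contracted. -/
theorem sparse : Sparse m A := by
  intro Y hY h2 hlt
  by_contra! hcon
  refine h.not_stronglyConn hY h2 (h.minimal m Y hlt h.symm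
    (h.planar.mono hY fun _ _ _ _ _ => id) ?_)
  intro Q
  by_cases hq : 2 ≤ (Y.image Q).card
  · have h1 := hcon Q hq
    obtain ⟨a, ha⟩ := even_crossing h.symm Y Q
    omega
  · have : bound (Y.image Q).card = 0 := by unfold bound; rw [if_pos (by omega)]
    rw [this]; omega

/-- Lifting at `v` adds the edge that `X` lacks, and the slack of 4 pays for it before `X` is
contracted. As `x` and `y` are already adjacent, the support does not grow and planarity is not at
stake. -/
theorem no_lift {X : Finset V} (hXA : X ⊆ A) {x y v : V} (hx : x ∈ X) (hy : y ∈ X) (hxy : x ≠ y)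
    (hm : 0 < m x y) (hv : v ∈ A) (hvX : v ∉ X) (hxv : 0 < m x v) (hvy : 0 < m v y)
    (hn : 4 ≤ A.card) (hc : StronglyConn (fun a b => m a b + pairInd x y a b) X) : False := by
  have nxv : x ≠ v := fun e => hvX (e ▸ hx)
  have nvy : v ≠ y := fun e => hvX (e ▸ hy)
  have hl := isLift_lift h.symm nxv nvy hxy hxv hvy
  have hX2 : 2 ≤ X.card := one_lt_card.2 ⟨x, hx, y, hy, hxy⟩
  refine h.reduce (lift_symm h.symm x v y)
    (fun β => Realizes.of_lift h.symm hl nxv nvy hxy (hXA hx) hv (hXA hy)) ?_ hXA hX2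
    (hc.congr fun a ha b hb => (lift_of_ne (ne_of_mem_of_not_mem ha hvX)
      (ne_of_mem_of_not_mem hb hvX)).symm) ?_
  · intro a _ b _ _ h0
    have h1 := hl a b
    by_cases hp : (a = x ∧ b = y) ∨ (a = y ∧ b = x)
    · rcases hp with ⟨rfl, rfl⟩ | ⟨rfl, rfl⟩
      · exact hm
      · rw [h.symm]; exact hm
    · have : pairInd x y a b = 0 := by simp [pairInd, hp]
      omega
  · intro f c hf ht
    have h1 := hl.crossing_eq nxv nvy hxy (hXA hx) hv (hXA hy) (hf x hx) (hf y hy)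
    have hlt : (A.image f).card < A.card := by
      have h3 := card_image_le_card_sdiff A f c
      have h4 : X ⊆ A.filter fun v => f v = c := fun a ha => mem_filter.2 ⟨hXA ha, hf a ha⟩
      have := card_le_card h4
      omega
    have h2 := crossing_gap_two h.dense h.sparse hn ht hlt
    split_ifs at h1 <;> omega

/-- The same argument with lifts at two different outside vertices, paid for by the slack of
`crossing_gap_four`. -/
theorem no_two_lifts {X : Finset V} (hXA : X ⊆ A) (hX : 3 ≤ X.card)
    (hX' : X.card = 3 → crossing m X id ≤ 12) {x y v x' y' v' : V}
    (hx : x ∈ X) (hy : y ∈ X) (hxy : x ≠ y) (hm : 0 < m x y) (hx' : x' ∈ X) (hy' : y' ∈ X)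
    (hxy' : x' ≠ y') (hm' : 0 < m x' y') (hv : v ∈ A) (hvX : v ∉ X) (hv' : v' ∈ A) (hvX' : v' ∉ X)
    (hne : v ≠ v') (hxv : 0 < m x v) (hvy : 0 < m v y) (hxv' : 0 < m x' v') (hvy' : 0 < m v' y')
    (hc : StronglyConn (fun a b => m a b + pairInd x y a b + pairInd x' y' a b) X) : False := by
  have nxv : x ≠ v := fun e => hvX (e ▸ hx)
  have nvy : v ≠ y := fun e => hvX (e ▸ hy)
  have nxv' : x' ≠ v' := fun e => hvX' (e ▸ hx')
  have nvy' : v' ≠ y' := fun e => hvX' (e ▸ hy')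
  have nx'v : x' ≠ v := fun e => hvX (e ▸ hx')
  have ny'v : y' ≠ v := fun e => hvX (e ▸ hy')
  have hl := isLift_lift h.symm nxv nvy hxy hxv hvy
  have hs1 := lift_symm h.symm x v y
  have hl' := isLift_lift hs1 nxv' nvy' hxy'
    (by rw [lift_of_ne nx'v hne.symm]; omega) (by rw [lift_of_ne hne.symm ny'v]; omega)
  have hn : 5 ≤ A.card := by
    have h1 : insert v (insert v' X) ⊆ A := by
      intro a ha
      simp only [mem_insert] at ha
      rcases ha with rfl | rfl | ha
      · exact hv
      · exact hv'
      · exact hXA ha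
    have h2 := card_le_card h1
    rw [card_insert_of_notMem (by simp [hne, hvX]), card_insert_of_notMem hvX'] at h2
    omega
  refine h.reduce (lift_symm hs1 x' v' y')
    (fun β hβ => Realizes.of_lift h.symm hl nxv nvy hxy (hXA hx) hv (hXA hy)
      (Realizes.of_lift hs1 hl' nxv' nvy' hxy' (hXA hx') hv' (hXA hy') hβ)) ?_ hXA (by omega)
    (hc.congr fun a ha b hb => ?_) ?_
  · intro a _ b _ _ h0
    have h1 := hl a b
    have h2 := hl' a b
    by_cases hp : (a = x ∧ b = y) ∨ (a = y ∧ b = x)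
    · rcases hp with ⟨rfl, rfl⟩ | ⟨rfl, rfl⟩
      · exact hm
      · rw [h.symm]; exact hm
    by_cases hp' : (a = x' ∧ b = y') ∨ (a = y' ∧ b = x')
    · rcases hp' with ⟨rfl, rfl⟩ | ⟨rfl, rfl⟩
      · exact hm'
      · rw [h.symm]; exact hm'
    · have e1 : pairInd x y a b = 0 := by simp [pairInd, hp]
      have e2 : pairInd x' y' a b = 0 := by simp [pairInd, hp']
      omega
  · rw [lift_of_ne (ne_of_mem_of_not_mem ha hvX') (ne_of_mem_of_not_mem hb hvX'),
      lift_of_ne (ne_of_mem_of_not_mem ha hvX) (ne_of_mem_of_not_mem hb hvX)]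
  · intro f c hf ht
    have h1 := hl.crossing_eq nxv nvy hxy (hXA hx) hv (hXA hy) (hf x hx) (hf y hy)
    have h2 := hl'.crossing_eq nxv' nvy' hxy' (hXA hx') hv' (hXA hy') (hf x' hx') (hf y' hy')
    have h3 := crossing_gap_four h.dense h.sparse hn hXA hX hX' hf ht hne hv hv'
    omega

end Critical

end

/-! ### Configurations excluded from a minimal counterexample -/

section

variable {V E : Type*} [Fintype V] [DecidableEq V] [Fintype E] [DecidableEq E]

theorem injective_three {x y z : V} (hxy : x ≠ y) (hyz : y ≠ z) (hxz : x ≠ z) :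
    Function.Injective ![x, y, z] := by
  intro i j hij
  fin_cases i <;> fin_cases j <;> simp_all

theorem injective_four {x y z w : V} (hxy : x ≠ y) (hxz : x ≠ z) (hxw : x ≠ w) (hyz : y ≠ z)
    (hyw : y ≠ w) (hzw : z ≠ w) : Function.Injective ![x, y, z, w] := by
  intro i j hij
  fin_cases i <;> fin_cases j <;> simp_all

theorem card_four {x y z w : V} (hxy : x ≠ y) (hxz : x ≠ z) (hxw : x ≠ w) (hyz : y ≠ z)
    (hyw : y ≠ w) (hzw : z ≠ w) : ({x, y, z, w} : Finset V).card = 4 := by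
  rw [card_insert_of_notMem (by simp [hxy, hxz, hxw]),
    card_eq_three.2 ⟨y, z, w, hyz, hyw, hzw, rfl⟩]

theorem Dense.le_crossing_id {m : V → V → ℕ} {A : Finset V} (h : Dense m A) :
    2 * bound A.card ≤ crossing m A id := by
  obtain ⟨Q, hQ⟩ := exists_injective_nat V
  have := h Q
  rw [card_image_of_injective _ hQ] at this
  refine this.trans (le_of_eq ?_)
  simp only [crossing, hQ.eq_iff, id]

/-- The total deficit below four is at most four; for multiplicities up to three this means at least
eight edges in all. -/
theorem stronglyConn_triangle {m : V → V → ℕ} (hsym : ∀ u w, m u w = m w u) {x y z : V}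
    (hxy : x ≠ y) (hyz : y ≠ z) (hxz : x ≠ z)
    (h : (4 - m x y) + (4 - m y z) + (4 - m z x) ≤ 4) : StronglyConn m {x, y, z} := by
  have h1 := stronglyConn_cycle (n := 0) hsym (injective_three hxy hyz hxz)
    (by simpa [Fin.sum_univ_three] using h)
  convert h1 using 1
  ext a
  simp [Fin.exists_fin_succ, eq_comm]

theorem stronglyConn_four_cycle {m : V → V → ℕ} (hsym : ∀ u w, m u w = m w u) {x y z w : V}
    (hxy : x ≠ y) (hxz : x ≠ z) (hxw : x ≠ w) (hyz : y ≠ z) (hyw : y ≠ w) (hzw : z ≠ w)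
    (h : (4 - m x y) + (4 - m y z) + (4 - m z w) + (4 - m w x) ≤ 4) :
    StronglyConn m {x, y, z, w} := by
  have h1 := stronglyConn_cycle (n := 1) hsym (injective_four hxy hxz hxw hyz hyw hzw)
    (by simpa [Fin.sum_univ_four] using h)
  convert h1 using 1
  ext a
  simp [Fin.exists_fin_succ, eq_comm]

theorem crossing_triple {m : V → V → ℕ} (hsym : ∀ u w, m u w = m w u) {x y z : V}
    (hxy : x ≠ y) (hyz : y ≠ z) (hxz : x ≠ z) :
    crossing m {x, y, z} id = 2 * (m x y + m y z + m z x) := by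
  have e1 : x ∉ ({y, z} : Finset V) := by simp [hxy, hxz]
  have e2 : y ∉ ({z} : Finset V) := by simp [hyz]
  simp only [crossing, sum_insert e1, sum_insert e2, sum_singleton, id, hxy, hyz, hxz, hxy.symm,
    hyz.symm, hxz.symm, if_false, if_true]
  rw [hsym y x, hsym z y, hsym x z]
  ring

namespace Critical

variable {m : V → V → ℕ} {A : Finset V} (h : Critical E m A)

include h

theorem le_three {x y : V} (hx : x ∈ A) (hy : y ∈ A) (hxy : x ≠ y) : m x y ≤ 3 := by
  by_contra! hc
  refine h.not_stronglyConn (X := {x, y}) ?_ (by rw [card_pair hxy])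
    (stronglyConn_pair hxy hc (by rw [h.symm]; exact hc))
  intro a ha
  simp only [mem_insert, mem_singleton] at ha
  rcases ha with rfl | rfl <;> assumption

theorem triple_le {x y z : V} (hx : x ∈ A) (hy : y ∈ A) (hz : z ∈ A) (hxy : x ≠ y) (hyz : y ≠ z)
    (hxz : x ≠ z) : m x y + m y z + m z x ≤ 7 := by
  by_contra! hc
  have h1 := h.le_three hx hy hxy
  have h2 := h.le_three hy hz hyz
  have h3 := h.le_three hz hx hxz.symm
  refine h.not_stronglyConn (X := {x, y, z}) ?_
    (by rw [card_eq_three.2 ⟨x, y, z, hxy, hxz, hyz, rfl⟩]; omega)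
    (stronglyConn_triangle h.symm hxy hyz hxz (by omega))
  intro a ha
  simp only [mem_insert, mem_singleton] at ha
  rcases ha with rfl | rfl | rfl <;> assumption

theorem symm_add_pairInd (x y : V) : ∀ u w, m u w + pairInd x y u w = m w u + pairInd x y w u :=
  fun u w => by rw [h.symm, pairInd_symm]

/-- A triangle with seven edges is one edge short of being strongly connected, and a common
neighbour of `x` and `y` supplies that edge by a lift. -/
theorem no_heavy_triple {x y z v : V} (hx : x ∈ A) (hy : y ∈ A) (hz : z ∈ A) (hxy : x ≠ y)
    (hyz : y ≠ z) (hxz : x ≠ z) (hm : 7 ≤ m x y + m y z + m z x) (hv : v ∈ A) (hvx : v ≠ x)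
    (hvy : v ≠ y) (hvz : v ≠ z) (h1 : 0 < m x v) (h2 : 0 < m v y) : False := by
  have a1 := h.le_three hx hy hxy
  have a2 := h.le_three hy hz hyz
  have a3 := h.le_three hz hx hxz.symm
  have hXA : ({x, y, z} : Finset V) ⊆ A := by
    intro a ha
    simp only [mem_insert, mem_singleton] at ha
    rcases ha with rfl | rfl | rfl <;> assumption
  have hvX : v ∉ ({x, y, z} : Finset V) := by simp [hvx, hvy, hvz]
  have hn : 4 ≤ A.card := by
    have := card_le_card (insert_subset hv hXA)
    rw [card_insert_of_notMem hvX, card_eq_three.2 ⟨x, y, z, hxy, hxz, hyz, rfl⟩] at this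
    exact this
  refine h.no_lift hXA (by simp) (by simp) hxy (by omega) hv hvX h1 h2 hn
    (stronglyConn_triangle (h.symm_add_pairInd x y) hxy hyz hxz ?_)
  simp [pairInd, hxy, hyz, hxz, hxy.symm, hyz.symm, hxz.symm]
  omega

/-- With six edges two lifts are needed. Both may go to the side `xy` only if its multiplicity is at
most 2, since edges beyond the fourth in a class are wasted. -/
theorem no_two_apexes {x y z v v' : V} (hx : x ∈ A) (hy : y ∈ A) (hz : z ∈ A) (hxy : x ≠ y)
    (hyz : y ≠ z) (hxz : x ≠ z) (hm : 6 ≤ m x y + m y z + m z x) (m1 : 0 < m x y) (m2 : 0 < m y z)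
    (m3 : 0 < m z x) (hv : v ∈ A) (hvx : v ≠ x) (hvy : v ≠ y) (hvz : v ≠ z) (hv' : v' ∈ A)
    (hvx' : v' ≠ x) (hvy' : v' ≠ y) (hvz' : v' ≠ z) (hne : v ≠ v')
    (h1 : 0 < m x v) (h2 : 0 < m v y)
    (h3 : (0 < m y v' ∧ 0 < m v' z) ∨ (0 < m x v' ∧ 0 < m v' y ∧ m x y ≤ 2)) : False := by
  have a1 := h.le_three hx hy hxy
  have a2 := h.le_three hy hz hyz
  have a3 := h.le_three hz hx hxz.symm
  have hXA : ({x, y, z} : Finset V) ⊆ A := by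
    intro a ha
    simp only [mem_insert, mem_singleton] at ha
    rcases ha with rfl | rfl | rfl <;> assumption
  have hvX : v ∉ ({x, y, z} : Finset V) := by simp [hvx, hvy, hvz]
  have hvX' : v' ∉ ({x, y, z} : Finset V) := by simp [hvx', hvy', hvz']
  have h7 : m x y + m y z + m z x ≤ 6 := by
    by_contra! hc
    exact h.no_heavy_triple hx hy hz hxy hyz hxz hc hv hvx hvy hvz h1 h2
  have hcard := card_eq_three.2 ⟨x, y, z, hxy, hxz, hyz, rfl⟩
  have hcr : crossing m {x, y, z} id ≤ 12 := by
    rw [crossing_triple h.symm hxy hyz hxz]; omega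
  have hsym : ∀ a b, ∀ u w, m u w + pairInd x y u w + pairInd a b u w =
      m w u + pairInd x y w u + pairInd a b w u := fun a b u w => by
    rw [h.symm_add_pairInd x y, pairInd_symm a b]
  rcases h3 with ⟨h3, h4⟩ | ⟨h3, h4, h5⟩
  · refine h.no_two_lifts hXA hcard.ge (fun _ => hcr) (by simp) (by simp) hxy m1 (by simp)
      (by simp) hyz m2 hv hvX hv' hvX' hne h1 h2 h3 h4
      (stronglyConn_triangle (hsym y z) hxy hyz hxz ?_)
    simp [pairInd, hxy, hyz, hxz, hxy.symm, hyz.symm, hxz.symm]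
    omega
  · refine h.no_two_lifts hXA hcard.ge (fun _ => hcr) (by simp) (by simp) hxy m1 (by simp)
      (by simp) hxy m1 hv hvX hv' hvX' hne h1 h2 h3 h4
      (stronglyConn_triangle (hsym x y) hxy hyz hxz ?_)
    simp [pairInd, hxy, hyz, hxz, hxy.symm, hyz.symm, hxz.symm]
    omega

section FourCycle

variable {x y z w : V} (hx : x ∈ A) (hy : y ∈ A) (hz : z ∈ A) (hw : w ∈ A) (hxy : x ≠ y)
  (hxz : x ≠ z) (hxw : x ≠ w) (hyz : y ≠ z) (hyw : y ≠ w) (hzw : z ≠ w)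

include hx hy hz hw hxy hxz hxw hyz hyw hzw

theorem four_cycle_le : m x y + m y z + m z w + m w x ≤ 11 := by
  by_contra! hc
  have a1 := h.le_three hx hy hxy
  have a2 := h.le_three hy hz hyz
  have a3 := h.le_three hz hw hzw
  have a4 := h.le_three hw hx hxw.symm
  refine h.not_stronglyConn (X := {x, y, z, w}) ?_ ?_
    (stronglyConn_four_cycle h.symm hxy hxz hxw hyz hyw hzw (by omega))
  · intro a ha
    simp only [mem_insert, mem_singleton] at ha
    rcases ha with rfl | rfl | rfl | rfl <;> assumption
  · exact one_lt_card.2 ⟨x, by simp, y, by simp, hxy⟩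

/-- A four-cycle becomes strongly connected with twelve edges, one more than here. -/
theorem no_apex_four_cycle (hm : 11 ≤ m x y + m y z + m z w + m w x) {v : V} (hv : v ∈ A)
    (hvx : v ≠ x) (hvy : v ≠ y) (hvz : v ≠ z) (hvw : v ≠ w) (h1 : 0 < m x v) (h2 : 0 < m v y) :
    False := by
  have a1 := h.le_three hx hy hxy
  have a2 := h.le_three hy hz hyz
  have a3 := h.le_three hz hw hzw
  have a4 := h.le_three hw hx hxw.symm
  have hXA : ({x, y, z, w} : Finset V) ⊆ A := by
    intro a ha
    simp only [mem_insert, mem_singleton] at ha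
    rcases ha with rfl | rfl | rfl | rfl <;> assumption
  have hvX : v ∉ ({x, y, z, w} : Finset V) := by simp [hvx, hvy, hvz, hvw]
  have hn : 4 ≤ A.card := by
    have := card_le_card hXA
    rwa [card_four hxy hxz hxw hyz hyw hzw] at this
  refine h.no_lift hXA (by simp) (by simp) hxy (by omega) hv hvX h1 h2 hn
    (stronglyConn_four_cycle (h.symm_add_pairInd x y) hxy hxz hxw hyz hyw hzw ?_)
  simp [pairInd, hxy, hyz, hxz, hxw, hyw, hzw, hxy.symm, hyz.symm, hxz.symm, hxw.symm, hyw.symm,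
    hzw.symm]
  omega

theorem no_two_apexes_four_cycle (hm : 10 ≤ m x y + m y z + m z w + m w x) {v v' : V} (hv : v ∈ A)
    (hvx : v ≠ x) (hvy : v ≠ y) (hvz : v ≠ z) (hvw : v ≠ w) (hv' : v' ∈ A)
    (hvx' : v' ≠ x) (hvy' : v' ≠ y) (hvz' : v' ≠ z) (hvw' : v' ≠ w) (hne : v ≠ v')
    (h1 : 0 < m x v) (h2 : 0 < m v y)
    (h3 : (0 < m y v' ∧ 0 < m v' z) ∨ (0 < m z v' ∧ 0 < m v' w)) : False := by
  have a1 := h.le_three hx hy hxy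
  have a2 := h.le_three hy hz hyz
  have a3 := h.le_three hz hw hzw
  have a4 := h.le_three hw hx hxw.symm
  have hXA : ({x, y, z, w} : Finset V) ⊆ A := by
    intro a ha
    simp only [mem_insert, mem_singleton] at ha
    rcases ha with rfl | rfl | rfl | rfl <;> assumption
  have hvX : v ∉ ({x, y, z, w} : Finset V) := by simp [hvx, hvy, hvz, hvw]
  have hvX' : v' ∉ ({x, y, z, w} : Finset V) := by simp [hvx', hvy', hvz', hvw']
  have hcard : ({x, y, z, w} : Finset V).card = 4 :=
    card_four hxy hxz hxw hyz hyw hzw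
  have hsym : ∀ a b, ∀ u w, m u w + pairInd x y u w + pairInd a b u w =
      m w u + pairInd x y w u + pairInd a b w u := fun a b u w => by
    rw [h.symm_add_pairInd x y, pairInd_symm a b]
  rcases h3 with ⟨h3, h4⟩ | ⟨h3, h4⟩
  · refine h.no_two_lifts hXA (by omega) (fun e => by omega) (by simp) (by simp) hxy (by omega)
      (by simp) (by simp) hyz (by omega) hv hvX hv' hvX' hne h1 h2 h3 h4
      (stronglyConn_four_cycle (hsym y z) hxy hxz hxw hyz hyw hzw ?_)
    simp [pairInd, hxy, hyz, hxz, hxw, hyw, hzw, hxy.symm, hyz.symm, hxz.symm, hxw.symm, hyw.symm,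
      hzw.symm]
    omega
  · refine h.no_two_lifts hXA (by omega) (fun e => by omega) (by simp) (by simp) hxy (by omega)
      (by simp) (by simp) hzw (by omega) hv hvX hv' hvX' hne h1 h2 h3 h4
      (stronglyConn_four_cycle (hsym z w) hxy hxz hxw hyz hyw hzw ?_)
    simp [pairInd, hxy, hyz, hxz, hxw, hyw, hzw, hxy.symm, hyz.symm, hxz.symm, hxw.symm, hyw.symm,
      hzw.symm]
    omega

end FourCycle

/-- A five-cycle of triple edges has deficit 5, one too many, and a single lift removes it. -/
theorem no_apex_five_cycle {x : Fin 5 → V} (hx : Function.Injective x) (hxA : ∀ i, x i ∈ A)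
    (hm : ∀ i, 3 ≤ m (x i) (x (i + 1))) (k : Fin 5) {v : V} (hv : v ∈ A) (hvx : ∀ i, v ≠ x i)
    (h1 : 0 < m (x k) v) (h2 : 0 < m v (x (k + 1))) : False := by
  have hXA : univ.image x ⊆ A := by
    intro a ha
    obtain ⟨i, -, rfl⟩ := mem_image.1 ha
    exact hxA i
  have hvX : v ∉ univ.image x := by
    simpa [eq_comm] using hvx
  have hn : 4 ≤ A.card := by
    have := card_le_card hXA
    rw [card_image_of_injective _ hx] at this
    simp at this; omega
  have hk : ∀ k : Fin 5, k ≠ k + 1 := by decide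
  refine h.no_lift hXA (mem_image_of_mem x (mem_univ k)) (mem_image_of_mem x (mem_univ (k + 1)))
    (hx.ne (hk k)) ((by omega : 0 < 3).trans_le (hm k)) hv hvX h1 h2 hn
    (stronglyConn_cycle (n := 2) (h.symm_add_pairInd _ _) hx ?_)
  have : ∀ i : Fin 5, 4 - (m (x i) (x (i + 1)) + pairInd (x k) (x (k + 1)) (x i) (x (i + 1))) ≤
      if i = k then 0 else 1 := by
    intro i
    have := hm i
    split_ifs with hi
    · subst hi
      simp [pairInd]; omega
    · omega
  refine (sum_le_sum fun i _ => this i).trans ?_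
  clear * -
  revert k
  decide

theorem no_chord_five_cycle {x : Fin 5 → V} (hx : Function.Injective x) (hxA : ∀ i, x i ∈ A)
    (hm : ∀ i, 3 ≤ m (x i) (x (i + 1))) (k : Fin 5) (hk : 0 < m (x k) (x (k + 2))) : False := by
  refine h.not_stronglyConn (X := univ.image x) ?_ ?_
    (stronglyConn_five_cycle_chord h.symm hx hm k hk)
  · intro a ha
    obtain ⟨i, -, rfl⟩ := mem_image.1 ha
    exact hxA i
  · rw [card_image_of_injective _ hx]; simp

/-- Multiplicities are at most three, so six edges at `w` reach at least two vertices of the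
triangle, and `w` is an apex. -/
theorem no_heavy_triple_of_card_four {x y z w : V} (hA : A = {x, y, z, w}) (hxy : x ≠ y)
    (hxz : x ≠ z) (hxw : x ≠ w) (hyz : y ≠ z) (hyw : y ≠ w) (hzw : z ≠ w)
    (hm : 7 ≤ m x y + m y z + m z x) (hw : 6 ≤ m x w + m y w + m z w) : False := by
  have hx : x ∈ A := by simp [hA]
  have hy : y ∈ A := by simp [hA]
  have hz : z ∈ A := by simp [hA]
  have hwA : w ∈ A := by simp [hA]
  have a1 := h.le_three hx hwA hxw
  have a2 := h.le_three hy hwA hyw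
  have a3 := h.le_three hz hwA hzw
  have s1 := h.symm w x
  have s2 := h.symm w y
  have s3 := h.symm w z
  by_cases c1 : 0 < m x w ∧ 0 < m w y
  · exact h.no_heavy_triple hx hy hz hxy hyz hxz hm hwA hxw.symm hyw.symm hzw.symm c1.1 c1.2
  by_cases c2 : 0 < m y w ∧ 0 < m w z
  · exact h.no_heavy_triple hy hz hx hyz hxz.symm hxy.symm (by omega) hwA hyw.symm hzw.symm
      hxw.symm c2.1 c2.2
  by_cases c3 : 0 < m z w ∧ 0 < m w x
  · exact h.no_heavy_triple hz hx hy hxz.symm hxy hyz.symm (by omega) hwA hzw.symm hxw.symm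
      hyw.symm c3.1 c3.2
  omega

theorem five_le_card : 5 ≤ A.card := by
  by_contra! hlt
  have hd := h.dense.le_crossing_id
  have hcases : A.card = 0 ∨ A.card = 1 ∨ A.card = 2 ∨ A.card = 3 ∨ A.card = 4 := by omega
  rcases hcases with h0 | h0 | h0 | h0 | h0
  · refine h.not_conn fun β _ => ⟨0, by simp, ?_, ?_⟩ <;> simp [card_eq_zero.1 h0]
  · obtain ⟨a, ha⟩ := card_eq_one.1 h0
    exact h.not_conn (ha ▸ stronglyConn_singleton m a)
  · obtain ⟨x, y, hxy, hA⟩ := card_eq_two.1 h0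
    have h1 := h.le_three (x := x) (y := y) (by simp [hA]) (by simp [hA]) hxy
    rw [h0, hA] at hd
    simp [crossing, sum_pair hxy, hxy, hxy.symm, bound] at hd
    have := h.symm x y
    omega
  · obtain ⟨x, y, z, hxy, hxz, hyz, hA⟩ := card_eq_three.1 h0
    have h1 := h.triple_le (x := x) (y := y) (z := z) (by simp [hA]) (by simp [hA]) (by simp [hA])
      hxy hyz hxz
    rw [h0, hA, crossing_triple h.symm hxy hyz hxz] at hd
    simp [bound] at hd
    omega
  · obtain ⟨x, hx⟩ : A.Nonempty := card_pos.1 (by omega)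
    have h3 : (A.erase x).card = 3 := by rw [card_erase_of_mem hx]; omega
    obtain ⟨y, z, w, hyz, hyw, hzw, hA'⟩ := card_eq_three.1 h3
    have hA : A = {x, y, z, w} := by rw [← insert_erase hx, hA']
    have hxn : x ∉ ({y, z, w} : Finset V) := by rw [← hA']; simp
    simp only [mem_insert, mem_singleton, not_or] at hxn
    obtain ⟨hxy, hxz, hxw⟩ := hxn
    change x ≠ y at hxy
    change x ≠ z at hxz
    change x ≠ w at hxw
    have hcr : crossing m A id = 2 * (m x y + m x z + m x w + m y z + m y w + m z w) := by
      have e1 : x ∉ ({y, z, w} : Finset V) := by simp [hxy, hxz, hxw]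
      have e2 : y ∉ ({z, w} : Finset V) := by simp [hyz, hyw]
      have e3 : z ∉ ({w} : Finset V) := by simp [hzw]
      rw [hA]
      simp only [crossing, sum_insert e1, sum_insert e2, sum_insert e3, sum_singleton, id, hxy,
        hyz, hxz, hxw, hyw, hzw, hxy.symm, hyz.symm, hxz.symm, hxw.symm, hyw.symm, hzw.symm,
        if_false, if_true]
      rw [h.symm y x, h.symm z x, h.symm w x, h.symm z y, h.symm w y, h.symm w z]
      ring
    rw [h0, hcr] at hd
    simp [bound] at hd
    have mx : x ∈ A := hx
    have my : y ∈ A := by simp [hA]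
    have mz : z ∈ A := by simp [hA]
    have mw : w ∈ A := by simp [hA]
    have t1 := h.triple_le mx my mz hxy hyz hxz
    have t2 := h.triple_le mx my mw hxy hyw hxw
    have t3 := h.triple_le mx mz mw hxz hzw hxw
    have t4 := h.triple_le my mz mw hyz hzw hyw
    have s1 := h.symm z x
    have s2 := h.symm w x
    have s3 := h.symm w y
    have s4 := h.symm y x
    have s5 := h.symm z y
    have s6 := h.symm w z
    -- The density bound for four parts is 13 edges and each edge lies in two of the four triples.
    -- Hence some triple carries seven edges, and at least six remain at the fourth vertex.
    by_cases c1 : 7 ≤ m x y + m y z + m z x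
    · exact h.no_heavy_triple_of_card_four hA hxy hxz hxw hyz hyw hzw c1 (by omega)
    by_cases c2 : 7 ≤ m x y + m y w + m w x
    · refine h.no_heavy_triple_of_card_four (x := x) (y := y) (z := w) (w := z) ?_ hxy hxw hxz hyw
        hyz hzw.symm c2 (by omega)
      rw [hA]; ext a; simp only [mem_insert, mem_singleton]; tauto
    by_cases c3 : 7 ≤ m x z + m z w + m w x
    · refine h.no_heavy_triple_of_card_four (x := x) (y := z) (z := w) (w := y) ?_ hxz hxw hxy hzw
        hyz.symm hyw.symm c3 (by omega)
      rw [hA]; ext a; simp only [mem_insert, mem_singleton]; tauto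
    by_cases c4 : 7 ≤ m y z + m z w + m w y
    · refine h.no_heavy_triple_of_card_four (x := y) (y := z) (z := w) (w := x) ?_ hyz hyw
        hxy.symm hzw hxz.symm hxw.symm c4 (by omega)
      rw [hA]; ext a; simp only [mem_insert, mem_singleton]; tauto
    omega

end Critical

end

section

variable {V E : Type*} [Fintype V] [DecidableEq V] [Fintype E] [DecidableEq E]

/-! ### Faces of a minimal counterexample -/

/-- A minimal counterexample has no cut vertex. Otherwise one side together with `v` would inherit
density and be strongly connected by minimality. -/
theorem Critical.exists_edge_erase {m : V → V → ℕ} {A : Finset V} (h : Critical E m A) {v : V}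
    (hv : v ∈ A) {Y : Finset V} (hY : Y ⊆ A.erase v) (hne : Y.Nonempty) (hY' : Y ≠ A.erase v) :
    ∃ y ∈ Y, ∃ x ∈ A.erase v \ Y, 0 < m y x := by
  by_contra! hcon
  have hvY : v ∉ Y := fun hh => by simpa using hY hh
  have hYA : Y ⊆ A := hY.trans (erase_subset _ _)
  have hXA : insert v Y ⊆ A := insert_subset hv hYA
  have h2 : 2 ≤ (insert v Y).card := by
    rw [card_insert_of_notMem hvY]; have := hne.card_pos; omega
  have hlt : (insert v Y).card < A.card := by
    rw [card_insert_of_notMem hvY, ← card_erase_add_one hv]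
    have := card_lt_card (hY.ssubset_of_ne hY')
    omega
  refine h.not_stronglyConn hXA h2 (h.minimal m _ hlt h.symm
    (h.planar.mono hXA fun _ _ _ _ _ => id) ?_)
  intro f
  -- A partition of one side is extended by putting all other vertices into the part of `v`. This
  -- creates no parts and no crossing edges.
  set F : V → ℕ := fun u => if u ∈ insert v Y then f u else f v with hF
  have hFin : ∀ u ∈ insert v Y, F u = f u := fun u hu => if_pos hu
  have hFout : ∀ u ∉ insert v Y, F u = f v := fun u hu => if_neg hu
  have himg : A.image F = (insert v Y).image f := by
    ext a
    simp only [mem_image]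
    constructor
    · rintro ⟨u, -, rfl⟩
      by_cases hu : u ∈ insert v Y
      · exact ⟨u, hu, (hFin u hu).symm⟩
      · exact ⟨v, mem_insert_self _ _, (hFout u hu).symm⟩
    · rintro ⟨u, hu, rfl⟩
      exact ⟨u, hXA hu, hFin u hu⟩
  have hcr : crossing m A F = crossing m (insert v Y) f := by
    have hz : ∀ x ∈ A, ∀ y ∈ A, y ∉ insert v Y → (if F x = F y then 0 else m x y) = 0 := by
      intro x _ y hy hyX
      by_cases hx : x ∈ insert v Y
      · rw [hFin x hx, hFout y hyX]
        rcases mem_insert.1 hx with rfl | hxY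
        · simp
        · have : y ∈ A.erase v \ Y := by
            simp only [mem_insert, not_or] at hyX
            simp [hy, hyX]
          have := hcon x hxY y this
          split_ifs <;> omega
      · rw [hFout x hx, hFout y hyX, if_pos rfl]
    unfold crossing
    symm
    have h1 : ∀ x ∈ A, ∑ y ∈ A, (if F x = F y then 0 else m x y) =
        ∑ y ∈ insert v Y, if F x = F y then 0 else m x y := fun x hx =>
      (sum_subset hXA fun y hy hyX => hz x hx y hy hyX).symm
    rw [sum_congr rfl h1]
    refine Eq.trans (sum_congr rfl fun x hx => sum_congr rfl fun y hy => ?_)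
      (sum_subset hXA fun x hx hxX => sum_eq_zero fun y hy => ?_)
    · rw [hFin x hx, hFin y hy]
    · have := hz y (hXA hy) x hx hxX
      rw [h.symm x y]
      simpa only [eq_comm (a := F x)] using this
  rw [← himg, ← hcr]
  exact h.dense F

/-- Merging leaves zero members behind, which must not be counted as faces. -/
theorem Covers.exists_ne_zero {Z : (E → ZMod 2) → Prop} {K : ℕ} {b : Fin K → E → ZMod 2}
    (h : Covers Z b) : ∃ (k : ℕ) (b' : Fin k → E → ZMod 2), Covers Z b' ∧ ∀ i, b' i ≠ 0 := by
  classical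
  set J := univ.filter fun i => b i ≠ 0 with hJ
  have hJ0 : ∀ i ∉ J, b i = 0 := fun i hi => by simpa [hJ] using hi
  let σ : Fin J.card ≃ J := J.equivFin.symm
  have hsum : ∀ g : Fin K → (E → ZMod 2), (∀ i ∉ J, g i = 0) → ∑ j, g (σ j) = ∑ i, g i := by
    intro g hg
    rw [σ.sum_comp (fun i : J => g i), sum_coe_sort J g]
    exact sum_subset (subset_univ _) fun i _ hi => hg i hi
  refine ⟨J.card, fun j => b (σ j), ⟨fun j => h.mem _, ?_, ?_, ?_⟩, fun j => ?_⟩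
  · rw [hsum b hJ0, h.sum_eq]
  · intro z hz
    obtain ⟨c, hc⟩ := h.span z hz
    refine ⟨fun j => c (σ j), ?_⟩
    rw [hsum (fun i => c i • b i) (fun i hi => by rw [hJ0 i hi, smul_zero]), hc]
  · intro e
    refine le_trans ?_ (h.two e)
    refine card_le_card_of_injOn (fun j => (σ j : Fin K)) ?_ ?_
    · intro j hj
      simpa using hj
    · intro j _ j' _ hjj
      exact σ.injective (Subtype.ext hjj)
  · exact (mem_filter.1 (σ j).2).2

theorem sum_bdry (s t : E → V) (z : E → ZMod 2) : ∑ v, bdry s t z v = 0 := by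
  simp only [bdry_apply]
  rw [sum_comm]
  refine sum_eq_zero fun e _ => ?_
  rw [sum_add_distrib]
  simp [CharTwo.add_self_eq_zero]

/-- Extension of a vector on `S` by zero. -/
def extendZero (S : Finset E) : (S → ZMod 2) →ₗ[ZMod 2] (E → ZMod 2) where
  toFun y e := if h : e ∈ S then y ⟨e, h⟩ else 0
  map_add' y z := by ext e; by_cases h : e ∈ S <;> simp [h]
  map_smul' c z := by ext e; by_cases h : e ∈ S <;> simp [h]

theorem extendZero_apply (S : Finset E) (y : S → ZMod 2) (e : E) :
    extendZero S y e = if h : e ∈ S then y ⟨e, h⟩ else 0 := rfl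

theorem extendZero_injective (S : Finset E) : Function.Injective (extendZero S) := by
  intro y z hyz
  ext e
  have := congrFun hyz e
  simpa [extendZero_apply] using this

/-- Euler's inequality for two-covers by nonzero vectors. -/
theorem Covers.euler {s t : E → V} {S : Finset E} {k : ℕ} {b : Fin k → E → ZMod 2}
    (hb : Covers (IsCycle s t S) b) {A : Finset V} (hA : A.Nonempty)
    (hS : ∀ e ∈ S, s e ∈ A ∧ t e ∈ A) :
    S.card + 2 ≤ k + A.card ∨ (k = 0 ∧ S.card + 1 ≤ A.card) := by
  obtain ⟨a, ha⟩ := hA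
  -- The coordinate at `a` may be dropped because boundaries have sum zero. So the cycle space has
  -- dimension at least `|S| - |A| + 1`.
  let L : (S → ZMod 2) →ₗ[ZMod 2] (A.erase a → ZMod 2) :=
    (LinearMap.funLeft (ZMod 2) (ZMod 2) (fun v : A.erase a => (v : V))).comp
      ((bdry s t).comp (extendZero S))
  let T : (Fin k → ZMod 2) →ₗ[ZMod 2] (E → ZMod 2) :=
    { toFun := fun c => ∑ i, c i • b i
      map_add' := fun c d => by simp [add_smul, sum_add_distrib]
      map_smul' := fun r c => by simp [smul_sum, mul_smul] }
  have h1 := L.finrank_range_add_finrank_ker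
  have h2 := T.finrank_range_add_finrank_ker
  have h3 : Module.finrank (ZMod 2) (LinearMap.range L) ≤ A.card - 1 := by
    refine (Submodule.finrank_le _).trans ?_
    rw [Module.finrank_fintype_fun_eq_card, Fintype.card_coe, card_erase_of_mem ha]
  rw [Module.finrank_fintype_fun_eq_card, Fintype.card_coe] at h1
  rw [Module.finrank_fintype_fun_eq_card, Fintype.card_fin] at h2
  have hker : ∀ y ∈ LinearMap.ker L, IsCycle s t S (extendZero S y) := by
    intro y hy
    refine ⟨fun e he => by simp [extendZero_apply, he], ?_⟩
    have hv : ∀ v, v ≠ a → bdry s t (extendZero S y) v = 0 := by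
      intro v hva
      by_cases hvA : v ∈ A
      · exact congrFun (LinearMap.mem_ker.1 hy) ⟨v, mem_erase.2 ⟨hva, hvA⟩⟩
      · rw [bdry_apply]
        refine sum_eq_zero fun e _ => ?_
        by_cases he : e ∈ S
        · have n1 : s e ≠ v := fun hh => hvA (hh ▸ (hS e he).1)
          have n2 : t e ≠ v := fun hh => hvA (hh ▸ (hS e he).2)
          simp [n1, n2]
        · simp [extendZero_apply, he]
    ext v
    by_cases hva : v = a
    · subst hva
      have := sum_bdry s t (extendZero S y)
      rwa [sum_eq_single v (fun u _ hu => hv u hu) (by simp)] at this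
    · exact hv v hva
  have h4 : Module.finrank (ZMod 2) (LinearMap.ker L) ≤
      Module.finrank (ZMod 2) (LinearMap.range T) := by
    have hsub : (LinearMap.ker L).map (extendZero S) ≤ LinearMap.range T := by
      rintro _ ⟨y, hy, rfl⟩
      obtain ⟨c, hc⟩ := hb.span _ (hker y hy)
      exact ⟨c, hc.symm⟩
    have := Submodule.finrank_mono hsub
    rwa [← (Submodule.equivMapOfInjective _ (extendZero_injective S) _).finrank_eq] at this
  rcases Nat.eq_zero_or_pos k with hk | hk
  · right
    refine ⟨hk, ?_⟩
    have := card_pos.2 ⟨a, ha⟩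
    omega
  · left
    -- The members sum to zero, so for `k > 0` they span at most `k - 1` dimensions.
    have h5 : 0 < Module.finrank (ZMod 2) (LinearMap.ker T) := by
      rw [Module.finrank_pos_iff_exists_ne_zero]
      refine ⟨⟨fun _ => 1, ?_⟩, ?_⟩
      · rw [LinearMap.mem_ker]
        simpa [T] using hb.sum_eq
      · intro h0
        have := congrFun (congrArg Subtype.val h0) ⟨0, hk⟩
        simp at this
    have := card_pos.2 ⟨a, ha⟩
    omega

open Classical in
/-- The faces of a planar simple graph, as adjacency relations. -/
structure Faces (m : V → V → ℕ) (A : Finset V) {k : ℕ} (N : Fin k → V → V → Prop) : Prop where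
  symm : ∀ i x y, N i x y → N i y x
  adj : ∀ i x y, N i x y → x ∈ A ∧ y ∈ A ∧ x ≠ y ∧ 0 < m x y
  even : ∀ i x, Even (univ.filter fun y => N i x y).card
  cover : ∀ i x y, N i x y → (univ.filter fun j => N j x y).card = 2
  nonempty : ∀ i, ∃ x y, N i x y
  euler : ((A ×ˢ A).filter fun p => p.1 ≠ p.2 ∧ 0 < m p.1 p.2).card + 4 ≤ 2 * k + 2 * A.card
  closed : ∀ C : Finset (Fin k), (∀ x y, Even (C.filter fun i => N i x y).card) → ∀ i ∈ C,
    ∀ x y y', N i x y → x ∈ A → y' ∈ A → x ≠ y' → 0 < m x y' → ∃ j ∈ C, N j x y'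

theorem sum_zmod_two {ι : Type*} (C : Finset ι) (f : ι → ZMod 2) :
    ∑ i ∈ C, f i = ((C.filter fun i => f i ≠ 0).card : ZMod 2) := by
  rw [card_filter, Nat.cast_sum]
  refine sum_congr rfl fun i _ => ?_
  by_cases h : f i = 0
  · simp [h]
  · simp [zmod_two_eq_one h]

theorem joins_iff {s t : E → V} {e : E} {x y : V} : Joins s t e x y ↔ s(s e, t e) = s(x, y) := by
  rw [Sym2.eq_iff]; rfl

theorem Critical.exists_faces {m : V → V → ℕ} {A : Finset V} (h : Critical E m A) :
    ∃ (k : ℕ) (N : Fin k → V → V → Prop), Faces m A N := by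
  classical
  obtain ⟨s, t, S, hS, hj⟩ := h.planar
  let P : V → V → Prop := fun x y => x ∈ A ∧ y ∈ A ∧ x ≠ y ∧ 0 < m x y
  have hP : ∀ {x y}, P x y → P y x := fun ⟨a, b, c, d⟩ => ⟨b, a, c.symm, by rw [h.symm]; exact d⟩
  -- One representative is chosen for each pair of ends, so that `S₀` is a simple graph and
  -- multiplicities are recorded only by `m`.
  let rep : Sym2 V → Option E := fun p =>
    if hp : ∃ e ∈ S, s(s e, t e) = p then some hp.choose else none
  set S₀ := S.filter fun e => P (s e) (t e) ∧ rep s(s e, t e) = some e with hS₀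
  have hex : ∀ x y, P x y → ∃ e ∈ S₀, Joins s t e x y := by
    rintro x y hxy
    have hp : ∃ e ∈ S, s(s e, t e) = s(x, y) := by
      obtain ⟨e, he, hej⟩ := hj x hxy.1 y hxy.2.1 hxy.2.2.1 hxy.2.2.2
      exact ⟨e, he, joins_iff.1 hej⟩
    obtain ⟨h1, h2⟩ := hp.choose_spec
    refine ⟨hp.choose, mem_filter.2 ⟨h1, ?_, ?_⟩, joins_iff.2 h2⟩
    · rcases joins_iff.2 h2 with ⟨h3, h4⟩ | ⟨h3, h4⟩
      · rw [h3, h4]; exact hxy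
      · rw [h3, h4]; exact hP hxy
    · rw [h2]
      simp only [rep, dif_pos hp]
  have huniq : ∀ x y, ∀ e ∈ S₀, ∀ e' ∈ S₀, Joins s t e x y → Joins s t e' x y → e = e' := by
    intro x y e he e' he' hej hej'
    have h1 := (mem_filter.1 he).2.2
    have h2 := (mem_filter.1 he').2.2
    rw [joins_iff.1 hej] at h1
    rw [joins_iff.1 hej'] at h2
    exact Option.some_injective _ (h1.symm.trans h2)
  have hPS : ∀ e ∈ S₀, P (s e) (t e) := fun e he => (mem_filter.1 he).2.1
  have hPj : ∀ e ∈ S₀, ∀ x y, Joins s t e x y → P x y := by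
    rintro e he x y (⟨rfl, rfl⟩ | ⟨rfl, rfl⟩)
    · exact hPS e he
    · exact hP (hPS e he)
  have hloop : ∀ e ∈ S₀, s e ≠ t e := fun e he => (hPS e he).2.2.1
  obtain ⟨K, b₀, hb₀⟩ : PlanarEdges s t S₀ := hS.mono (filter_subset _ _)
  obtain ⟨k, b, hb, hb0⟩ := hb₀.exists_ne_zero
  have hbS : ∀ i e, b i e ≠ 0 → e ∈ S₀ := by
    intro i e hie
    by_contra he; exact hie ((hb.mem i).1 e he)
  set N : Fin k → V → V → Prop := fun i x y => ∃ e ∈ S₀, Joins s t e x y ∧ b i e ≠ 0 with hN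
  have hNe : ∀ e ∈ S₀, ∀ x y, Joins s t e x y → ∀ i, N i x y ↔ b i e ≠ 0 := by
    intro e he x y hej i
    constructor
    · rintro ⟨e', he', hej', h0⟩
      rwa [huniq x y e he e' he' hej hej']
    · intro h0
      exact ⟨e, he, hej, h0⟩
  have hdarts : ((A ×ˢ A).filter fun p => p.1 ≠ p.2 ∧ 0 < m p.1 p.2).card ≤ 2 * S₀.card := by
    rcases isEmpty_or_nonempty E with hE | ⟨⟨e₀⟩⟩
    · rw [card_eq_zero.2]
      · exact Nat.zero_le _
      · rw [filter_eq_empty_iff]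
        rintro p hp ⟨h1, h2⟩
        rw [mem_product] at hp
        obtain ⟨e, -⟩ := hex p.1 p.2 ⟨hp.1, hp.2, h1, h2⟩
        exact hE.elim e
    have hch : ∀ p : V × V, ∃ e : E, p ∈ ((A ×ˢ A).filter fun p => p.1 ≠ p.2 ∧ 0 < m p.1 p.2) →
        e ∈ S₀ ∧ Joins s t e p.1 p.2 := by
      intro p
      by_cases hp : p ∈ ((A ×ˢ A).filter fun p => p.1 ≠ p.2 ∧ 0 < m p.1 p.2)
      · have hp' := hp
        simp only [mem_filter, mem_product] at hp'
        obtain ⟨e, he, hej⟩ := hex p.1 p.2 ⟨hp'.1.1, hp'.1.2, hp'.2.1, hp'.2.2⟩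
        exact ⟨e, fun _ => ⟨he, hej⟩⟩
      · exact ⟨e₀, fun h => absurd h hp⟩
    choose φ hφ using hch
    have : 2 * S₀.card = (S₀ ×ˢ (univ : Finset Bool)).card := by
      rw [card_product]; simp [mul_comm]
    rw [this]
    -- An ordered adjacent pair is recovered from its edge and the direction of traversal.
    refine card_le_card_of_injOn (fun p => (φ p, decide (s (φ p) = p.1))) ?_ ?_
    · intro p hp
      have := hφ p hp
      exact mem_coe.2 (mem_product.2 ⟨this.1, mem_univ _⟩)
    · intro p hp p' hp' hpp
      simp only [Prod.mk.injEq, decide_eq_decide] at hpp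
      obtain ⟨h1, h2⟩ := hpp
      have j1 := (hφ p hp).2
      have j2 := (hφ p' hp').2
      rw [← h1] at j2 h2
      have hne := hloop _ (hφ p hp).1
      rcases j1 with ⟨a1, a2⟩ | ⟨a1, a2⟩ <;> rcases j2 with ⟨b1, b2⟩ | ⟨b1, b2⟩
      · exact Prod.ext (a1.symm.trans b1) (a2.symm.trans b2)
      · exact absurd ((h2.1 a1).trans b2.symm) hne
      · exact absurd ((h2.2 b1).trans a2.symm) hne
      · exact Prod.ext (a2.symm.trans b2) (a1.symm.trans b1)
  have h5 := h.five_le_card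
  refine ⟨k, N, ?_, ?_, ?_, ?_, ?_, ?_, ?_⟩
  · rintro i x y ⟨e, he, hej, h0⟩
    exact ⟨e, he, hej.symm, h0⟩
  · rintro i x y ⟨e, he, hej, h0⟩
    exact hPj e he x y hej
  · intro i x
    have h1 := congrFun (hb.mem i).2 x
    rw [bdry_apply_of_loopless (fun e he => by
      rintro ⟨a, b⟩; exact hloop e (hbS i e he) (a.trans b.symm)), sum_zmod_two, Pi.zero_apply,
      ZMod.natCast_eq_zero_iff_even] at h1
    convert h1 using 1
    symm
    refine card_bij (fun e _ => if s e = x then t e else s e) ?_ ?_ ?_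
    · intro e he
      simp only [mem_filter, mem_univ, true_and] at he ⊢
      refine ⟨e, hbS i e he.2, ?_, he.2⟩
      split_ifs with hs
      · exact Or.inl ⟨hs, rfl⟩
      · exact Or.inr ⟨rfl, he.1.resolve_left hs⟩
    · intro e he e' he' hee
      simp only [mem_filter, mem_univ, true_and] at he he'
      have j : ∀ e, (s e = x ∨ t e = x) → Joins s t e x (if s e = x then t e else s e) := by
        intro e he
        split_ifs with hs
        · exact Or.inl ⟨hs, rfl⟩
        · exact Or.inr ⟨rfl, he.resolve_left hs⟩
      refine huniq x _ e (hbS i e he.2) e' (hbS i e' he'.2) (j e he.1) ?_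
      rw [hee]; exact j e' he'.1
    · intro y hy
      simp only [mem_filter, mem_univ, true_and] at hy
      obtain ⟨e, he, hej, h0⟩ := hy
      refine ⟨e, ?_, ?_⟩
      · simp only [mem_filter, mem_univ, true_and]
        refine ⟨?_, h0⟩
        rcases hej with ⟨a, -⟩ | ⟨-, a⟩
        · exact Or.inl a
        · exact Or.inr a
      · rcases hej with ⟨a, b⟩ | ⟨a, b⟩
        · rw [if_pos a, b]
        · rw [if_neg, a]
          intro hsx
          exact hloop e he (hsx.trans b.symm)
  · rintro i x y ⟨e, he, hej, h0⟩
    suffices h1 : (univ.filter fun j => b j e ≠ 0).card = 2 by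
      convert h1 using 2
      ext j; simp only [mem_filter, mem_univ, true_and]; exact hNe e he x y hej j
    have h2 := hb.two e
    have h3 : Even (univ.filter fun j => b j e ≠ 0).card := by
      rw [← ZMod.natCast_eq_zero_iff_even, ← sum_zmod_two, ← Finset.sum_apply, hb.sum_eq]; rfl
    have h4 : 0 < (univ.filter fun j => b j e ≠ 0).card := card_pos.2 ⟨i, by simpa using h0⟩
    obtain ⟨a, ha⟩ := h3
    omega
  · intro i
    by_contra! hcon
    refine hb0 i ?_
    ext e
    by_contra h0
    have he := hbS i e h0
    exact hcon (s e) (t e) ⟨e, he, Or.inl ⟨rfl, rfl⟩, h0⟩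
  · have he := hb.euler (A := A) (card_pos.1 (by omega)) fun e he => ⟨(hPS e he).1, (hPS e he).2.1⟩
    rcases he with he | ⟨-, he⟩
    · omega
    -- Without faces there would be at most `|A| - 1` adjacent pairs of multiplicity at most three.
    -- That is too few for the density of at least five vertices.
    · exfalso
      have h6 := h.dense.le_crossing_id
      have h7 : crossing m A id ≤ 3 * ((A ×ˢ A).filter fun p => p.1 ≠ p.2 ∧ 0 < m p.1 p.2).card := by
        rw [crossing, ← sum_product', mul_comm, card_filter, sum_mul]
        refine sum_le_sum fun p hp => ?_
        rw [mem_product] at hp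
        by_cases hpe : p.1 = p.2
        · simp [hpe]
        · have := h.le_three hp.1 hp.2 hpe
          simp only [id, hpe, if_false]
          by_cases h0 : 0 < m p.1 p.2
          · simp [hpe, h0]; omega
          · omega
      have h8 : 2 * bound A.card + 19 ≥ 11 * A.card := by
        unfold bound; split_ifs <;> omega
      omega
  · intro C hC i hi x y y' hxy hx hy' hne h0
    obtain ⟨e, he, hej, hie⟩ := hxy
    obtain ⟨e', he', hej'⟩ := hex x y' ⟨hx, hy', hne, h0⟩
    have hsum : ∑ i ∈ C, b i = 0 := by
      ext f
      rw [Finset.sum_apply, sum_zmod_two, Pi.zero_apply, ZMod.natCast_eq_zero_iff_even]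
      by_cases hf : f ∈ S₀
      · convert hC (s f) (t f) using 2
        ext i
        simp only [mem_filter]
        rw [hNe f hf (s f) (t f) (Or.inl ⟨rfl, rfl⟩)]
      · rw [filter_eq_empty_iff.2]
        · simp
        · intro i _; simpa using (hb.mem i).1 f hf
    have hconn : ConnectedOn s t S₀ (A.erase x) := by
      intro Y hY hYn hYne
      obtain ⟨u, hu, w, hw, huw⟩ := h.exists_edge_erase hx hY hYn hYne
      have hwX := (mem_sdiff.1 hw).1
      obtain ⟨f, hf, hfj⟩ := hex u w ⟨mem_of_mem_erase (hY hu), mem_of_mem_erase hwX,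
        fun hh => (mem_sdiff.1 hw).2 (hh ▸ hu), huw⟩
      exact ⟨f, hf, u, hu, w, hw, hfj⟩
    have hPxy := hPj e he x y hej
    obtain ⟨j, hj, hje⟩ := hb.covered_of_sum_eq_zero hloop (by simp : x ∉ A.erase x) hconn
      (mem_erase.2 ⟨hPxy.2.2.1.symm, hPxy.2.1⟩) (mem_erase.2 ⟨hne.symm, hy'⟩) he he' hej hej'
      hsum hi hie
    exact ⟨j, hj, e', he', hej', hje⟩

end

section

variable {V E : Type*} [Fintype V] [DecidableEq V] [Fintype E] [DecidableEq E]

/-! ### Short even graphs -/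

open Classical in
/-- The ordered adjacent pairs of a relation. -/
noncomputable def darts (R : V → V → Prop) : Finset (V × V) := univ.filter fun p => R p.1 p.2

theorem mem_darts {R : V → V → Prop} {p : V × V} : p ∈ darts R ↔ R p.1 p.2 := by
  simp [darts]

/-- `R` is the adjacency relation of the cycle through the vertices `x 0, x 1, …`. -/
structure IsCyclic {n : ℕ} (R : V → V → Prop) (x : Fin (n + 3) → V) : Prop where
  inj : Function.Injective x
  adj : ∀ u v, R u v ↔ ∃ j, (u = x j ∧ v = x (j + 1)) ∨ (u = x (j + 1) ∧ v = x j)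

theorem fin_add_one_add_one_ne {n : ℕ} (i : Fin (n + 3)) : i + 1 + 1 ≠ i := by
  intro h
  rw [add_assoc, add_eq_left] at h
  have := congrArg Fin.val h
  rw [Fin.val_add] at this
  simp only [Fin.val_one, Nat.reduceAdd, Fin.val_zero] at this
  rw [Nat.mod_eq_of_lt (by omega)] at this
  omega

theorem IsCyclic.sum_darts {n : ℕ} {R : V → V → Prop} {x : Fin (n + 3) → V} (h : IsCyclic R x)
    (f : V × V → ℕ) :
    ∑ p ∈ darts R, f p = ∑ j, (f (x j, x (j + 1)) + f (x (j + 1), x j)) := by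
  have h1 : darts R = univ.image (fun j => (x j, x (j + 1))) ∪
      univ.image (fun j => (x (j + 1), x j)) := by
    ext ⟨u, v⟩
    simp only [mem_darts, h.adj, mem_union, mem_image, mem_univ, true_and, Prod.mk.injEq]
    constructor
    · rintro ⟨j, ⟨rfl, rfl⟩ | ⟨rfl, rfl⟩⟩
      · exact Or.inl ⟨j, rfl, rfl⟩
      · exact Or.inr ⟨j, rfl, rfl⟩
    · rintro (⟨j, rfl, rfl⟩ | ⟨j, rfl, rfl⟩)
      · exact ⟨j, Or.inl ⟨rfl, rfl⟩⟩
      · exact ⟨j, Or.inr ⟨rfl, rfl⟩⟩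
  rw [h1, sum_union, sum_image, sum_image, sum_add_distrib]
  · intro i _ j _ hij
    exact h.inj (Prod.mk.inj hij).2
  · intro i _ j _ hij
    exact h.inj (Prod.mk.inj hij).1
  · rw [disjoint_left]
    intro p hp hp'
    obtain ⟨i, -, rfl⟩ := mem_image.1 hp
    obtain ⟨j, -, hij⟩ := mem_image.1 hp'
    obtain ⟨h2, h3⟩ := Prod.mk.inj hij
    have h2 := h.inj h2
    have h3 := h.inj h3
    exact fin_add_one_add_one_ne j (by rw [h2, h3])

theorem IsCyclic.exists_start {n : ℕ} {R : V → V → Prop} {x : Fin (n + 3) → V} (h : IsCyclic R x)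
    {u v : V} (huv : R u v) :
    ∃ x' : Fin (n + 3) → V, IsCyclic R x' ∧ x' 0 = u ∧ x' 1 = v := by
  obtain ⟨j, ⟨rfl, rfl⟩ | ⟨rfl, rfl⟩⟩ := (h.adj u v).1 huv
  · refine ⟨fun i => x (i + j), ⟨fun a b hab => add_right_cancel (h.inj hab), fun u v => ?_⟩,
      by simp, by simp [add_comm]⟩
    rw [h.adj, (Equiv.addRight j).symm.exists_congr_left]
    simp [add_right_comm]
  · refine ⟨fun i => x (j + 1 - i), ⟨fun a b hab => sub_right_injective (h.inj hab), fun u v => ?_⟩,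
      by simp, by simp⟩
    rw [h.adj, (Equiv.subLeft j).symm.exists_congr_left]
    refine exists_congr fun i => ?_
    simp only [Equiv.symm_symm, Equiv.subLeft_apply]
    rw [show j + 1 - (i + 1) = j - i by abel, show j + 1 - i = j - i + 1 by abel]
    exact or_comm

theorem isCyclic_three {R : V → V → Prop} {a b c : V} (h : [a, b, c].Nodup)
    (hR : ∀ u v, R u v ↔ (u = a ∧ v = b ∨ u = b ∧ v = a) ∨ (u = b ∧ v = c ∨ u = c ∧ v = b) ∨
      (u = c ∧ v = a ∨ u = a ∧ v = c)) : IsCyclic (n := 0) R ![a, b, c] := by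
  refine ⟨?_, fun u v => ?_⟩
  · intro i j hij
    simp only [List.nodup_cons, List.mem_cons, List.not_mem_nil, not_or, or_false] at h
    fin_cases i <;> fin_cases j <;> simp_all
  · rw [hR]
    simp [Fin.exists_fin_succ]

theorem isCyclic_four {R : V → V → Prop} {a b c d : V} (h : [a, b, c, d].Nodup)
    (hR : ∀ u v, R u v ↔ (u = a ∧ v = b ∨ u = b ∧ v = a) ∨ (u = b ∧ v = c ∨ u = c ∧ v = b) ∨
      (u = c ∧ v = d ∨ u = d ∧ v = c) ∨ (u = d ∧ v = a ∨ u = a ∧ v = d)) :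
    IsCyclic (n := 1) R ![a, b, c, d] := by
  refine ⟨?_, fun u v => ?_⟩
  · intro i j hij
    simp only [List.nodup_cons, List.mem_cons, List.not_mem_nil, not_or, or_false] at h
    fin_cases i <;> fin_cases j <;> simp_all
  · rw [hR]
    simp [Fin.exists_fin_succ]

theorem isCyclic_five {R : V → V → Prop} {a b c d e : V} (h : [a, b, c, d, e].Nodup)
    (hR : ∀ u v, R u v ↔ (u = a ∧ v = b ∨ u = b ∧ v = a) ∨ (u = b ∧ v = c ∨ u = c ∧ v = b) ∨
      (u = c ∧ v = d ∨ u = d ∧ v = c) ∨ (u = d ∧ v = e ∨ u = e ∧ v = d) ∨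
      (u = e ∧ v = a ∨ u = a ∧ v = e)) :
    IsCyclic (n := 2) R ![a, b, c, d, e] := by
  refine ⟨?_, fun u v => ?_⟩
  · intro i j hij
    simp only [List.nodup_cons, List.mem_cons, List.not_mem_nil, not_or, or_false] at h
    fin_cases i <;> fin_cases j <;> simp_all
  · rw [hR]
    simp [Fin.exists_fin_succ]

theorem card_darts_eq_sum (R : V → V → Prop)
    [DecidableRel R] : (darts R).card = ∑ v, (univ.filter fun y => R v y).card := by
  have : darts R = univ.filter fun p : V × V => R p.1 p.2 := by ext p; simp [mem_darts]
  rw [this, card_filter, ← univ_product_univ, sum_product]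
  exact sum_congr rfl fun v _ => (card_filter _ _).symm

theorem IsCyclic.card_darts {n : ℕ} {R : V → V → Prop} {x : Fin (n + 3) → V} (h : IsCyclic R x) :
    (darts R).card = 2 * (n + 3) := by
  rw [card_eq_sum_ones, h.sum_darts]
  simp [mul_comm]

open Classical in
/-- A nonempty simple graph with even degrees and at most five edges is a cycle. -/
theorem exists_isCyclic {R : V → V → Prop} (hsymm : ∀ x y, R x y → R y x) (hirr : ∀ x, ¬ R x x)
    (heven : ∀ x, Even (univ.filter fun y => R x y).card) (hne : ∃ x y, R x y)
    (hL : (darts R).card < 12) :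
    (∃ x, IsCyclic (n := 0) R x) ∨ (∃ x, IsCyclic (n := 1) R x) ∨ ∃ x, IsCyclic (n := 2) R x := by
  set deg : V → ℕ := fun v => (univ.filter fun y => R v y).card with hdeg
  have hsum : ∑ v, deg v < 12 := by
    rwa [card_darts_eq_sum] at hL
  have htwo : ∀ x y, R x y → 2 ≤ deg x := by
    intro x y hxy
    have h1 : 0 < deg x := card_pos.2 ⟨y, by simpa using hxy⟩
    obtain ⟨k, hk⟩ := heven x
    change deg x = k + k at hk
    omega
  -- Every non-isolated vertex has degree at least 2 and the total degree is below 12.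
  have hfew : ∀ l : List V, l.Nodup → (∀ w ∈ l, ∃ y, R w y) → l.length ≤ 5 := by
    intro l hl hW
    have h1 : l.toFinset.card * 2 ≤ ∑ v ∈ l.toFinset, deg v := by
      rw [← smul_eq_mul]
      exact card_nsmul_le_sum _ _ _ fun w hw =>
        (hW w (List.mem_toFinset.1 hw)).elim fun y hy => htwo w y hy
    have h2 : ∑ v ∈ l.toFinset, deg v ≤ ∑ v, deg v := sum_le_sum_of_subset (subset_univ _)
    rw [List.toFinset_card_of_nodup hl] at h1
    omega
  -- A vertex of degree four and its neighbours alone would give total degree `4 + 4 * 2 = 12`.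
  have hfour : ∀ v, deg v < 4 := by
    intro v
    by_contra! hv
    have hvn : v ∉ univ.filter fun y => R v y := by simp [hirr]
    have h1 : deg v + (univ.filter fun y => R v y).card * 2 ≤ ∑ u, deg u := by
      refine le_trans ?_ (sum_le_sum_of_subset (subset_univ (insert v (univ.filter fun y => R v y))))
      rw [sum_insert hvn, ← smul_eq_mul]
      gcongr
      refine card_nsmul_le_sum _ _ _ fun w hw => ?_
      exact htwo w v (hsymm _ _ (by simpa using hw))
    change deg v + deg v * 2 ≤ _ at h1
    omega
  have hnb : ∀ u v, R u v → ∃ c, c ≠ v ∧ ∀ y, R u y ↔ y = v ∨ y = c := by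
    intro u v huv
    have h2 : deg u = 2 := by
      have h1 := htwo u v huv
      have h3 := hfour u
      obtain ⟨k, hk⟩ := heven u
      change deg u = k + k at hk
      omega
    obtain ⟨a, b, hab, h3⟩ := card_eq_two.1 h2
    have h4 : ∀ y, R u y ↔ y = a ∨ y = b := fun y => by
      have := Finset.ext_iff.1 h3 y
      simpa using this
    rcases (h4 v).1 huv with rfl | rfl
    · exact ⟨b, hab.symm, h4⟩
    · exact ⟨a, hab, fun y => (h4 y).trans or_comm⟩
  obtain ⟨v, a, hva⟩ := hne
  obtain ⟨b, hba, hv⟩ := hnb v a hva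
  obtain ⟨c, hcv, ha⟩ := hnb a v (hsymm _ _ hva)
  have hvb : R v b := (hv b).2 (Or.inr rfl)
  obtain ⟨d, hdv, hb⟩ := hnb b v (hsymm _ _ hvb)
  have hac : R a c := (ha c).2 (Or.inr rfl)
  have hbd : R b d := (hb d).2 (Or.inr rfl)
  have hne : ∀ {x y}, R x y → x ≠ y := fun hxy hh => hirr _ (hh ▸ hxy)
  have hva' := hne hva
  have hvb' := hne hvb
  have hac' := hne hac
  have hbd' := hne hbd
  by_cases hcb : c = b
  · left
    have hda : d = a := by
      have := (hb a).1 (hsymm _ _ (hcb ▸ hac))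
      grind
    subst hcb hda
    refine ⟨_, isCyclic_three (a := v) (b := d) (c := c) (by simp; grind) fun u w => ?_⟩
    by_cases hu : u = v ∨ u = d ∨ u = c
    · grind
    · have : ¬ R u w := by
        intro huw
        obtain ⟨w', hw', hu'⟩ := hnb u w huw
        have huw' := (hu' w').2 (Or.inr rfl)
        have e1 := hsymm _ _ huw
        have e2 := hsymm _ _ huw'
        have n1 := hne huw
        have n2 := hne huw'
        have := hfew [v, d, c, u, w, w'] (by clear hnb hfew; simp; grind) (by
          simp only [List.forall_mem_cons]
          exact ⟨⟨_, hva⟩, ⟨_, hac⟩, ⟨_, hbd⟩, ⟨_, huw⟩, ⟨_, e1⟩, ⟨_, e2⟩, by simp⟩)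
        simp at this
      grind
  · right
    by_cases hcd : d = c
    · left
      subst hcd
      obtain ⟨f, hfa, hd⟩ := hnb d a (hsymm _ _ hac)
      have hfb : f = b := by
        have := (hd b).1 (hsymm _ _ hbd)
        grind
      subst hfb
      refine ⟨_, isCyclic_four (a := v) (b := a) (c := d) (d := f) (by simp; grind) fun u w => ?_⟩
      by_cases hu : u = v ∨ u = a ∨ u = d ∨ u = f
      · grind
      · have : ¬ R u w := by
          intro huw
          have e1 := hsymm _ _ huw
          have n1 := hne huw
          have := hfew [v, a, d, f, u, w] (by clear hnb hfew; simp; grind) (by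
            simp only [List.forall_mem_cons]
            exact ⟨⟨_, hva⟩, ⟨_, hac⟩, ⟨_, (hd a).2 (Or.inl rfl)⟩, ⟨_, hbd⟩, ⟨_, huw⟩, ⟨_, e1⟩,
              by simp⟩)
          simp at this
        grind
    · right
      have hda : d ≠ a := by
        rintro rfl
        have := (ha b).1 (hsymm _ _ hbd)
        grind
      have hW : ∀ u y, R u y → u = v ∨ u = a ∨ u = c ∨ u = d ∨ u = b := by
        intro u y huy
        by_contra hu
        have := hfew [u, v, a, c, d, b] (by clear hnb hfew; simp; grind) (by
          simp only [List.forall_mem_cons]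
          exact ⟨⟨_, huy⟩, ⟨_, hva⟩, ⟨_, hac⟩, ⟨_, hsymm _ _ hac⟩, ⟨_, hsymm _ _ hbd⟩, ⟨_, hbd⟩,
            by simp⟩)
        simp at this
      obtain ⟨f, hfa, hc⟩ := hnb c a (hsymm _ _ hac)
      have hcf : R c f := (hc f).2 (Or.inr rfl)
      have hfd : f = d := by
        have h1 := hW f c (hsymm _ _ hcf)
        have h2 := hsymm _ _ hcf
        have h3 := hne hcf
        grind
      subst hfd
      obtain ⟨g, hgb, hd⟩ := hnb f b (hsymm _ _ hbd)
      have hgc : g = c := by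
        have := (hd c).1 (hsymm _ _ hcf)
        grind
      subst hgc
      refine ⟨_, isCyclic_five (a := v) (b := a) (c := g) (d := f) (e := b) (by simp; grind)
        fun u w => ?_⟩
      by_cases hu : u = v ∨ u = a ∨ u = g ∨ u = f ∨ u = b
      · grind
      · have : ¬ R u w := fun huw => hu (hW u w huw)
        grind

end

section

variable {V E : Type*} [Fintype V] [DecidableEq V] [Fintype E] [DecidableEq E]

/-! ### Discharging -/

/-- `R` is the adjacency relation of the triangle `x y z`. -/
structure IsTriangle (R : V → V → Prop) (x y z : V) : Prop where
  ne₁ : x ≠ y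
  ne₂ : y ≠ z
  ne₃ : x ≠ z
  adj : ∀ u v, R u v ↔ (u = x ∧ v = y ∨ u = y ∧ v = x) ∨ (u = y ∧ v = z ∨ u = z ∧ v = y) ∨
    (u = z ∧ v = x ∨ u = x ∧ v = z)

theorem IsTriangle.rotate {R : V → V → Prop} {x y z : V} (h : IsTriangle R x y z) :
    IsTriangle R y z x :=
  ⟨h.ne₂, h.ne₃.symm, h.ne₁.symm, fun u v => (h.adj u v).trans ⟨by tauto, by tauto⟩⟩

/-- `R` is the adjacency relation of the four-cycle `x y z w`. -/
structure IsQuad (R : V → V → Prop) (x y z w : V) : Prop where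
  ne₁ : x ≠ y
  ne₂ : x ≠ z
  ne₃ : x ≠ w
  ne₄ : y ≠ z
  ne₅ : y ≠ w
  ne₆ : z ≠ w
  adj : ∀ u v, R u v ↔ (u = x ∧ v = y ∨ u = y ∧ v = x) ∨ (u = y ∧ v = z ∨ u = z ∧ v = y) ∨
    (u = z ∧ v = w ∨ u = w ∧ v = z) ∨ (u = w ∧ v = x ∨ u = x ∧ v = w)

theorem IsQuad.rotate {R : V → V → Prop} {x y z w : V} (h : IsQuad R x y z w) :
    IsQuad R y z w x :=
  ⟨h.ne₄, h.ne₅, h.ne₁.symm, h.ne₆, h.ne₂.symm, h.ne₃.symm,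
    fun u v => (h.adj u v).trans ⟨by tauto, by tauto⟩⟩

theorem IsQuad.reflect {R : V → V → Prop} {x y z w : V} (h : IsQuad R x y z w) :
    IsQuad R y x w z := by
  refine ⟨h.ne₁.symm, h.ne₅, h.ne₄, h.ne₃, h.ne₂, h.ne₆.symm, fun u v => (h.adj u v).trans ⟨?_, ?_⟩⟩
  all_goals
    rintro ((h | h) | (h | h) | (h | h) | (h | h)) <;> simp [h]

theorem IsCyclic.exists_isTriangle {R : V → V → Prop} {t : Fin 3 → V} (h : IsCyclic (n := 0) R t)
    {x y : V} (hxy : R x y) : ∃ z, IsTriangle R x y z := by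
  obtain ⟨t', h', rfl, rfl⟩ := h.exists_start hxy
  refine ⟨t' 2, h'.inj.ne (by decide), h'.inj.ne (by decide), h'.inj.ne (by decide), fun u v => ?_⟩
  rw [h'.adj]
  simp [Fin.exists_fin_succ]

theorem IsCyclic.exists_isQuad {R : V → V → Prop} {t : Fin 4 → V} (h : IsCyclic (n := 1) R t)
    {x y : V} (hxy : R x y) : ∃ z w, IsQuad R x y z w := by
  obtain ⟨t', h', rfl, rfl⟩ := h.exists_start hxy
  refine ⟨t' 2, t' 3, h'.inj.ne (by decide), h'.inj.ne (by decide), h'.inj.ne (by decide),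
    h'.inj.ne (by decide), h'.inj.ne (by decide), h'.inj.ne (by decide), fun u v => ?_⟩
  rw [h'.adj]
  simp [Fin.exists_fin_succ]

theorem IsTriangle.sum_darts {R : V → V → Prop} {x y z : V} (h : IsTriangle R x y z)
    {m : V → V → ℕ} (hm : ∀ u w, m u w = m w u) :
    ∑ p ∈ darts R, m p.1 p.2 = 2 * (m x y + m y z + m z x) := by
  have := isCyclic_three (R := R) (a := x) (b := y) (c := z)
    (by have := h.ne₁; have := h.ne₂; have := h.ne₃; simp; grind) h.adj
  rw [this.sum_darts fun p => m p.1 p.2, Fin.sum_univ_three]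
  simp
  rw [hm y x, hm z y, hm x z]
  ring

theorem IsQuad.sum_darts {R : V → V → Prop} {x y z w : V} (h : IsQuad R x y z w)
    {m : V → V → ℕ} (hm : ∀ u w, m u w = m w u) :
    ∑ p ∈ darts R, m p.1 p.2 = 2 * (m x y + m y z + m z w + m w x) := by
  have := isCyclic_four (R := R) (a := x) (b := y) (c := z) (d := w)
    (by
      have := h.ne₁; have := h.ne₂; have := h.ne₃; have := h.ne₄; have := h.ne₅; have := h.ne₆
      simp; grind) h.adj
  rw [this.sum_darts fun p => m p.1 p.2, Fin.sum_univ_four]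
  simp
  rw [hm y x, hm z y, hm w z, hm x w]
  ring

namespace Faces

variable {m : V → V → ℕ} {A : Finset V} {k : ℕ} {N : Fin k → V → V → Prop} (F : Faces m A N)

include F

theorem eq_of_ne {i j l : Fin k} {x y : V} (hi : N i x y) (hj : N j x y) (hl : N l x y)
    (hji : j ≠ i) (hli : l ≠ i) : j = l := by
  classical
  by_contra hjl
  have h1 := F.cover i x y hi
  have h2 : ({i, j, l} : Finset (Fin k)).card = 3 :=
    card_eq_three.2 ⟨i, j, l, hji.symm, hli.symm, hjl, rfl⟩
  have h3 : ({i, j, l} : Finset (Fin k)).card ≤ (univ.filter fun j => N j x y).card := by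
    refine card_le_card fun a ha => ?_
    simp only [mem_insert, mem_singleton] at ha
    rcases ha with rfl | rfl | rfl <;> simpa
  rw [h2] at h3
  have h4 : (univ.filter fun j => N j x y).card = 2 := by convert h1
  omega

theorem exists_ne {i : Fin k} {x y : V} (hi : N i x y) : ∃ j, j ≠ i ∧ N j x y := by
  classical
  have h1 := F.cover i x y hi
  obtain ⟨j, hj, hji⟩ := exists_mem_ne (s := univ.filter fun j => N j x y)
    (by have h4 : (univ.filter fun j => N j x y).card = 2 := by convert h1
        omega) i
  exact ⟨j, hji, by simpa using hj⟩

omit F in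
theorem _root_.PlanarFlow.Dense.exists_edge {m : V → V → ℕ} {A : Finset V} (hd : Dense m A)
    {Y : Finset V} (hY : Y ⊆ A) (hne : Y.Nonempty) (hYA : Y ≠ A) (hsym : ∀ u w, m u w = m w u) :
    ∃ y ∈ Y, ∃ x ∈ A \ Y, 0 < m y x := by
  by_contra! hcon
  have h1 := hd fun v => if v ∈ Y then 0 else 1
  have h2 : (A.image fun v => if v ∈ Y then 0 else 1) = {0, 1} := by
    obtain ⟨y, hy⟩ := hne
    obtain ⟨x, hx, hxY⟩ := exists_of_ssubset (hY.ssubset_of_ne hYA)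
    ext a
    simp only [mem_image, mem_insert, mem_singleton]
    constructor
    · rintro ⟨u, -, rfl⟩
      split_ifs <;> simp
    · rintro (rfl | rfl)
      · exact ⟨y, hY hy, if_pos hy⟩
      · exact ⟨x, hx, if_neg hxY⟩
  rw [h2] at h1
  have h3 : crossing m A (fun v => if v ∈ Y then 0 else 1) = 0 := by
    refine sum_eq_zero fun x hx => sum_eq_zero fun y hy => ?_
    by_cases hxY : x ∈ Y <;> by_cases hyY : y ∈ Y <;> simp only [hxY, hyY, if_true, if_false]
    · simpa using hcon x hxY y (mem_sdiff.2 ⟨hy, hyY⟩)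
    · rw [hsym]
      simpa using hcon y hyY x (mem_sdiff.2 ⟨hx, hxY⟩)
  rw [h3] at h1
  simp [bound] at h1

/-- A nonempty set of faces in which every edge occurs an even number of times is spanning. -/
theorem covers_of_paired (hd : Dense m A) (hsym : ∀ u w, m u w = m w u) {C : Finset (Fin k)}
    (hC : ∀ i ∈ C, ∀ x y, N i x y → ∃ j ∈ C, j ≠ i ∧ N j x y) {i : Fin k} (hi : i ∈ C) :
    (∀ v ∈ A, ∃ j ∈ C, ∃ y, N j v y) ∧
      ∀ x ∈ A, ∀ y ∈ A, x ≠ y → 0 < m x y → ∃ j ∈ C, N j x y := by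
  classical
  -- An edge lies on exactly two faces, so it is covered by none or by both. Hence the faces of `C`
  -- sum to zero and `closed` applies.
  have heven : ∀ x y, Even (C.filter fun i => N i x y).card := by
    intro x y
    rcases (C.filter fun i => N i x y).eq_empty_or_nonempty with h0 | ⟨i, hi⟩
    · rw [h0]; simp
    · obtain ⟨hiC, hixy⟩ := mem_filter.1 hi
      obtain ⟨j, hj, hji, hjxy⟩ := hC i hiC x y hixy
      have h1 := F.cover i x y hixy
      have h2 : (C.filter fun i => N i x y).card ≤ 2 := by
        rw [← h1]
        refine card_le_card fun a ha => ?_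
        simpa using (mem_filter.1 ha).2
      have h3 : 1 < (C.filter fun i => N i x y).card :=
        one_lt_card.2 ⟨j, mem_filter.2 ⟨hj, hjxy⟩, i, hi, hji⟩
      exact ⟨1, by omega⟩
  have hclosed : ∀ i ∈ C, ∀ x y y', N i x y → y' ∈ A → x ≠ y' → 0 < m x y' →
      ∃ j ∈ C, N j x y' := by
    intro i hi x y y' hxy hy' hne h0
    refine F.closed C ?_ i hi x y y' hxy (F.adj i x y hxy).1 hy' hne h0
    intro x y
    convert heven x y
  have hall : A.filter (fun v => ∃ j ∈ C, ∃ y, N j v y) = A := by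
    by_contra hne
    obtain ⟨x, y, hxy⟩ := F.nonempty i
    obtain ⟨u, hu, w, hw, huw⟩ := hd.exists_edge (filter_subset _ _)
      ⟨x, mem_filter.2 ⟨(F.adj i x y hxy).1, i, hi, y, hxy⟩⟩ hne hsym
    obtain ⟨-, j, hj, z, hz⟩ := mem_filter.1 hu
    obtain ⟨hwA, hw'⟩ := mem_sdiff.1 hw
    obtain ⟨l, hl, hluw⟩ := hclosed j hj u z w hz hwA (fun h => hw' (h ▸ hu)) huw
    exact hw' (mem_filter.2 ⟨hwA, l, hl, u, F.symm l u w hluw⟩)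
  have h1 : ∀ v ∈ A, ∃ j ∈ C, ∃ y, N j v y := fun v hv => by
    rw [← hall] at hv
    exact (mem_filter.1 hv).2
  refine ⟨h1, fun x hx y hy hne h0 => ?_⟩
  obtain ⟨j, hj, z, hz⟩ := h1 x hx
  exact hclosed j hj x z y hz hy hne h0

/-- A few faces that close up to a sphere are all of the graph. This excludes coinciding apexes,
since at least five vertices are present. -/
theorem card_le_of_paired (hd : Dense m A) (hsym : ∀ u w, m u w = m w u) {C : Finset (Fin k)}
    (hC : ∀ i ∈ C, ∀ x y, N i x y → ∃ j ∈ C, j ≠ i ∧ N j x y) {i : Fin k} (hi : i ∈ C)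
    {W : Finset V} (hW : ∀ i ∈ C, ∀ x y, N i x y → x ∈ W) : A.card ≤ W.card := by
  refine card_le_card fun v hv => ?_
  obtain ⟨j, hj, y, hy⟩ := (F.covers_of_paired hd hsym hC hi).1 v hv
  exact hW j hj v y hy

theorem cases_card (i : Fin k) :
    ((∃ x, IsCyclic (n := 0) (N i) x) ∧ (darts (N i)).card = 6) ∨
    ((∃ x, IsCyclic (n := 1) (N i) x) ∧ (darts (N i)).card = 8) ∨
    ((∃ x, IsCyclic (n := 2) (N i) x) ∧ (darts (N i)).card = 10) ∨ 12 ≤ (darts (N i)).card := by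
  by_cases hL : (darts (N i)).card < 12
  · rcases exists_isCyclic (F.symm i) (fun x hx => (F.adj i x x hx).2.2.1 rfl) (F.even i)
      (F.nonempty i) hL with ⟨x, hx⟩ | ⟨x, hx⟩ | ⟨x, hx⟩
    · exact Or.inl ⟨⟨x, hx⟩, hx.card_darts⟩
    · exact Or.inr (Or.inl ⟨⟨x, hx⟩, hx.card_darts⟩)
    · exact Or.inr (Or.inr (Or.inl ⟨⟨x, hx⟩, hx.card_darts⟩))
  · exact Or.inr (Or.inr (Or.inr (not_lt.1 hL)))

theorem exists_isTriangle {i : Fin k} (hi : (darts (N i)).card = 6) {x y : V} (hxy : N i x y) :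
    ∃ z, IsTriangle (N i) x y z := by
  rcases F.cases_card i with ⟨⟨x, hx⟩, -⟩ | ⟨-, h⟩ | ⟨-, h⟩ | h
  · exact hx.exists_isTriangle hxy
  all_goals omega

theorem exists_isQuad {i : Fin k} (hi : (darts (N i)).card = 8) {x y : V} (hxy : N i x y) :
    ∃ z w, IsQuad (N i) x y z w := by
  rcases F.cases_card i with ⟨-, h⟩ | ⟨⟨x, hx⟩, -⟩ | ⟨-, h⟩ | h
  · omega
  · exact hx.exists_isQuad hxy
  all_goals omega

end Faces

/-- The number of common ordered edges of two faces. -/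
noncomputable def shared {k : ℕ} (N : Fin k → V → V → Prop) (i j : Fin k) : ℕ :=
  (darts (N i) ∩ darts (N j)).card

/-- Each ordered edge of the face `i` lies on exactly one other face. -/
theorem Faces.sum_shared {m : V → V → ℕ} {A : Finset V} {k : ℕ} {N : Fin k → V → V → Prop}
    (F : Faces m A N) (i : Fin k) : ∑ j ∈ univ.erase i, shared N j i = (darts (N i)).card := by
  classical
  have h1 : ∀ j, shared N j i = ∑ p ∈ darts (N i), if N j p.1 p.2 then 1 else 0 := by
    intro j
    rw [shared, inter_comm, ← card_filter]
    congr 1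
    ext p
    simp [mem_darts]
  simp only [h1]
  rw [sum_comm, card_eq_sum_ones]
  refine sum_congr rfl fun p hp => ?_
  rw [← card_filter]
  obtain ⟨j, hji, hj⟩ := F.exists_ne (mem_darts.1 hp)
  rw [card_eq_one]
  refine ⟨j, ?_⟩
  ext l
  simp only [mem_filter, mem_erase, mem_univ, and_true, mem_singleton]
  constructor
  · rintro ⟨hl, hlp⟩
    exact F.eq_of_ne (mem_darts.1 hp) hlp hj hl hji
  · rintro rfl
    exact ⟨hji, hj⟩

theorem Faces.sum_sum_darts {m : V → V → ℕ} {A : Finset V} {k : ℕ} {N : Fin k → V → V → Prop}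
    (F : Faces m A N) (hd : Dense m A) (hsym : ∀ u w, m u w = m w u) (hk : 0 < k)
    (f : V × V → ℕ) : ∑ i, ∑ p ∈ darts (N i), f p =
      2 * ∑ p ∈ (A ×ˢ A).filter fun p => p.1 ≠ p.2 ∧ 0 < m p.1 p.2, f p := by
  classical
  have h1 : ∀ i, ∑ p ∈ darts (N i), f p =
      ∑ p ∈ (A ×ˢ A).filter fun p => p.1 ≠ p.2 ∧ 0 < m p.1 p.2,
        if N i p.1 p.2 then f p else 0 := by
    intro i
    rw [← sum_filter]
    refine sum_congr ?_ fun _ _ => rfl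
    ext p
    simp only [mem_darts, mem_filter, mem_product]
    exact ⟨fun h => ⟨⟨⟨(F.adj i _ _ h).1, (F.adj i _ _ h).2.1⟩, (F.adj i _ _ h).2.2⟩, h⟩,
      fun h => h.2⟩
  simp only [h1]
  rw [sum_comm, mul_sum]
  refine sum_congr rfl fun p hp => ?_
  simp only [mem_filter, mem_product] at hp
  obtain ⟨i, -, hi⟩ := (F.covers_of_paired hd hsym (C := univ) (i := ⟨0, hk⟩)
    (fun i _ x y hxy => by
      obtain ⟨j, hj, hjxy⟩ := F.exists_ne hxy
      exact ⟨j, mem_univ _, hj, hjxy⟩) (mem_univ _)).2 p.1 hp.1.1 p.2 hp.1.2 hp.2.1 hp.2.2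
  have h2 := F.cover i p.1 p.2 hi
  rw [← sum_filter, sum_const, smul_eq_mul]
  congr 1

end

/-! ### Charges and what the heavy triangles send -/

section

variable {V E : Type*} [Fintype V] [DecidableEq V] [Fintype E] [DecidableEq E]

/-- The total multiplicity of the ordered edges of a face. -/
noncomputable def weight (m : V → V → ℕ) (R : V → V → Prop) : ℕ := ∑ p ∈ darts R, m p.1 p.2

/-- The initial charge of a face. -/
noncomputable def charge (m : V → V → ℕ) (R : V → V → Prop) : ℤ :=
  44 - 11 * ((darts R).card : ℤ) + 2 * (weight m R : ℤ)

/-- A triangular face of positive charge. -/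
def IsHeavy (m : V → V → ℕ) (R : V → V → Prop) : Prop := (darts R).card = 6 ∧ 12 ≤ weight m R

open Classical in
/-- The charge sent from the face `i` to the face `j`. -/
noncomputable def transfer (m : V → V → ℕ) {k : ℕ} (N : Fin k → V → V → Prop) (i j : Fin k) : ℕ :=
  if IsHeavy m (N i) ∧ (darts (N j)).card ≠ 6 then
    if 10 ≤ (darts (N j)).card ∨ weight m (N j) ≤ 18 then shared N i j
    else if shared N i j = 2 then 2 else 0
  else 0

theorem shared_le_of_subset {k : ℕ} {N : Fin k → V → V → Prop} {i j : Fin k} {l : List (V × V)}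
    (hl : l.Nodup) (h : ∀ p ∈ l, N i p.1 p.2 ∧ N j p.1 p.2) : l.length ≤ shared N i j := by
  rw [← List.toFinset_card_of_nodup hl]
  refine card_le_card fun p hp => ?_
  rw [mem_inter, mem_darts, mem_darts]
  exact h p (List.mem_toFinset.1 hp)

namespace Critical

variable {m : V → V → ℕ} {A : Finset V} (h : Critical E m A) {k : ℕ} {N : Fin k → V → V → Prop}
  (F : Faces m A N)

include h F

/-- Each edge is on two faces, so the total is `44k - 22D + 4c`, where `D` counts ordered adjacent
pairs and `c` is twice the number of edges. Euler's inequality `D + 4 ≤ 2k + 2n` and the density `c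
≥ 11n - 19` for the discrete partition give at least `88 - 76 = 12`. -/
theorem sum_charge_pos : 0 < ∑ i, charge m (N i) := by
  have h5 := h.five_le_card
  have hd := h.dense.le_crossing_id
  have hb : 11 * A.card ≤ 2 * bound A.card + 19 := by
    unfold bound; split_ifs <;> omega
  have heul := F.euler
  set D := (A ×ˢ A).filter fun p => p.1 ≠ p.2 ∧ 0 < m p.1 p.2 with hD
  have hcr : crossing m A id = ∑ p ∈ D, m p.1 p.2 := by
    rw [crossing, ← sum_product', hD, sum_filter]
    refine sum_congr rfl fun p _ => ?_
    by_cases hp : p.1 = p.2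
    · simp [hp]
    · simp only [id, hp, if_false, ne_eq, not_false_eq_true, true_and]
      split_ifs <;> omega
  have hk : 0 < k := by
    by_contra hk
    have h7 : crossing m A id ≤ 3 * D.card := by
      rw [hcr, mul_comm, ← smul_eq_mul]
      refine sum_le_card_nsmul _ _ _ fun p hp => ?_
      simp only [hD, mem_filter, mem_product] at hp
      exact h.le_three hp.1.1 hp.1.2 hp.2.1
    have : D.card + 4 ≤ 2 * k + 2 * A.card := by convert heul
    omega
  have h1 := F.sum_sum_darts h.dense h.symm hk fun _ => 1
  have h2 := F.sum_sum_darts h.dense h.symm hk fun p => m p.1 p.2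
  simp only [← card_eq_sum_ones] at h1
  rw [← hcr] at h2
  have h3 : ∑ i, charge m (N i) =
      44 * (k : ℤ) - 11 * ((∑ i, (darts (N i)).card : ℕ) : ℤ) +
        2 * ((∑ i, weight m (N i) : ℕ) : ℤ) := by
    simp only [charge, sum_add_distrib, sum_sub_distrib, ← mul_sum, Nat.cast_sum]
    simp [mul_comm]
  rw [h3]
  have h2' : ∑ i, weight m (N i) = 2 * crossing m A id := h2
  rw [h1, h2']
  have : D.card + 4 ≤ 2 * k + 2 * A.card := by convert heul
  push_cast
  have hDD : ({p ∈ A ×ˢ A | p.1 ≠ p.2 ∧ 0 < m p.1 p.2} : Finset (V × V)).card = D.card := rfl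
  omega

theorem pos_of_adj {i : Fin k} {x y : V} (hxy : N i x y) : 0 < m x y ∧ 0 < m y x := by
  have := (F.adj i x y hxy).2.2.2
  exact ⟨this, by rwa [h.symm]⟩

/-- Two distinct faces are not the same triangle. -/
theorem apex_ne {i j : Fin k} (hij : j ≠ i) {x y z u : V} (hi : IsTriangle (N i) x y z)
    (hj : IsTriangle (N j) x y u) : u ≠ z := by
  rintro rfl
  have h5 := h.five_le_card
  have := F.card_le_of_paired h.dense h.symm (C := {i, j}) (i := i) (W := {x, y, u})
    (by
      simp only [mem_insert, mem_singleton]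
      rintro l (rfl | rfl) a b hab
      · exact ⟨j, Or.inr rfl, hij, (hj.adj a b).2 ((hi.adj a b).1 hab)⟩
      · exact ⟨i, Or.inl rfl, hij.symm, (hi.adj a b).2 ((hj.adj a b).1 hab)⟩) (by simp)
    (by
      simp only [mem_insert, mem_singleton]
      rintro l (rfl | rfl) a b hab
      · rcases (hi.adj a b).1 hab with (⟨a, b⟩ | ⟨a, b⟩) | (⟨a, b⟩ | ⟨a, b⟩) | (⟨a, b⟩ | ⟨a, b⟩) <;>
          simp [a]
      · rcases (hj.adj a b).1 hab with (⟨a, b⟩ | ⟨a, b⟩) | (⟨a, b⟩ | ⟨a, b⟩) | (⟨a, b⟩ | ⟨a, b⟩) <;>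
          simp [a])
  have h3 := card_le_three (a := x) (b := y) (c := u)
  omega

-- Shared edges are counted in both directions, so one common side contributes 2.
theorem two_le_shared {i j : Fin k} {x y : V} (hi : N i x y) (hj : N j x y) :
    2 ≤ shared N i j := by
  have hne := (F.adj i x y hi).2.2.1
  refine shared_le_of_subset (l := [(x, y), (y, x)]) (by simp [hne]) ?_
  simp only [List.forall_mem_cons]
  exact ⟨⟨hi, hj⟩, ⟨F.symm _ _ _ hi, F.symm _ _ _ hj⟩, by simp⟩

theorem four_le_shared {i j : Fin k} {x y z : V} (hi : N i x y) (hj : N j x y) (hi' : N i y z)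
    (hj' : N j y z) (hxz : x ≠ z) : 4 ≤ shared N i j := by
  have hne := (F.adj i x y hi).2.2.1
  have hne' := (F.adj i y z hi').2.2.1
  refine shared_le_of_subset (l := [(x, y), (y, x), (y, z), (z, y)])
    (by simp; grind) ?_
  simp only [List.forall_mem_cons]
  exact ⟨⟨hi, hj⟩, ⟨F.symm _ _ _ hi, F.symm _ _ _ hj⟩, ⟨hi', hj'⟩,
    ⟨F.symm _ _ _ hi', F.symm _ _ _ hj'⟩, by simp⟩

theorem shared_eq_two {i j : Fin k} {x y z a b : V} (hi : IsTriangle (N i) x y z)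
    (hj : IsQuad (N j) x y a b) (ha : a ≠ z) (hb : b ≠ z) : shared N i j = 2 := by
  rw [shared, card_eq_two]
  refine ⟨(x, y), (y, x), by simp [hi.ne₁], ?_⟩
  ext ⟨u, v⟩
  simp only [mem_inter, mem_darts, hi.adj, hj.adj, mem_insert, mem_singleton, Prod.mk.injEq]
  have := hi.ne₁; have := hi.ne₂; have := hi.ne₃; have := hj.ne₁; have := hj.ne₂; have := hj.ne₃
  have := hj.ne₄; have := hj.ne₅; have := hj.ne₆
  clear hi hj h F
  constructor
  · rintro ⟨h1, h2⟩
    rcases h1 with (⟨rfl, rfl⟩ | ⟨rfl, rfl⟩) | (⟨rfl, rfl⟩ | ⟨rfl, rfl⟩) | (⟨rfl, rfl⟩ | ⟨rfl, rfl⟩) <;>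
      grind
  · rintro (⟨rfl, rfl⟩ | ⟨rfl, rfl⟩) <;> simp

theorem weight_triangle {i : Fin k} {x y z : V} (hi : IsTriangle (N i) x y z) :
    weight m (N i) = 2 * (m x y + m y z + m z x) := hi.sum_darts h.symm

theorem mem_of_triangle {i : Fin k} {x y z : V} (hi : IsTriangle (N i) x y z) :
    x ∈ A ∧ y ∈ A ∧ z ∈ A ∧ N i x y ∧ N i y z ∧ N i z x := by
  have h1 : N i x y := (hi.adj x y).2 (by simp)
  have h2 : N i y z := (hi.adj y z).2 (by simp)
  have h3 : N i z x := (hi.adj z x).2 (by simp)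
  exact ⟨(F.adj _ _ _ h1).1, (F.adj _ _ _ h2).1, (F.adj _ _ _ h3).1, h1, h2, h3⟩

theorem mem_of_quad {i : Fin k} {x y z w : V} (hi : IsQuad (N i) x y z w) :
    (x ∈ A ∧ y ∈ A ∧ z ∈ A ∧ w ∈ A) ∧ N i x y ∧ N i y z ∧ N i z w ∧ N i w x := by
  have h1 : N i x y := (hi.adj x y).2 (by simp)
  have h2 : N i y z := (hi.adj y z).2 (by simp)
  have h3 : N i z w := (hi.adj z w).2 (by simp)
  have h4 : N i w x := (hi.adj w x).2 (by simp)
  exact ⟨⟨(F.adj _ _ _ h1).1, (F.adj _ _ _ h2).1, (F.adj _ _ _ h3).1, (F.adj _ _ _ h4).1⟩,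
    h1, h2, h3, h4⟩

/-- The possible faces across an edge of a heavy triangle that receive less than the full
charge. -/
theorem neighbor_cases {i j : Fin k} (hij : j ≠ i) (hi : IsHeavy m (N i)) {x y z : V}
    (ht : IsTriangle (N i) x y z) (hj : N j x y) :
    (∃ u, IsTriangle (N j) x y u ∧ u ≠ z) ∨
    ((∃ b, IsQuad (N j) x y z b ∨ IsQuad (N j) y x z b) ∧ 18 < weight m (N j)) ∨
    (transfer m N i j = shared N i j) := by
  have hx := h.mem_of_triangle F ht
  by_cases hsmall : 10 ≤ (darts (N j)).card ∨ weight m (N j) ≤ 18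
  · by_cases h6 : (darts (N j)).card = 6
    · obtain ⟨u, hu⟩ := F.exists_isTriangle h6 hj
      exact Or.inl ⟨u, hu, h.apex_ne F hij ht hu⟩
    · right; right
      rw [transfer, if_pos ⟨hi, h6⟩, if_pos hsmall]
  · push Not at hsmall
    rcases F.cases_card j with ⟨-, h6⟩ | ⟨-, h8⟩ | ⟨-, h10⟩ | h12
    · obtain ⟨u, hu⟩ := F.exists_isTriangle h6 hj
      exact Or.inl ⟨u, hu, h.apex_ne F hij ht hu⟩
    · obtain ⟨a, b, hq⟩ := F.exists_isQuad h8 hj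
      right
      by_cases ha : a = z
      · subst ha
        exact Or.inl ⟨⟨b, Or.inl hq⟩, hsmall.2⟩
      by_cases hb : b = z
      · subst hb
        exact Or.inl ⟨⟨a, Or.inr hq.reflect⟩, hsmall.2⟩
      · right
        have h2 := h.shared_eq_two F ht hq ha hb
        rw [transfer, if_pos ⟨hi, by omega⟩, if_neg (by omega), if_pos h2, h2]
    · omega
    · omega

theorem transfer_self (i : Fin k) : transfer m N i i = 0 := by
  rw [transfer]
  split_ifs with h1
  · exact absurd h1.1.1 h1.2
  · exact absurd h1.1.1 h1.2
  · rfl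
  · rfl

theorem transfer_le_shared (i j : Fin k) : transfer m N i j ≤ shared N i j := by
  rw [transfer]
  split_ifs <;> omega

theorem sum_transfer_le (j : Fin k) : ∑ i, transfer m N i j ≤ (darts (N j)).card := by
  rw [← F.sum_shared j, ← add_sum_erase _ _ (mem_univ j), h.transfer_self F, zero_add]
  exact sum_le_sum fun i _ => h.transfer_le_shared F i j

/-- The charge of a triangle with seven edges is 6, which it must send through all three sides. A
neighbouring triangle, or a four-cycle along two sides, would provide an apex for a lift. -/
theorem heavy_seven {i : Fin k} (hi : IsHeavy m (N i)) (h14 : 14 ≤ weight m (N i)) :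
    6 ≤ ∑ j, transfer m N i j := by
  rw [← hi.1, ← F.sum_shared i]
  refine le_trans (sum_le_sum fun j hj => ?_)
    (sum_le_sum_of_subset (f := fun j => transfer m N i j) (subset_univ (univ.erase i)))
  rw [shared, inter_comm, ← shared]
  rcases Nat.eq_zero_or_pos (shared N i j) with h0 | h0
  · omega
  obtain ⟨⟨x, y⟩, hp⟩ := card_pos.1 h0
  rw [mem_inter, mem_darts, mem_darts] at hp
  obtain ⟨z, ht⟩ := F.exists_isTriangle hi.1 hp.1
  rw [h.weight_triangle F ht] at h14
  obtain ⟨hx, hy, hz, e1, e2, e3⟩ := h.mem_of_triangle F ht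
  rcases h.neighbor_cases F (mem_erase.1 hj).1 hi ht hp.2 with
    ⟨u, hu, huz⟩ | ⟨⟨b, hq | hq⟩, -⟩ | h1
  · exfalso
    obtain ⟨-, -, hu', f1, f2, f3⟩ := h.mem_of_triangle F hu
    exact h.no_heavy_triple hx hy hz ht.ne₁ ht.ne₂ ht.ne₃ (by omega) hu' hu.ne₃.symm hu.ne₂.symm huz
      (h.pos_of_adj F f3).2 (h.pos_of_adj F f2).2
  · exfalso
    obtain ⟨⟨-, -, -, hb⟩, f1, f2, f3, f4⟩ := h.mem_of_quad F hq
    exact h.no_heavy_triple hz hx hy ht.ne₃.symm ht.ne₁ ht.ne₂.symm (by omega) hb hq.ne₆.symm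
      hq.ne₃.symm hq.ne₅.symm (h.pos_of_adj F f3).1 (h.pos_of_adj F f4).1
  · exfalso
    obtain ⟨⟨-, -, -, hb⟩, f1, f2, f3, f4⟩ := h.mem_of_quad F hq
    exact h.no_heavy_triple hy hz hx ht.ne₂ ht.ne₃.symm ht.ne₁.symm (by omega) hb hq.ne₃.symm
      hq.ne₆.symm hq.ne₅.symm (h.pos_of_adj F f4).2 (h.pos_of_adj F f3).2
  · rw [h1]

/-- If the four-cycle runs along two sides of the triangle, its fourth vertex `b` is adjacent to
both ends of the third side `zx`. The face beyond `zx` then either gives a second apex there or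
receives charge. -/
theorem no_quad_neighbor {i j : Fin k} (hij : j ≠ i) (hi : IsHeavy m (N i))
    (hcon : ∀ l, transfer m N i l < 2) {x y z b : V} (ht : IsTriangle (N i) x y z)
    (hq : IsQuad (N j) x y z b) (hw : 18 < weight m (N j)) : False := by
  obtain ⟨hx, hy, hz, e1, e2, e3⟩ := h.mem_of_triangle F ht
  obtain ⟨⟨-, -, -, hb⟩, f1, f2, f3, f4⟩ := h.mem_of_quad F hq
  have hno : ¬ N j z x := by
    rw [hq.adj]
    have := hq.ne₁; have := hq.ne₂; have := hq.ne₃; have := hq.ne₄; have := hq.ne₆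
    grind
  obtain ⟨l, hli, hl⟩ := F.exists_ne e3
  rcases h.neighbor_cases F hli hi ht.rotate.rotate hl with
    ⟨u, hu, huy⟩ | ⟨⟨c, hq' | hq'⟩, -⟩ | h1
  · obtain ⟨-, -, hu', g1, g2, g3⟩ := h.mem_of_triangle F hu
    -- With equal apexes the three faces close up and leave only four vertices.
    by_cases hub : u = b
    · subst hub
      have h5 := h.five_le_card
      have hlj : l ≠ j := by
        rintro rfl; exact hno hl
      have := F.card_le_of_paired h.dense h.symm (C := {i, j, l}) (i := i) (W := {x, y, z, u})
        (by
          simp only [mem_insert, mem_singleton, exists_eq_or_imp, exists_eq_left]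
          rintro a (rfl | rfl | rfl) p q hpq
          · rcases (ht.adj p q).1 hpq with (⟨rfl, rfl⟩ | ⟨rfl, rfl⟩) | (⟨rfl, rfl⟩ | ⟨rfl, rfl⟩) |
              (⟨rfl, rfl⟩ | ⟨rfl, rfl⟩)
            · exact Or.inr (Or.inl ⟨hij, f1⟩)
            · exact Or.inr (Or.inl ⟨hij, F.symm _ _ _ f1⟩)
            · exact Or.inr (Or.inl ⟨hij, f2⟩)
            · exact Or.inr (Or.inl ⟨hij, F.symm _ _ _ f2⟩)
            · exact Or.inr (Or.inr ⟨hli, g1⟩)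
            · exact Or.inr (Or.inr ⟨hli, F.symm _ _ _ g1⟩)
          · rcases (hq.adj p q).1 hpq with (⟨rfl, rfl⟩ | ⟨rfl, rfl⟩) | (⟨rfl, rfl⟩ | ⟨rfl, rfl⟩) |
              (⟨rfl, rfl⟩ | ⟨rfl, rfl⟩) | (⟨rfl, rfl⟩ | ⟨rfl, rfl⟩)
            · exact Or.inl ⟨hij.symm, e1⟩
            · exact Or.inl ⟨hij.symm, F.symm _ _ _ e1⟩
            · exact Or.inl ⟨hij.symm, e2⟩
            · exact Or.inl ⟨hij.symm, F.symm _ _ _ e2⟩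
            · exact Or.inr (Or.inr ⟨hlj, F.symm _ _ _ g3⟩)
            · exact Or.inr (Or.inr ⟨hlj, g3⟩)
            · exact Or.inr (Or.inr ⟨hlj, F.symm _ _ _ g2⟩)
            · exact Or.inr (Or.inr ⟨hlj, g2⟩)
          · rcases (hu.adj p q).1 hpq with (⟨rfl, rfl⟩ | ⟨rfl, rfl⟩) | (⟨rfl, rfl⟩ | ⟨rfl, rfl⟩) |
              (⟨rfl, rfl⟩ | ⟨rfl, rfl⟩)
            · exact Or.inl ⟨hli.symm, e3⟩
            · exact Or.inl ⟨hli.symm, F.symm _ _ _ e3⟩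
            · exact Or.inr (Or.inl ⟨hlj.symm, F.symm _ _ _ f4⟩)
            · exact Or.inr (Or.inl ⟨hlj.symm, f4⟩)
            · exact Or.inr (Or.inl ⟨hlj.symm, F.symm _ _ _ f3⟩)
            · exact Or.inr (Or.inl ⟨hlj.symm, f3⟩)) (by simp)
        (by
          simp only [mem_insert, mem_singleton]
          rintro a (rfl | rfl | rfl) p q hpq
          · rcases (ht.adj p q).1 hpq with (⟨a, -⟩ | ⟨a, -⟩) | (⟨a, -⟩ | ⟨a, -⟩) |
              (⟨a, -⟩ | ⟨a, -⟩) <;> simp [a]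
          · rcases (hq.adj p q).1 hpq with (⟨a, -⟩ | ⟨a, -⟩) | (⟨a, -⟩ | ⟨a, -⟩) |
              (⟨a, -⟩ | ⟨a, -⟩) | (⟨a, -⟩ | ⟨a, -⟩) <;> simp [a]
          · rcases (hu.adj p q).1 hpq with (⟨a, -⟩ | ⟨a, -⟩) | (⟨a, -⟩ | ⟨a, -⟩) |
              (⟨a, -⟩ | ⟨a, -⟩) <;> simp [a])
      have h4 := card_le_four (a := x) (b := y) (c := z) (d := u)
      omega
    · have hw' : weight m (N j) = 2 * (m x y + m y z + m z b + m b x) := hq.sum_darts h.symm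
      have hT := hi.2
      rw [h.weight_triangle F ht] at hT
      have a1 := h.le_three hz hb hq.ne₆
      have a2 := h.le_three hb hx hq.ne₃.symm
      have a3 := h.triple_le hx hy hz ht.ne₁ ht.ne₂ ht.ne₃
      -- The four-cycle has at least ten edges, at most six of them at `b`, so `xy` and `yz` carry
      -- at least four. If `zx` is triple, the triangle has seven edges and `b` alone suffices.
      have hzx : m z x ≤ 2 ∨ 7 ≤ m x y + m y z + m z x := by omega
      rcases hzx with hzx | hzx
      · exact h.no_two_apexes hz hx hy ht.ne₃.symm ht.ne₁ ht.ne₂.symm (by omega)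
          (h.pos_of_adj F e3).1 (h.pos_of_adj F e1).1 (h.pos_of_adj F e2).1 hb hq.ne₆.symm
          hq.ne₃.symm hq.ne₅.symm hu' hu.ne₃.symm hu.ne₂.symm huy (Ne.symm hub)
          (h.pos_of_adj F f3).1 (h.pos_of_adj F f4).1
          (Or.inr ⟨(h.pos_of_adj F g3).2, (h.pos_of_adj F g2).2, hzx⟩)
      · exact h.no_heavy_triple hz hx hy ht.ne₃.symm ht.ne₁ ht.ne₂.symm (by omega) hb hq.ne₆.symm
          hq.ne₃.symm hq.ne₅.symm (h.pos_of_adj F f3).1 (h.pos_of_adj F f4).1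
  · have : N l x y := (hq'.adj x y).2 (by simp)
    have := F.eq_of_ne e1 this f1 hli hij
    subst this
    exact hno hl
  · have : N l y z := (hq'.adj y z).2 (by simp)
    have := F.eq_of_ne e2 this f2 hli hij
    subst this
    exact hno hl
  · have := h.two_le_shared F e3 hl
    have := hcon l
    omega

/-- The charge here is 2, so one side that transfers is enough. If there is none, triangles lie
across all three sides. Two different apexes allow two lifts, and a single common apex closes the
graph up to a tetrahedron. -/
theorem heavy_six {i : Fin k} (hi : IsHeavy m (N i)) : 2 ≤ ∑ j, transfer m N i j := by
  by_contra! hlt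
  have hcon : ∀ l, transfer m N i l < 2 := fun l =>
    lt_of_le_of_lt (single_le_sum (f := fun j => transfer m N i j) (fun _ _ => Nat.zero_le _)
      (mem_univ l)) hlt
  have hside : ∀ x y z, IsTriangle (N i) x y z →
      ∃ j u, j ≠ i ∧ IsTriangle (N j) x y u ∧ u ≠ z := by
    intro x y z ht
    obtain ⟨hx, hy, hz, e1, e2, e3⟩ := h.mem_of_triangle F ht
    obtain ⟨j, hji, hj⟩ := F.exists_ne e1
    rcases h.neighbor_cases F hji hi ht hj with ⟨u, hu, huz⟩ | ⟨⟨b, hq | hq⟩, hw⟩ | h1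
    · exact ⟨j, u, hji, hu, huz⟩
    · exact (h.no_quad_neighbor F hji hi hcon ht hq hw).elim
    · refine (h.no_quad_neighbor F hji hi hcon ht.rotate.rotate (b := b) ?_ hw).elim
      exact hq.reflect.rotate.rotate.rotate
    · have := h.two_le_shared F e1 hj
      have := hcon j
      omega
  obtain ⟨x, y, hxy⟩ := F.nonempty i
  obtain ⟨z, ht⟩ := F.exists_isTriangle hi.1 hxy
  obtain ⟨hx, hy, hz, e1, e2, e3⟩ := h.mem_of_triangle F ht
  obtain ⟨j₁, u₁, hj₁, t₁, n₁⟩ := hside x y z ht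
  obtain ⟨j₂, u₂, hj₂, t₂, n₂⟩ := hside y z x ht.rotate
  obtain ⟨j₃, u₃, hj₃, t₃, n₃⟩ := hside z x y ht.rotate.rotate
  obtain ⟨-, -, hu₁, a1, a2, a3⟩ := h.mem_of_triangle F t₁
  obtain ⟨-, -, hu₂, b1, b2, b3⟩ := h.mem_of_triangle F t₂
  obtain ⟨-, -, hu₃, c1, c2, c3⟩ := h.mem_of_triangle F t₃
  have hT := hi.2
  rw [h.weight_triangle F ht] at hT
  by_cases h12 : u₁ = u₂
  · by_cases h23 : u₂ = u₃
    · subst h12 h23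
      have h5 := h.five_le_card
      have n12 : j₁ ≠ j₂ := by
        rintro rfl
        have := (t₂.adj x y).1 a1
        have := ht.ne₁; have := ht.ne₂; have := ht.ne₃; have := t₁.ne₃; have := t₁.ne₂
        grind
      have n23 : j₂ ≠ j₃ := by
        rintro rfl
        have := (t₃.adj y z).1 b1
        have := ht.ne₁; have := ht.ne₂; have := ht.ne₃; have := t₂.ne₃; have := t₂.ne₂
        grind
      have n13 : j₁ ≠ j₃ := by
        rintro rfl
        have := (t₃.adj x y).1 a1
        have := ht.ne₁; have := ht.ne₂; have := ht.ne₃; have := t₁.ne₃; have := t₁.ne₂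
        grind
      have := F.card_le_of_paired h.dense h.symm (C := {i, j₁, j₂, j₃}) (i := i)
        (W := {x, y, z, u₁})
        (by
          simp only [mem_insert, mem_singleton, exists_eq_or_imp, exists_eq_left]
          rintro a (rfl | rfl | rfl | rfl) p q hpq
          · rcases (ht.adj p q).1 hpq with (⟨rfl, rfl⟩ | ⟨rfl, rfl⟩) | (⟨rfl, rfl⟩ | ⟨rfl, rfl⟩) |
              (⟨rfl, rfl⟩ | ⟨rfl, rfl⟩)
            · exact Or.inr (Or.inl ⟨hj₁, a1⟩)
            · exact Or.inr (Or.inl ⟨hj₁, F.symm _ _ _ a1⟩)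
            · exact Or.inr (Or.inr (Or.inl ⟨hj₂, b1⟩))
            · exact Or.inr (Or.inr (Or.inl ⟨hj₂, F.symm _ _ _ b1⟩))
            · exact Or.inr (Or.inr (Or.inr ⟨hj₃, c1⟩))
            · exact Or.inr (Or.inr (Or.inr ⟨hj₃, F.symm _ _ _ c1⟩))
          · rcases (t₁.adj p q).1 hpq with (⟨rfl, rfl⟩ | ⟨rfl, rfl⟩) | (⟨rfl, rfl⟩ | ⟨rfl, rfl⟩) |
              (⟨rfl, rfl⟩ | ⟨rfl, rfl⟩)
            · exact Or.inl ⟨hj₁.symm, e1⟩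
            · exact Or.inl ⟨hj₁.symm, F.symm _ _ _ e1⟩
            · exact Or.inr (Or.inr (Or.inl ⟨n12.symm, F.symm _ _ _ b3⟩))
            · exact Or.inr (Or.inr (Or.inl ⟨n12.symm, b3⟩))
            · exact Or.inr (Or.inr (Or.inr ⟨n13.symm, F.symm _ _ _ c2⟩))
            · exact Or.inr (Or.inr (Or.inr ⟨n13.symm, c2⟩))
          · rcases (t₂.adj p q).1 hpq with (⟨rfl, rfl⟩ | ⟨rfl, rfl⟩) | (⟨rfl, rfl⟩ | ⟨rfl, rfl⟩) |
              (⟨rfl, rfl⟩ | ⟨rfl, rfl⟩)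
            · exact Or.inl ⟨hj₂.symm, e2⟩
            · exact Or.inl ⟨hj₂.symm, F.symm _ _ _ e2⟩
            · exact Or.inr (Or.inr (Or.inr ⟨n23.symm, F.symm _ _ _ c3⟩))
            · exact Or.inr (Or.inr (Or.inr ⟨n23.symm, c3⟩))
            · exact Or.inr (Or.inl ⟨n12, F.symm _ _ _ a2⟩)
            · exact Or.inr (Or.inl ⟨n12, a2⟩)
          · rcases (t₃.adj p q).1 hpq with (⟨rfl, rfl⟩ | ⟨rfl, rfl⟩) | (⟨rfl, rfl⟩ | ⟨rfl, rfl⟩) |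
              (⟨rfl, rfl⟩ | ⟨rfl, rfl⟩)
            · exact Or.inl ⟨hj₃.symm, e3⟩
            · exact Or.inl ⟨hj₃.symm, F.symm _ _ _ e3⟩
            · exact Or.inr (Or.inl ⟨n13, F.symm _ _ _ a3⟩)
            · exact Or.inr (Or.inl ⟨n13, a3⟩)
            · exact Or.inr (Or.inr (Or.inl ⟨n23, F.symm _ _ _ b2⟩))
            · exact Or.inr (Or.inr (Or.inl ⟨n23, b2⟩))) (by simp)
        (by
          simp only [mem_insert, mem_singleton]
          rintro a (rfl | rfl | rfl | rfl) p q hpq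
          · rcases (ht.adj p q).1 hpq with (⟨a, -⟩ | ⟨a, -⟩) | (⟨a, -⟩ | ⟨a, -⟩) |
              (⟨a, -⟩ | ⟨a, -⟩) <;> simp [a]
          · rcases (t₁.adj p q).1 hpq with (⟨a, -⟩ | ⟨a, -⟩) | (⟨a, -⟩ | ⟨a, -⟩) |
              (⟨a, -⟩ | ⟨a, -⟩) <;> simp [a]
          · rcases (t₂.adj p q).1 hpq with (⟨a, -⟩ | ⟨a, -⟩) | (⟨a, -⟩ | ⟨a, -⟩) |
              (⟨a, -⟩ | ⟨a, -⟩) <;> simp [a]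
          · rcases (t₃.adj p q).1 hpq with (⟨a, -⟩ | ⟨a, -⟩) | (⟨a, -⟩ | ⟨a, -⟩) |
              (⟨a, -⟩ | ⟨a, -⟩) <;> simp [a])
      have h4 := card_le_four (a := x) (b := y) (c := z) (d := u₁)
      omega
    · exact h.no_two_apexes hy hz hx ht.ne₂ ht.ne₃.symm ht.ne₁.symm (by omega)
        (h.pos_of_adj F e2).1 (h.pos_of_adj F e3).1 (h.pos_of_adj F e1).1 hu₂ t₂.ne₃.symm
        t₂.ne₂.symm n₂ hu₃ n₃ t₃.ne₃.symm t₃.ne₂.symm h23 (h.pos_of_adj F b3).2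
        (h.pos_of_adj F b2).2 (Or.inl ⟨(h.pos_of_adj F c3).2, (h.pos_of_adj F c2).2⟩)
  · exact h.no_two_apexes hx hy hz ht.ne₁ ht.ne₂ ht.ne₃ (by omega)
      (h.pos_of_adj F e1).1 (h.pos_of_adj F e2).1 (h.pos_of_adj F e3).1 hu₁ t₁.ne₃.symm
      t₁.ne₂.symm n₁ hu₂ n₂ t₂.ne₃.symm t₂.ne₂.symm h12 (h.pos_of_adj F a3).2
      (h.pos_of_adj F a2).2 (Or.inl ⟨(h.pos_of_adj F b3).2, (h.pos_of_adj F b2).2⟩)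

end Critical

end

/-! ### Faces that receive charge, and the contradiction -/

section

variable {V E : Type*} [Fintype V] [DecidableEq V] [Fintype E] [DecidableEq E]

namespace Critical

variable {m : V → V → ℕ} {A : Finset V} (h : Critical E m A) {k : ℕ} {N : Fin k → V → V → Prop}
  (F : Faces m A N)

include h F

theorem weight_le (i : Fin k) : weight m (N i) ≤ 3 * (darts (N i)).card := by
  rw [weight, mul_comm, ← smul_eq_mul]
  refine sum_le_card_nsmul _ _ _ fun p hp => ?_
  have := F.adj i p.1 p.2 (mem_darts.1 hp)
  exact h.le_three this.1 this.2.1 this.2.2.1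

/-- With at most 14 edges the charge is at most -10, and at most 10 arrives. With 15 edges the
charge is only -6, but all sides are triple and then nothing arrives. -/
theorem pentagon_le {j : Fin k} (h10 : (darts (N j)).card = 10) :
    charge m (N j) + ((∑ i, transfer m N i j : ℕ) : ℤ) ≤ 0 := by
  have h1 := h.sum_transfer_le F j
  by_cases hw : weight m (N j) ≤ 28
  · rw [charge, h10]
    omega
  have hcyc : ∃ t, IsCyclic (n := 2) (N j) t := by
    rcases F.cases_card j with ⟨-, h6⟩ | ⟨-, h8⟩ | ⟨ht, h10⟩ | h12
    · omega
    · omega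
    · exact ht
    · omega
  have hthree : ∀ x y, N j x y → 3 ≤ m x y := by
    intro x y hxy
    by_contra! hlt
    have hne := (F.adj j x y hxy).2.2.1
    have h2 : weight m (N j) < ∑ p ∈ darts (N j), 3 := by
      refine sum_lt_sum (fun p hp => ?_) ⟨(x, y), mem_darts.2 hxy, hlt⟩
      have := F.adj j p.1 p.2 (mem_darts.1 hp)
      exact h.le_three this.1 this.2.1 this.2.2.1
    have h3 : Even (weight m (N j)) := by
      obtain ⟨t, ht⟩ := hcyc
      rw [weight, ht.sum_darts fun p => m p.1 p.2]
      simp only [h.symm (t (_ + 1))]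
      refine ⟨∑ i, m (t i) (t (i + 1)), ?_⟩
      rw [← sum_add_distrib]
    rw [sum_const, h10, smul_eq_mul] at h2
    obtain ⟨a, ha⟩ := h3
    omega
  have h0 : ∑ i, transfer m N i j = 0 := by
    refine sum_eq_zero fun i _ => ?_
    by_contra hne
    have hpos : 0 < shared N i j := by
      have := h.transfer_le_shared F i j
      omega
    have hi : IsHeavy m (N i) := by
      by_contra hi
      exact hne (by rw [transfer, if_neg fun hh => hi hh.1])
    obtain ⟨⟨x, y⟩, hp⟩ := card_pos.1 hpos
    rw [mem_inter, mem_darts, mem_darts] at hp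
    obtain ⟨z, ht⟩ := F.exists_isTriangle hi.1 hp.1
    obtain ⟨hx, hy, hz, e1, e2, e3⟩ := h.mem_of_triangle F ht
    obtain ⟨t, hcyc⟩ := hcyc
    -- The third vertex of an adjacent heavy triangle is either an outside apex of the five-cycle or
    -- makes one of the triangle's sides a chord. Both are excluded.
    obtain ⟨t, htc, rfl, rfl⟩ := hcyc.exists_start hp.2
    have hadj : ∀ l, N j (t l) (t (l + 1)) := fun l => (htc.adj _ _).2 ⟨l, Or.inl ⟨rfl, rfl⟩⟩
    have htA : ∀ l, t l ∈ A := fun l => (F.adj j _ _ (hadj l)).1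
    have ht3 : ∀ l, 3 ≤ m (t l) (t (l + 1)) := fun l => hthree _ _ (hadj l)
    by_cases hzt : ∀ l, z ≠ t l
    · exact h.no_apex_five_cycle htc.inj htA ht3 0 hz hzt (h.pos_of_adj F e3).2
        (h.pos_of_adj F e2).2
    · push Not at hzt
      obtain ⟨l, rfl⟩ := hzt
      fin_cases l
      · exact ht.ne₃ rfl
      · exact ht.ne₂ rfl
      · exact h.no_chord_five_cycle htc.inj htA ht3 0 (h.pos_of_adj F e3).2
      · exact h.no_chord_five_cycle htc.inj htA ht3 1 (h.pos_of_adj F e2).1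
      · exact h.no_chord_five_cycle htc.inj htA ht3 4 (h.pos_of_adj F e2).2
  have h2 := h.weight_le F j
  rw [h0, charge, h10]
  push_cast at *
  omega

/-- If the triangle had its third vertex on the four-cycle, the two faces would share two sides and
hence at least four ordered edges. -/
theorem exists_apex {i j : Fin k} (hi : IsHeavy m (N i)) (hs : shared N i j = 2) {x y z w : V}
    (hq : IsQuad (N j) x y z w) (hxy : N i x y) :
    ∃ u, IsTriangle (N i) x y u ∧ u ≠ z ∧ u ≠ w := by
  obtain ⟨u, hu⟩ := F.exists_isTriangle hi.1 hxy
  obtain ⟨-, -, -, e1, e2, e3⟩ := h.mem_of_triangle F hu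
  obtain ⟨-, f1, f2, f3, f4⟩ := h.mem_of_quad F hq
  refine ⟨u, hu, ?_, ?_⟩
  · rintro rfl
    have := h.four_le_shared F e1 f1 e2 f2 hu.ne₃
    omega
  · rintro rfl
    have := h.four_le_shared F e3 f4 e1 f1 hu.ne₂.symm
    omega

/-- A four-cycle with ten edges admits no two distinct apexes on these sides, so the three triangles
have a common apex. -/
theorem no_three_neighbors {i₁ i₂ i₃ j : Fin k} (h₁ : IsHeavy m (N i₁)) (h₂ : IsHeavy m (N i₂))
    (h₃ : IsHeavy m (N i₃)) (s₁ : shared N i₁ j = 2) (s₂ : shared N i₂ j = 2)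
    (s₃ : shared N i₃ j = 2) {x y z w : V} (hq : IsQuad (N j) x y z w)
    (hw : 20 ≤ weight m (N j)) (n₁ : N i₁ x y) (n₂ : N i₂ y z) (n₃ : N i₃ z w) : False := by
  obtain ⟨u₁, t₁, a₁, b₁⟩ := h.exists_apex F h₁ s₁ hq n₁
  obtain ⟨u₂, t₂, a₂, b₂⟩ := h.exists_apex F h₂ s₂ hq.rotate n₂
  obtain ⟨u₃, t₃, a₃, b₃⟩ := h.exists_apex F h₃ s₃ hq.rotate.rotate n₃
  have hw' : weight m (N j) = 2 * (m x y + m y z + m z w + m w x) := hq.sum_darts h.symm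
  obtain ⟨⟨hx, hy, hz, hwA⟩, f1, f2, f3, f4⟩ := h.mem_of_quad F hq
  obtain ⟨-, -, hu₁, c1, c2, c3⟩ := h.mem_of_triangle F t₁
  obtain ⟨-, -, hu₂, d1, d2, d3⟩ := h.mem_of_triangle F t₂
  obtain ⟨-, -, hu₃, e1, e2, e3⟩ := h.mem_of_triangle F t₃
  have h12 : u₁ = u₂ := by
    by_contra hne
    exact h.no_two_apexes_four_cycle hx hy hz hwA hq.ne₁ hq.ne₂ hq.ne₃ hq.ne₄ hq.ne₅ hq.ne₆
      (by omega) hu₁ t₁.ne₃.symm t₁.ne₂.symm a₁ b₁ hu₂ b₂ t₂.ne₃.symm t₂.ne₂.symm a₂ hne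
      (h.pos_of_adj F c3).2 (h.pos_of_adj F c2).2
      (Or.inl ⟨(h.pos_of_adj F d3).2, (h.pos_of_adj F d2).2⟩)
  have h23 : u₂ = u₃ := by
    by_contra hne
    exact h.no_two_apexes_four_cycle hy hz hwA hx hq.ne₄ hq.ne₅ hq.ne₁.symm hq.ne₆ hq.ne₂.symm
      hq.ne₃.symm
      (by omega) hu₂ t₂.ne₃.symm t₂.ne₂.symm a₂ b₂ hu₃ b₃ t₃.ne₃.symm t₃.ne₂.symm a₃ hne
      (h.pos_of_adj F d3).2 (h.pos_of_adj F d2).2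
      (Or.inl ⟨(h.pos_of_adj F e3).2, (h.pos_of_adj F e2).2⟩)
  subst h12 h23
  have hT := h₂.2
  rw [h.weight_triangle F t₂] at hT
  have s1 := h.symm y u₁
  have s2 := h.symm u₁ z
  have s3 := h.symm z y
  -- The middle triangle on `y`, `z` and the common apex is itself heavy, and `x` and `w` are two
  -- apexes on different sides of it.
  exact h.no_two_apexes hy hu₁ hz t₂.ne₃ t₂.ne₂.symm t₂.ne₁ (by omega) (h.pos_of_adj F d3).2
    (h.pos_of_adj F d2).2 (h.pos_of_adj F d1).2 hx hq.ne₁ t₁.ne₃ hq.ne₂ hwA hq.ne₅.symm b₁.symm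
    hq.ne₆.symm hq.ne₃ (h.pos_of_adj F f1).2 (h.pos_of_adj F c3).2
    (Or.inl ⟨(h.pos_of_adj F e2).2, (h.pos_of_adj F f3).2⟩)

theorem exists_side {i j : Fin k} (hs : shared N i j = 2) {x y z w : V}
    (hq : IsQuad (N j) x y z w) : N i x y ∨ N i y z ∨ N i z w ∨ N i w x := by
  obtain ⟨⟨u, v⟩, hp⟩ := card_pos.1 (show 0 < shared N i j by omega)
  rw [mem_inter, mem_darts, mem_darts, hq.adj] at hp
  obtain ⟨h1, (⟨rfl, rfl⟩ | ⟨rfl, rfl⟩) | (⟨rfl, rfl⟩ | ⟨rfl, rfl⟩) | (⟨rfl, rfl⟩ | ⟨rfl, rfl⟩) |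
    (⟨rfl, rfl⟩ | ⟨rfl, rfl⟩)⟩ := hp
  · exact Or.inl h1
  · exact Or.inl (F.symm _ _ _ h1)
  · exact Or.inr (Or.inl h1)
  · exact Or.inr (Or.inl (F.symm _ _ _ h1))
  · exact Or.inr (Or.inr (Or.inl h1))
  · exact Or.inr (Or.inr (Or.inl (F.symm _ _ _ h1)))
  · exact Or.inr (Or.inr (Or.inr h1))
  · exact Or.inr (Or.inr (Or.inr (F.symm _ _ _ h1)))

/-- The charge is `4M - 44` for `M` edges in all. For `M ≤ 9` it is at most -8, and at most 8
arrives. For `M = 10` it is -4 and at most two triangles send 2 each. For `M = 11` it is 0 and no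
triangle sends anything. -/
theorem quad_le {j : Fin k} (h8 : (darts (N j)).card = 8) :
    charge m (N j) + ((∑ i, transfer m N i j : ℕ) : ℤ) ≤ 0 := by
  classical
  have h1 := h.sum_transfer_le F j
  by_cases hw : weight m (N j) ≤ 18
  · rw [charge, h8]
    omega
  obtain ⟨x, y, hxy⟩ := F.nonempty j
  obtain ⟨z, w, hq⟩ := F.exists_isQuad h8 hxy
  have hwt : weight m (N j) = 2 * (m x y + m y z + m z w + m w x) := hq.sum_darts h.symm
  obtain ⟨⟨hx, hy, hz, hwA⟩, f1, f2, f3, f4⟩ := h.mem_of_quad F hq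
  have h11 := h.four_cycle_le hx hy hz hwA hq.ne₁ hq.ne₂ hq.ne₃ hq.ne₄ hq.ne₅ hq.ne₆
  set B := univ.filter fun i => IsHeavy m (N i) ∧ shared N i j = 2 with hB
  have hsum : ∑ i, transfer m N i j = 2 * B.card := by
    rw [mul_comm, ← smul_eq_mul, ← sum_const, hB, sum_filter]
    refine sum_congr rfl fun i _ => ?_
    rw [transfer]
    by_cases hi : IsHeavy m (N i)
    · rw [if_pos ⟨hi, by omega⟩, if_neg (by omega)]
      simp [hi]
    · rw [if_neg (by tauto), if_neg (by tauto)]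
  have hBj : ∀ i ∈ B, i ≠ j ∧ IsHeavy m (N i) ∧ shared N i j = 2 := by
    intro i hi
    have hi := (mem_filter.1 hi).2
    refine ⟨?_, hi⟩
    rintro rfl
    have := hi.1.1
    omega
  rw [hsum, charge, h8]
  by_cases h22 : m x y + m y z + m z w + m w x = 11
  · have hB0 : B = ∅ := by
      rw [eq_empty_iff_forall_notMem]
      intro i hi
      obtain ⟨hij, hih, hs⟩ := hBj i hi
      have key : ∀ x y z w, IsQuad (N j) x y z w → 11 ≤ m x y + m y z + m z w + m w x →
          N i x y → False := by
        intro x y z w hq hm hxy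
        obtain ⟨⟨hx, hy, hz, hwA⟩, f1, f2, f3, f4⟩ := h.mem_of_quad F hq
        obtain ⟨u, hu, huz, huw⟩ := h.exists_apex F hih hs hq hxy
        obtain ⟨-, -, hu', e1, e2, e3⟩ := h.mem_of_triangle F hu
        exact h.no_apex_four_cycle hx hy hz hwA hq.ne₁ hq.ne₂ hq.ne₃ hq.ne₄ hq.ne₅ hq.ne₆ hm hu'
          hu.ne₃.symm hu.ne₂.symm huz huw (h.pos_of_adj F e3).2 (h.pos_of_adj F e2).2
      rcases h.exists_side F hs hq with a | a | a | a
      · exact key _ _ _ _ hq (by omega) a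
      · exact key _ _ _ _ hq.rotate (by omega) a
      · exact key _ _ _ _ hq.rotate.rotate (by omega) a
      · exact key _ _ _ _ hq.rotate.rotate.rotate (by omega) a
    rw [hB0, hwt]
    push_cast
    simp only [card_empty]
    omega
  · have hB2 : B.card ≤ 2 := by
      by_contra! hlt
      obtain ⟨i₁, hi₁, i₂, hi₂, i₃, hi₃, n12, n13, n23⟩ := two_lt_card.1 hlt
      obtain ⟨hj₁, hh₁, s₁⟩ := hBj _ hi₁
      obtain ⟨hj₂, hh₂, s₂⟩ := hBj _ hi₂
      obtain ⟨hj₃, hh₃, s₃⟩ := hBj _ hi₃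
      have hsame : ∀ {a b i i'}, i ≠ j → i' ≠ j → N j a b → N i a b → N i' a b → i = i' :=
        fun ha hb hj hi hi' => F.eq_of_ne hj hi hi' ha hb
      have key : ∀ x y z w, IsQuad (N j) x y z w → N i₁ x y → False := by
        intro x y z w hq hxy
        obtain ⟨-, f1, f2, f3, f4⟩ := h.mem_of_quad F hq
        rcases h.exists_side F s₂ hq with a | a | a | a <;>
          rcases h.exists_side F s₃ hq with b | b | b | b
        · exact n12 (hsame hj₁ hj₂ f1 hxy a)
        · exact n12 (hsame hj₁ hj₂ f1 hxy a)
        · exact n12 (hsame hj₁ hj₂ f1 hxy a)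
        · exact n12 (hsame hj₁ hj₂ f1 hxy a)
        · exact n13 (hsame hj₁ hj₃ f1 hxy b)
        · exact n23 (hsame hj₂ hj₃ f2 a b)
        · exact h.no_three_neighbors F hh₁ hh₂ hh₃ s₁ s₂ s₃ hq (by omega) hxy a b
        · exact h.no_three_neighbors F hh₃ hh₁ hh₂ s₃ s₁ s₂ hq.rotate.rotate.rotate (by omega)
            b hxy a
        · exact n13 (hsame hj₁ hj₃ f1 hxy b)
        · exact h.no_three_neighbors F hh₁ hh₃ hh₂ s₁ s₃ s₂ hq (by omega) hxy b a
        · exact n23 (hsame hj₂ hj₃ f3 a b)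
        · exact h.no_three_neighbors F hh₂ hh₃ hh₁ s₂ s₃ s₁ hq.rotate.rotate (by omega) a b hxy
        · exact n13 (hsame hj₁ hj₃ f1 hxy b)
        · exact h.no_three_neighbors F hh₂ hh₁ hh₃ s₂ s₁ s₃ hq.rotate.rotate.rotate (by omega)
            a hxy b
        · exact h.no_three_neighbors F hh₃ hh₂ hh₁ s₃ s₂ s₁ hq.rotate.rotate (by omega) b a hxy
        · exact n23 (hsame hj₂ hj₃ f4 a b)
      rcases h.exists_side F s₁ hq with a | a | a | a
      · exact key _ _ _ _ hq a
      · exact key _ _ _ _ hq.rotate a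
      · exact key _ _ _ _ hq.rotate.rotate a
      · exact key _ _ _ _ hq.rotate.rotate.rotate a
    rw [hwt]
    push_cast
    omega

theorem final_charge_nonpos (i : Fin k) : charge m (N i) - ((∑ j, transfer m N i j : ℕ) : ℤ) +
    ((∑ j, transfer m N j i : ℕ) : ℤ) ≤ 0 := by
  by_cases h6 : (darts (N i)).card = 6
  · have h0 : ∑ j, transfer m N j i = 0 := sum_eq_zero fun j _ => by
      rw [transfer, if_neg fun hh => hh.2 h6]
    have hcyc : Even (weight m (N i)) ∧ weight m (N i) ≤ 14 := by
      obtain ⟨x, y, hxy⟩ := F.nonempty i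
      obtain ⟨z, ht⟩ := F.exists_isTriangle h6 hxy
      obtain ⟨hx, hy, hz, -⟩ := h.mem_of_triangle F ht
      have := h.triple_le hx hy hz ht.ne₁ ht.ne₂ ht.ne₃
      rw [h.weight_triangle F ht]
      exact ⟨even_two_mul _, by omega⟩
    obtain ⟨⟨a, ha⟩, h14⟩ := hcyc
    rw [h0, charge, h6]
    by_cases hh : IsHeavy m (N i)
    · by_cases hw : 14 ≤ weight m (N i)
      · have := h.heavy_seven F hh hw
        omega
      · have := h.heavy_six F hh
        omega
    · have : ¬ 12 ≤ weight m (N i) := fun hw => hh ⟨h6, hw⟩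
      omega
  · have h0 : ∑ j, transfer m N i j = 0 := sum_eq_zero fun j _ => by
      rw [transfer, if_neg fun hh => h6 hh.1.1]
    rw [h0]
    push_cast
    rw [sub_zero]
    rcases F.cases_card i with ⟨-, h6'⟩ | ⟨-, h8⟩ | ⟨-, h10⟩ | h12
    · exact absurd h6' h6
    · simpa using h.quad_le F h8
    · simpa using h.pentagon_le F h10
    -- With `d ≥ 12` ordered edges of multiplicity at most three, the charge is at most `44 - 5d`
    -- and at most `d` arrives.
    · have h1 := h.sum_transfer_le F i
      have h2 := h.weight_le F i
      have h3 : charge m (N i) + ((∑ j, transfer m N j i : ℕ) : ℤ) ≤ 0 := by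
        rw [charge]
        omega
      simpa using h3

omit F in
theorem false : False := by
  obtain ⟨k, N, F⟩ := h.exists_faces
  have h1 := h.sum_charge_pos F
  have h2 : ∑ i, (charge m (N i) - ((∑ j, transfer m N i j : ℕ) : ℤ) +
      ((∑ j, transfer m N j i : ℕ) : ℤ)) ≤ 0 := sum_nonpos fun i _ => h.final_charge_nonpos F i
  rw [sum_add_distrib, sum_sub_distrib] at h2
  have h3 : ∑ i, ((∑ j, transfer m N i j : ℕ) : ℤ) = ∑ i, ((∑ j, transfer m N j i : ℕ) : ℤ) := by
    push_cast
    exact sum_comm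
  omega

end Critical

/-- A planar multigraph that satisfies the density condition can be oriented with arbitrary
prescribed net degrees modulo five. -/
theorem stronglyConn_of_dense {m : V → V → ℕ} {A : Finset V} (hsym : ∀ u w, m u w = m w u)
    (hp : PlanarSupport E m A) (hd : Dense m A) : StronglyConn m A := by
  induction hn : A.card using Nat.strong_induction_on generalizing m A with
  | _ n ih =>
    by_contra hcon
    exact Critical.false (E := E) ⟨hsym, hp, hd, hcon, fun m' A' hlt hs hp' hd' =>
      ih _ (hn ▸ hlt) hs hp' hd' rfl⟩

end

section

variable {V E : Type*} [Fintype V] [DecidableEq V] [Fintype E] [DecidableEq E]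

/-! ### Balanced orientations of odd-edge-connected planar multigraphs -/

/-- The number of edges of `S` with exactly one end in `X`. -/
def cut (s t : E → V) (S : Finset E) (X : Finset V) : ℕ :=
  ∑ e ∈ S, if (s e ∈ X ↔ t e ∈ X) then 0 else 1

/-- All odd cuts have at least eleven edges. -/
def OddConn (s t : E → V) (S : Finset E) : Prop :=
  ∀ X : Finset V, Odd (cut s t S X) → 11 ≤ cut s t S X

/-- The net value of an edge of value `c` at the vertex `v`. -/
def edgeNet (s t : E → V) (e : E) (c : ZMod 5) (v : V) : ZMod 5 :=
  (if s e = v then c else 0) - (if t e = v then c else 0)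

/-- The net outflow at `v`. -/
def net (s t : E → V) (S : Finset E) (ε : E → ZMod 5) (v : V) : ZMod 5 :=
  ∑ e ∈ S, edgeNet s t e (ε e) v

/-- Existence of an orientation, coded by signs, whose net outflows vanish modulo five. -/
def Balanced (s t : E → V) (S : Finset E) : Prop :=
  ∃ ε : E → ZMod 5, (∀ e, ε e = 1 ∨ ε e = -1) ∧ ∀ v, net s t S ε v = 0

theorem net_congr {s t : E → V} {S : Finset E} {ε ε' : E → ZMod 5} (h : ∀ e ∈ S, ε e = ε' e)
    (v : V) : net s t S ε v = net s t S ε' v :=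
  sum_congr rfl fun e he => by rw [h e he]

theorem Balanced.union {s t : E → V} {S : Finset E} (P : E → Prop) [DecidablePred P]
    (h : Balanced s t (S.filter P)) (h' : Balanced s t (S.filter fun e => ¬ P e)) :
    Balanced s t S := by
  obtain ⟨ε, h1, h2⟩ := h
  obtain ⟨ε', h1', h2'⟩ := h'
  refine ⟨fun e => if P e then ε e else ε' e, fun e => ?_, fun v => ?_⟩
  · dsimp only
    split_ifs
    · exact h1 e
    · exact h1' e
  · have h3 := h2 v
    have h3' := h2' v
    rw [net, ← sum_filter_add_sum_filter_not S P]
    have a1 : net s t (S.filter P) (fun e => if P e then ε e else ε' e) v = 0 := by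
      rw [← h3]
      exact net_congr (fun e he => if_pos (mem_filter.1 he).2) v
    have a2 : net s t (S.filter fun e => ¬ P e) (fun e => if P e then ε e else ε' e) v = 0 := by
      rw [← h3']
      exact net_congr (fun e he => if_neg (mem_filter.1 he).2) v
    rw [net] at a1 a2
    rw [a1, a2, add_zero]

theorem Balanced.of_erase_loop {s t : E → V} {S : Finset E} {e : E} (he : s e = t e)
    (h : Balanced s t (S.erase e)) : Balanced s t S := by
  by_cases heS : e ∈ S
  · obtain ⟨ε, h1, h2⟩ := h
    refine ⟨ε, h1, fun v => ?_⟩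
    rw [net, ← add_sum_erase _ _ heS, ← net, h2, add_zero, edgeNet, he, sub_self]
  · rwa [erase_eq_of_notMem heS] at h

theorem OddConn.erase_loop {s t : E → V} {S : Finset E} {e : E} (he : s e = t e)
    (h : OddConn s t S) : OddConn s t (S.erase e) := by
  have : ∀ X, cut s t (S.erase e) X = cut s t S X := by
    intro X
    by_cases heS : e ∈ S
    · rw [cut, cut, ← add_sum_erase S _ heS, he]
      simp
    · rw [erase_eq_of_notMem heS]
  intro X
  rw [this]
  exact h X

theorem cut_compl (s t : E → V) (S : Finset E) (X : Finset V) : cut s t S Xᶜ = cut s t S X := by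
  simp only [cut, mem_compl, not_iff_not]

/-- Edge sets on both sides of a cut vertex inherit odd edge-connectivity. -/
theorem OddConn.filter {s t : E → V} {S : Finset E} (h : OddConn s t S) {v : V} {Y : Finset V}
    (hv : v ∉ Y) (hY : ∀ e ∈ S, ∀ a ∈ Y, ∀ b, Joins s t e a b → b ∈ Y ∨ b = v) :
    OddConn s t (S.filter fun e => s e ∈ Y ∨ t e ∈ Y) ∧
      OddConn s t (S.filter fun e => ¬ (s e ∈ Y ∨ t e ∈ Y)) := by
  -- Up to complements the cut set avoids `v`. Its intersection with `Y`, or its difference from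
  -- `Y`, then defines the same cut in the whole graph.
  have key : ∀ S', (∀ X : Finset V, v ∉ X → ∃ X', cut s t S' X = cut s t S X') →
      OddConn s t S' := by
    intro S' hS' X hX
    by_cases hvX : v ∈ X
    · obtain ⟨X', h1⟩ := hS' Xᶜ (by simpa using hvX)
      rw [cut_compl] at h1
      rw [h1] at hX ⊢
      exact h X' hX
    · obtain ⟨X', h1⟩ := hS' X hvX
      rw [h1] at hX ⊢
      exact h X' hX
  have hst : ∀ e ∈ S, s e ∈ Y → t e ∈ Y ∨ t e = v := fun e he hs =>
    hY e he _ hs _ (Or.inl ⟨rfl, rfl⟩)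
  have hts : ∀ e ∈ S, t e ∈ Y → s e ∈ Y ∨ s e = v := fun e he hs =>
    hY e he _ hs _ (Or.inr ⟨rfl, rfl⟩)
  constructor
  · refine key _ fun X hvX => ⟨X ∩ Y, ?_⟩
    rw [cut, cut, sum_filter]
    refine sum_congr rfl fun e he => ?_
    have a := hst e he
    have b := hts e he
    simp only [mem_inter]
    by_cases h1 : s e ∈ Y <;> by_cases h2 : t e ∈ Y
    · simp [h1, h2]
    · have := (a h1).resolve_left h2
      simp [h1, h2, this, hvX, hv]
    · have := (b h2).resolve_left h1
      simp [h1, h2, this, hvX, hv]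
    · simp [h1, h2]
  · refine key _ fun X hvX => ⟨X \ Y, ?_⟩
    rw [cut, cut, sum_filter]
    refine sum_congr rfl fun e he => ?_
    have a := hst e he
    have b := hts e he
    simp only [mem_sdiff]
    by_cases h1 : s e ∈ Y <;> by_cases h2 : t e ∈ Y
    · simp [h1, h2]
    · have := (a h1).resolve_left h2
      simp [h1, h2, this, hvX, hv]
    · have := (b h2).resolve_left h1
      simp [h1, h2, this, hvX, hv]
    · simp [h1, h2]

/-! #### Lifting at a vertex of even degree -/

theorem Joins.exists_edgeNet {s t : E → V} {e : E} {a b : V} (h : Joins s t e a b) {c : ZMod 5}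
    (hc : c = 1 ∨ c = -1) : ∃ c' : ZMod 5, (c' = 1 ∨ c' = -1) ∧
      ∀ u, edgeNet s t e c' u = (if a = u then c else 0) - (if b = u then c else 0) := by
  rcases h with ⟨rfl, rfl⟩ | ⟨rfl, rfl⟩
  · exact ⟨c, hc, fun u => rfl⟩
  · refine ⟨-c, ?_, fun u => ?_⟩
    · rcases hc with rfl | rfl <;> simp
    · rw [edgeNet]; split_ifs <;> simp

theorem Balanced.of_lift {s t : E → V} {S : Finset E} {e e' : E} (hne : e ≠ e') (he : e ∈ S)
    (he' : e' ∈ S) {v x x' : V} (hj : Joins s t e v x) (hj' : Joins s t e' v x')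
    (h : Balanced (Function.update s e x) (Function.update t e x') (S.erase e')) :
    Balanced s t S := by
  obtain ⟨ε, h1, h2⟩ := h
  obtain ⟨c, hc, hce⟩ := hj.symm.exists_edgeNet (h1 e)
  obtain ⟨c', hc', hce'⟩ := hj'.exists_edgeNet (h1 e)
  refine ⟨Function.update (Function.update ε e c) e' c', fun f => ?_, fun u => ?_⟩
  · by_cases hf' : f = e'
    · subst hf'; simpa using hc'
    · by_cases hf : f = e
      · subst hf; simpa [hf'] using hc
      · simpa [hf, hf'] using h1 f
  · have h3 := h2 u
    have heE : e ∈ S.erase e' := mem_erase.2 ⟨hne, he⟩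
    rw [net, ← add_sum_erase _ _ heE] at h3
    rw [net, ← add_sum_erase _ _ he', ← add_sum_erase _ _ heE, Function.update_self, hce',
      Function.update_of_ne hne, Function.update_self, hce]
    have h4 : ∑ f ∈ (S.erase e').erase e,
        edgeNet (Function.update s e x) (Function.update t e x') f (ε f) u =
        ∑ f ∈ (S.erase e').erase e,
          edgeNet s t f (Function.update (Function.update ε e c) e' c' f) u := by
      refine sum_congr rfl fun f hf => ?_
      simp only [mem_erase] at hf
      simp [edgeNet, hf.1, hf.2.1]
    rw [h4] at h3
    rw [edgeNet, Function.update_self, Function.update_self] at h3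
    linear_combination h3

theorem cut_lift {s t : E → V} {S : Finset E} {e e' : E} (hne : e ≠ e') (he : e ∈ S)
    (he' : e' ∈ S) {v x x' : V} (hj : Joins s t e v x) (hj' : Joins s t e' v x') (X : Finset V) :
    cut s t S X = cut (Function.update s e x) (Function.update t e x') (S.erase e') X +
      if (x ∈ X ↔ x' ∈ X) ∧ ¬ (v ∈ X ↔ x ∈ X) then 2 else 0 := by
  have heE : e ∈ S.erase e' := mem_erase.2 ⟨hne, he⟩
  rw [cut, cut, ← add_sum_erase _ _ he', ← add_sum_erase _ _ heE, ← add_sum_erase (S.erase e') _ heE]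
  have h4 : ∑ f ∈ (S.erase e').erase e, (if (Function.update s e x f ∈ X ↔
      Function.update t e x' f ∈ X) then 0 else 1) =
        ∑ f ∈ (S.erase e').erase e, if (s f ∈ X ↔ t f ∈ X) then 0 else 1 := by
    refine sum_congr rfl fun f hf => ?_
    simp only [mem_erase] at hf
    simp [hf.1]
  rw [h4]
  have h5 : (if (s e ∈ X ↔ t e ∈ X) then 0 else 1) = if (v ∈ X ↔ x ∈ X) then 0 else 1 := by
    rcases hj with ⟨rfl, rfl⟩ | ⟨rfl, rfl⟩
    · rfl
    · simp only [iff_comm]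
  have h6 : (if (s e' ∈ X ↔ t e' ∈ X) then 0 else 1) = if (v ∈ X ↔ x' ∈ X) then 0 else 1 := by
    rcases hj' with ⟨rfl, rfl⟩ | ⟨rfl, rfl⟩
    · rfl
    · simp only [iff_comm]
  rw [h5, h6]
  simp only [Function.update_self]
  by_cases a : v ∈ X <;> by_cases b : x ∈ X <;> by_cases c : x' ∈ X <;> simp [a, b, c] <;> ring

theorem cut_inter_add_cut_union (s t : E → V) (S : Finset E) (X Y : Finset V) :
    cut s t S (X ∩ Y) + cut s t S (X ∪ Y) ≤ cut s t S X + cut s t S Y := by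
  simp only [cut, ← sum_add_distrib]
  refine sum_le_sum fun e _ => ?_
  by_cases a : s e ∈ X <;> by_cases b : s e ∈ Y <;> by_cases c : t e ∈ X <;> by_cases d : t e ∈ Y <;>
    simp [a, b, c, d]

/-- The edge `f` joins the intersection to the outside of the union. It crosses both sets but
neither difference, which accounts for the extra 2. -/
theorem cut_sdiff_add_cut_sdiff {s t : E → V} {S : Finset E} {X Y : Finset V} {f : E} (hf : f ∈ S)
    {v x : V} (hj : Joins s t f v x) (hx : x ∈ X ∩ Y) (hv : v ∉ X ∪ Y) :
    cut s t S (X \ Y) + cut s t S (Y \ X) + 2 ≤ cut s t S X + cut s t S Y := by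
  have h2 : 2 = ∑ e ∈ S, if e = f then 2 else 0 := by simp [hf]
  rw [h2]
  simp only [cut, ← sum_add_distrib]
  refine sum_le_sum fun e _ => ?_
  by_cases hef : e = f
  · subst hef
    simp only [mem_inter, mem_union, not_or] at hx hv
    rcases hj with ⟨rfl, rfl⟩ | ⟨rfl, rfl⟩ <;> simp [hx, hv]
  · by_cases a : s e ∈ X <;> by_cases b : s e ∈ Y <;> by_cases c : t e ∈ X <;>
      by_cases d : t e ∈ Y <;> simp [a, b, c, d, hef]

theorem cut_parity (s t : E → V) (S : Finset E) {X Y : Finset V} (h : Disjoint X Y) :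
    ∃ c, cut s t S (X ∪ Y) + 2 * c = cut s t S X + cut s t S Y := by
  refine ⟨∑ e ∈ S, if (s e ∈ X ∧ t e ∈ Y) ∨ (s e ∈ Y ∧ t e ∈ X) then 1 else 0, ?_⟩
  simp only [cut, mul_sum, ← sum_add_distrib]
  refine sum_congr rfl fun e _ => ?_
  have h1 : s e ∈ X → s e ∉ Y := fun h1 h2 => disjoint_left.1 h h1 h2
  have h2 : t e ∈ X → t e ∉ Y := fun h1 h2 => disjoint_left.1 h h1 h2
  by_cases a : s e ∈ X <;> by_cases b : s e ∈ Y <;> by_cases c : t e ∈ X <;> by_cases d : t e ∈ Y <;>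
    simp [a, b, c, d] <;> tauto

/-- At a vertex of even degree that is no cut vertex, two edges can be lifted. -/
theorem exists_lift {s t : E → V} {S : Finset E} (hS : PlanarEdges s t S) (hl : ∀ e ∈ S, s e ≠ t e)
    (ho : OddConn s t S) {v : V} {U : Finset V} (hvU : v ∉ U) (hU : ConnectedOn s t S U)
    (hSU : ∀ e ∈ S, ∀ x, Joins s t e v x → x ∈ U) (heven : Even (cut s t S {v}))
    (hpos : 0 < cut s t S {v}) :
    ∃ e ∈ S, ∃ e' ∈ S, e ≠ e' ∧ ∃ x x', Joins s t e v x ∧ Joins s t e' v x' ∧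
      PlanarEdges (Function.update s e x) (Function.update t e x') (S.erase e') ∧
      OddConn (Function.update s e x) (Function.update t e x') (S.erase e') := by
  classical
  obtain ⟨k, b, hb⟩ := hS
  have hend : ∀ f ∈ S, (s f = v ∨ t f = v) → ∃ x, Joins s t f v x := by
    rintro f hf (h1 | h1)
    · exact ⟨t f, Or.inl ⟨h1, rfl⟩⟩
    · exact ⟨s f, Or.inr ⟨rfl, h1⟩⟩
  by_contra! hcon
  -- A lift lowers a cut by at most 2 and keeps its parity. So it can only fail because of a cut of
  -- size exactly 11 that separates both other ends from `v`.
  have hbad : ∀ e ∈ S, ∀ e' ∈ S, e ≠ e' → ∀ x x', Joins s t e v x → Joins s t e' v x' → ∀ i,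
      b i e ≠ 0 → b i e' ≠ 0 →
      ∃ X : Finset V, v ∉ X ∧ x ∈ X ∧ x' ∈ X ∧ cut s t S X = 11 := by
    intro e he e' he' hne x x' hj hj' i hi hi'
    have h1 := hcon e he e' he' hne x x' hj hj' (hb.lift hne he he' hj hj' hi hi')
    unfold OddConn at h1
    push Not at h1
    obtain ⟨X, hodd, hlt⟩ := h1
    have h2 := cut_lift hne he he' hj hj' X
    split_ifs at h2 with h3
    · have h4 : cut s t S X = 11 := by
        have h5 : Odd (cut s t S X) := by rw [h2]; exact hodd.add_even even_two
        have := ho X h5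
        obtain ⟨a, ha⟩ := h5
        omega
      by_cases hvX : v ∈ X
      · refine ⟨Xᶜ, by simpa using hvX, ?_, ?_, by rw [cut_compl, h4]⟩ <;> simp only [mem_compl] <;>
          tauto
      · exact ⟨X, hvX, by tauto, by tauto, h4⟩
    · have := ho X (by rw [h2]; simpa using hodd)
      omega
  have hcutv : cut s t S {v} = (S.filter fun e => s e = v ∨ t e = v).card := by
    rw [cut, card_filter]
    refine sum_congr rfl fun e he => ?_
    have := hl e he
    simp only [mem_singleton]
    by_cases a : s e = v
    · have : t e ≠ v := fun h => this (a.trans h.symm)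
      simp [a, this]
    · by_cases b : t e = v <;> simp [a, b]
  have htwo : 1 < (S.filter fun e => s e = v ∨ t e = v).card := by
    rw [← hcutv]
    obtain ⟨a, ha⟩ := heven
    omega
  obtain ⟨e₁, he₁, e₂, he₂, hne⟩ := one_lt_card.1 htwo
  rw [mem_filter] at he₁ he₂
  obtain ⟨x₁, hx₁⟩ := hend e₁ he₁.1 he₁.2
  obtain ⟨x₂, hx₂⟩ := hend e₂ he₂.1 he₂.2
  have hfam : (univ.filter fun X : Finset V => v ∉ X ∧ cut s t S X = 11 ∧
      ∃ f ∈ S, ∃ x ∈ X, Joins s t f v x).Nonempty := by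
    obtain ⟨i, f, hf, f', hf', hfI, hfv, h1, h2⟩ := hb.exists_shared hl hvU hU
      (hSU e₁ he₁.1 x₁ hx₁) (hSU e₂ he₂.1 x₂ hx₂) {e₁} he₁.1 he₂.1 hx₁ hx₂ (by simp)
      (by simpa using hne.symm) (by simpa using he₁.2)
    rw [mem_singleton] at hf
    subst hf
    obtain ⟨x', hx'⟩ := hend f' hf' hfv
    obtain ⟨X, a1, a2, a3, a4⟩ := hbad f he₁.1 f' hf' (fun h => hfI (by simp [h])) x₁ x' hx₁ hx' i
      h1 h2
    exact ⟨X, by simp only [mem_filter, mem_univ, true_and]; exact ⟨a1, a4, f, he₁.1, x₁, a2, hx₁⟩⟩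
  -- A largest set with an 11-edge cut that avoids `v` and contains a neighbour of `v`; uncrossing
  -- will enlarge it.
  obtain ⟨X, hX, hmax⟩ := exists_max_image _ Finset.card hfam
  simp only [mem_filter, mem_univ, true_and] at hX hmax
  obtain ⟨hvX, hX11, f₀, hf₀, y₀, hy₀, hj₀⟩ := hX
  -- If all edges at `v` led into `X`, adding `v` to `X` would give a cut of size `11 - d(v)`, which
  -- is odd and too small.
  have hout : ∃ f ∈ S, ∃ x, x ∉ X ∧ Joins s t f v x := by
    by_contra! hall
    have h1 : cut s t S (insert v X) + cut s t S {v} = cut s t S X := by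
      simp only [cut, ← sum_add_distrib]
      refine sum_congr rfl fun e he => ?_
      have hle := hl e he
      simp only [mem_insert, mem_singleton]
      by_cases a : s e = v
      · have h2 : t e ∈ X := by
          by_contra h2; exact hall e he _ h2 (Or.inl ⟨a, rfl⟩)
        have h3 : t e ≠ v := fun h => hle (a.trans h.symm)
        simp [a, h2, h3, hvX]
      · by_cases b : t e = v
        · have h2 : s e ∈ X := by
            by_contra h2; exact hall e he _ h2 (Or.inr ⟨rfl, b⟩)
          simp [a, b, h2, hvX]
        · simp [a, b]
    have h2 := ho (insert v X) (by
      obtain ⟨a, ha⟩ := heven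
      exact ⟨5 - a, by omega⟩)
    omega
  obtain ⟨f₁, hf₁, y₁, hy₁, hj₁⟩ := hout
  have huniq : ∀ {f x x'}, f ∈ S → Joins s t f v x → Joins s t f v x' → x = x' := by
    intro f x x' hf h1 h2
    have := hl f hf
    rcases h1 with ⟨a, b⟩ | ⟨a, b⟩ <;> rcases h2 with ⟨c, d⟩ | ⟨c, d⟩
    · exact b.symm.trans d
    · exact absurd (a.trans d.symm) this
    · exact absurd (c.trans b.symm) this
    · exact a.symm.trans c
  set I := S.filter fun f => ∃ x ∈ X, Joins s t f v x with hI
  obtain ⟨i, f, hf, f', hf', hfI, hfv, h1, h2⟩ := hb.exists_shared hl hvU hU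
    (hSU f₀ hf₀ y₀ hj₀) (hSU f₁ hf₁ y₁ hj₁) I hf₀ hf₁ hj₀ hj₁
    (mem_filter.2 ⟨hf₀, y₀, hy₀, hj₀⟩)
    (fun hh => by
      obtain ⟨-, x, hx, hjx⟩ := mem_filter.1 hh
      exact hy₁ (huniq hf₁ hj₁ hjx ▸ hx))
    (fun f hf => by
      obtain ⟨-, x, hx, hjx⟩ := mem_filter.1 hf
      rcases hjx with ⟨a, -⟩ | ⟨-, a⟩
      · exact Or.inl a
      · exact Or.inr a)
  obtain ⟨hfS, x, hx, hjx⟩ := mem_filter.1 hf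
  obtain ⟨x', hjx'⟩ := hend f' hf' hfv
  have hx' : x' ∉ X := fun hh => hfI (mem_filter.2 ⟨hf', x', hh, hjx'⟩)
  obtain ⟨Y, hvY, hxY, hxY', hY11⟩ := hbad f hfS f' hf' (fun h => hfI (h ▸ hf)) x x' hjx hjx' i h1 h2
  have s1 := cut_inter_add_cut_union s t S X Y
  have s2 := cut_sdiff_add_cut_sdiff hfS hjx (mem_inter.2 ⟨hx, hxY⟩)
    (by simp [hvX, hvY] : v ∉ X ∪ Y)
  obtain ⟨c1, p1⟩ := cut_parity s t S (disjoint_sdiff_inter X Y)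
  obtain ⟨c2, p2⟩ := cut_parity s t S (disjoint_sdiff_inter Y X)
  obtain ⟨c3, p3⟩ := cut_parity s t S (disjoint_sdiff : Disjoint X (Y \ X))
  rw [sdiff_union_inter] at p1 p2
  rw [union_sdiff_self_eq_union] at p3
  rw [inter_comm Y X] at p2
  -- If the intersection is even, both differences are odd cuts, together of size at most `22 - 2`.
  -- If it is odd, so is the union, submodularity forces the latter to have size 11, and it is
  -- larger than `X`.
  rcases Nat.even_or_odd (cut s t S (X ∩ Y)) with hp | hp
  · obtain ⟨a, ha⟩ := hp
    have q1 := ho (X \ Y) (Nat.odd_iff.2 (by omega))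
    have q2 := ho (Y \ X) (Nat.odd_iff.2 (by omega))
    omega
  · have q1 := ho _ hp
    obtain ⟨a, ha⟩ := hp
    have q2 := ho (X ∪ Y) (Nat.odd_iff.2 (by omega))
    have hlt : X.card < (X ∪ Y).card :=
      card_lt_card (ssubset_iff_of_subset subset_union_left |>.2 ⟨x', mem_union_right _ hxY', hx'⟩)
    have := hmax (X ∪ Y) ⟨by simp [hvX, hvY], by omega, f₀, hf₀, y₀, mem_union_left _ hy₀, hj₀⟩
    omega

end

section

variable {V E : Type*} [Fintype V] [DecidableEq V] [Fintype E] [DecidableEq E]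

/-! #### Contraction of a dense set -/

/-- The number of edges of `S` between two vertices. -/
def mult (s t : E → V) (S : Finset E) (x y : V) : ℕ := ∑ e ∈ S, pairInd (s e) (t e) x y

theorem mult_symm (s t : E → V) (S : Finset E) (x y : V) : mult s t S x y = mult s t S y x :=
  sum_congr rfl fun _ _ => pairInd_symm _ _ _ _

theorem exists_joins_of_mult_pos {s t : E → V} {S : Finset E} {x y : V}
    (h : 0 < mult s t S x y) : ∃ e ∈ S, Joins s t e x y := by
  by_contra! hcon
  have : mult s t S x y = 0 := by
    refine sum_eq_zero fun e he => ?_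
    rw [pairInd, if_neg]
    rintro (⟨a, b⟩ | ⟨a, b⟩)
    · exact hcon e he (Or.inl ⟨a.symm, b.symm⟩)
    · exact hcon e he (Or.inr ⟨b.symm, a.symm⟩)
  omega

/-- A realization of a boundary by multiplicities yields signs of the edges. -/
theorem Realizes.exists_signs {s t : E → V} {S : Finset E} {X : Finset V}
    (hS : ∀ e ∈ S, s e ∈ X ∧ t e ∈ X ∧ s e ≠ t e) {β : V → ZMod 5}
    (h : Realizes (mult s t S) X β) :
    ∃ ε : E → ZMod 5, (∀ e, ε e = 1 ∨ ε e = -1) ∧ ∀ v ∈ X, net s t S ε v = β v := by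
  induction S using Finset.induction_on generalizing β with
  | empty =>
    obtain ⟨g, h1, h2, h3⟩ := h
    refine ⟨fun _ => 1, fun _ => Or.inl rfl, fun v hv => ?_⟩
    rw [← h3 v hv, net, sum_empty]
    symm
    refine sum_eq_zero fun y hy => ?_
    by_cases hvy : v = y
    · subst hvy
      have := h1 v v
      revert this
      generalize g v v = a
      revert a
      decide
    · have := h2 v hv y hy hvy
      simpa [mult, SignSum] using this
  | insert e S he ih =>
    obtain ⟨g, h1, h2, h3⟩ := h
    obtain ⟨hp, hq, hpq⟩ := hS e (mem_insert_self _ _)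
    have hm : ∀ x y, mult s t (insert e S) x y = mult s t S x y + pairInd (s e) (t e) x y := by
      intro x y; rw [mult, sum_insert he, add_comm]; rfl
    -- The sign of `e` is peeled off the sum of signs between its ends, and the rest is realized by
    -- induction.
    obtain ⟨δ, hδ, hg⟩ : ∃ δ : ZMod 5, (δ = 1 ∨ δ = -1) ∧
        SignSum (mult s t S (s e) (t e)) (g (s e) (t e) - δ) := by
      have h4 := h2 _ hp _ hq hpq
      rw [hm] at h4
      simp only [pairInd, and_self, true_or, if_true] at h4
      rcases h4 with h4 | h4
      · exact ⟨1, Or.inl rfl, h4⟩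
      · exact ⟨-1, Or.inr rfl, by rwa [sub_neg_eq_add]⟩
    obtain ⟨ε, hε, hnet⟩ := ih (fun f hf => hS f (mem_insert_of_mem hf))
      (β := fun v => β v - edgeNet s t e δ v) ⟨fun x y => g x y - edgeFlow (s e) (t e) δ x y, by
        intro x y
        dsimp only
        rw [h1, edgeFlow_antisymm]; ring, by
        intro x hx y hy hxy
        by_cases c1 : x = s e ∧ y = t e
        · obtain ⟨rfl, rfl⟩ := c1
          simpa [edgeFlow, hpq] using hg
        · by_cases c2 : x = t e ∧ y = s e
          · obtain ⟨rfl, rfl⟩ := c2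
            have h5 := hg.neg
            dsimp only
            rw [mult_symm, h1]
            simp only [edgeFlow, and_self, if_true, hpq, hpq.symm, if_false]
            convert h5 using 1
            ring
          · have h5 := h2 x hx y hy hxy
            rw [hm, pairInd, if_neg (by tauto), add_zero] at h5
            simpa [edgeFlow, c1, c2] using h5, by
        intro x hx
        dsimp only
        rw [sum_sub_distrib, h3 x hx, sum_edgeFlow hp hq]
        simp only [edgeNet, eq_comm]⟩
    refine ⟨Function.update ε e δ, fun f => ?_, fun v hv => ?_⟩
    · by_cases hf : f = e
      · subst hf; simpa using hδ
      · simpa [hf] using hε f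
    · rw [net, sum_insert he, Function.update_self]
      have h5 := hnet v hv
      rw [net] at h5
      rw [sum_congr rfl (g := fun f => edgeNet s t f (ε f) v) fun f hf => by
        rw [Function.update_of_ne (ne_of_mem_of_not_mem hf he)], h5]
      ring

theorem net_collapse {s t : E → V} {S : Finset E} {X : Finset V} {r : V}
    (ε : E → ZMod 5) (v : V) : net (collapse X r ∘ s) (collapse X r ∘ t) S ε v =
      ∑ u ∈ univ.filter fun u => collapse X r u = v, net s t S ε u := by
  simp only [net]
  rw [sum_comm]
  refine sum_congr rfl fun e _ => ?_
  simp only [edgeNet, sum_sub_distrib, Function.comp]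
  congr 1 <;> · rw [sum_ite_eq]; simp

/-- The error of the contracted orientation is confined to `X` and has sum zero there, so the edges
inside `X` can correct it. -/
theorem Balanced.of_contract {s t : E → V} {S : Finset E} (hl : ∀ e ∈ S, s e ≠ t e)
    {X : Finset V} {r : V} (hr : r ∈ X)
    (hX : StronglyConn (mult s t (S.filter fun e => s e ∈ X ∧ t e ∈ X)) X)
    (h : Balanced (collapse X r ∘ s) (collapse X r ∘ t)
      (S.filter fun e => ¬ (s e ∈ X ∧ t e ∈ X))) : Balanced s t S := by
  obtain ⟨ε, h1, h2⟩ := h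
  set F := S.filter fun e => ¬ (s e ∈ X ∧ t e ∈ X) with hF
  have hout : ∀ v ∉ X, net s t F ε v = 0 := by
    intro v hv
    have := h2 v
    rw [net_collapse, sum_eq_single v] at this
    · exact this
    · intro u hu huv
      have hu := (mem_filter.1 hu).2
      by_cases h3 : u ∈ X
      · rw [collapse, if_pos h3] at hu
        rw [hu] at hr
        exact absurd hr hv
      · rw [collapse, if_neg h3] at hu
        exact absurd hu huv
    · intro hv'
      refine absurd ?_ hv'
      rw [mem_filter, collapse, if_neg hv]
      exact ⟨mem_univ _, rfl⟩
  have hin : ∑ v ∈ X, net s t F ε v = 0 := by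
    have := h2 r
    rw [net_collapse] at this
    rw [← this]
    refine sum_congr ?_ fun _ _ => rfl
    ext u
    rw [mem_filter, collapse]
    split_ifs with hu
    · simp [hu]
    · refine ⟨fun h => absurd h hu, fun h => ?_⟩
      rw [h.2]
      exact hr
  obtain ⟨ε', h1', h2'⟩ := (hX (fun v => - net s t F ε v) (by rw [sum_neg_distrib, hin, neg_zero])
    ).exists_signs (fun e he => ⟨(mem_filter.1 he).2.1, (mem_filter.1 he).2.2,
      hl e (mem_filter.1 he).1⟩)
  refine ⟨fun e => if s e ∈ X ∧ t e ∈ X then ε' e else ε e, fun e => ?_, fun v => ?_⟩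
  · dsimp only
    split_ifs
    · exact h1' e
    · exact h1 e
  · have e1 : net s t S (fun e => if s e ∈ X ∧ t e ∈ X then ε' e else ε e) v =
        net s t (S.filter fun e => s e ∈ X ∧ t e ∈ X) ε' v + net s t F ε v := by
      rw [net, ← sum_filter_add_sum_filter_not S fun e => s e ∈ X ∧ t e ∈ X]
      congr 1
      · exact net_congr (fun e he => if_pos (mem_filter.1 he).2) v
      · exact net_congr (fun e he => if_neg (mem_filter.1 he).2) v
    rw [e1]
    by_cases hv : v ∈ X
    · rw [h2' v hv, neg_add_cancel]
    · rw [hout v hv, add_zero]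
      refine sum_eq_zero fun e he => ?_
      have := (mem_filter.1 he).2
      have n1 : s e ≠ v := fun h => hv (h ▸ this.1)
      have n2 : t e ≠ v := fun h => hv (h ▸ this.2)
      simp [edgeNet, n1, n2]

theorem OddConn.contract {s t : E → V} {S : Finset E} (h : OddConn s t S) {X : Finset V} {r : V} :
    OddConn (collapse X r ∘ s) (collapse X r ∘ t) (S.filter fun e => ¬ (s e ∈ X ∧ t e ∈ X)) := by
  intro Y
  have : cut (collapse X r ∘ s) (collapse X r ∘ t) (S.filter fun e => ¬ (s e ∈ X ∧ t e ∈ X)) Y =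
      cut s t S (univ.filter fun v => collapse X r v ∈ Y) := by
    rw [cut, cut, sum_filter]
    refine sum_congr rfl fun e _ => ?_
    simp only [mem_filter, mem_univ, true_and, Function.comp]
    split_ifs with h1 h2 h3 <;> simp_all [collapse]
  rw [this]
  exact h _

/-- The crossing edges of a partition of `X`, in terms of the cuts of the parts. -/
theorem sum_cut_eq {s t : E → V} {S : Finset E} (hl : ∀ e ∈ S, s e ≠ t e) (X : Finset V)
    (f : V → ℕ) : ∑ a ∈ X.image f, cut s t S (X.filter fun v => f v = a) =
      crossing (mult s t (S.filter fun e => s e ∈ X ∧ t e ∈ X)) X f + cut s t S X := by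
  have h1 : crossing (mult s t (S.filter fun e => s e ∈ X ∧ t e ∈ X)) X f =
      ∑ e ∈ S, if s e ∈ X ∧ t e ∈ X then (if f (s e) = f (t e) then 0 else 2) else 0 := by
    have h2 : ∀ T : Finset E, crossing (mult s t T) X f =
        ∑ e ∈ T, crossing (pairInd (s e) (t e)) X f := by
      intro T
      induction T using Finset.induction_on with
      | empty => simp [crossing, mult]
      | insert e T he ih =>
        rw [sum_insert he, ← ih, ← crossing_add]
        congr 1
        ext x y
        rw [mult, sum_insert he]; rfl
    rw [h2, sum_filter]
    refine sum_congr rfl fun e he => ?_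
    split_ifs with h3 h4
    · rw [crossing_pairInd h3.1 h3.2 (hl e he), if_pos h4]
    · rw [crossing_pairInd h3.1 h3.2 (hl e he), if_neg h4]
    · rfl
  rw [h1]
  simp only [cut]
  rw [sum_comm, ← sum_add_distrib]
  refine sum_congr rfl fun e _ => ?_
  simp only [mem_filter]
  by_cases hs : s e ∈ X <;> by_cases ht : t e ∈ X
  · simp only [hs, ht, true_and]
    by_cases hf : f (s e) = f (t e)
    · simp [hf]
    · have h3 : ∀ a ∈ X.image f, (if (f (s e) = a ↔ f (t e) = a) then 0 else 1) =
          (if f (s e) = a then 1 else 0) + (if f (t e) = a then 1 else 0) := by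
        intro a _
        by_cases c : f (s e) = a
        · have : f (t e) ≠ a := fun h => hf (c.trans h.symm)
          simp [c, this]
        · by_cases d : f (t e) = a <;> simp [c, d]
      rw [sum_congr rfl h3, sum_add_distrib]
      simp only [sum_ite_eq, mem_image_of_mem f hs, mem_image_of_mem f ht, if_true, hf, if_false]
  · simp only [hs, ht, true_and, false_and, iff_false, and_false, if_false]
    have h3 : ∀ a ∈ X.image f, (if ¬ f (s e) = a then 0 else 1) =
        (if f (s e) = a then 1 else 0) := by
      intro a _; split_ifs <;> simp_all
    rw [sum_congr rfl h3, sum_ite_eq, if_pos (mem_image_of_mem f hs)]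
    simp
  · simp only [hs, ht, true_and, false_and, false_iff, and_false, if_false]
    have h3 : ∀ a ∈ X.image f, (if ¬ f (t e) = a then 0 else 1) =
        (if f (t e) = a then 1 else 0) := by
      intro a _; split_ifs <;> simp_all
    rw [sum_congr rfl h3, sum_ite_eq, if_pos (mem_image_of_mem f ht)]
    simp
  · simp [hs, ht]

/-- The `t` parts have cuts of size at least 11. Subtracting the at most 10 edges that leave `X`,
twice the number of crossing edges is at least `11t - 10`, more than density asks. -/
theorem dense_of_cut {s t : E → V} {S : Finset E} (hl : ∀ e ∈ S, s e ≠ t e) {X : Finset V}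
    (hX : cut s t S X ≤ 10) (hmin : ∀ Y ⊂ X, Y.Nonempty → 11 ≤ cut s t S Y) :
    Dense (mult s t (S.filter fun e => s e ∈ X ∧ t e ∈ X)) X := by
  intro f
  have h1 := sum_cut_eq hl X f
  by_cases ht : (X.image f).card ≤ 1
  · simp [bound, ht]
  · have h2 : 11 * (X.image f).card ≤ ∑ a ∈ X.image f, cut s t S (X.filter fun v => f v = a) := by
      rw [mul_comm, ← smul_eq_mul]
      refine card_nsmul_le_sum _ _ _ fun a ha => hmin _ ?_ ?_
      · refine (filter_subset _ _).ssubset_of_ne fun heq => ht ?_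
        rw [card_le_one]
        intro b hb c hc
        obtain ⟨u, hu, rfl⟩ := mem_image.1 hb
        obtain ⟨w, hw, rfl⟩ := mem_image.1 hc
        rw [← heq] at hu hw
        exact (mem_filter.1 hu).2.trans (mem_filter.1 hw).2.symm
      · obtain ⟨u, hu, rfl⟩ := mem_image.1 ha
        exact ⟨u, mem_filter.2 ⟨hu, rfl⟩⟩
    have h3 : 2 * bound (X.image f).card + 10 ≤ 11 * (X.image f).card := by
      unfold bound; split_ifs <;> omega
    omega

/-- Every planar multigraph whose odd cuts have at least eleven edges has an orientation with
net out-degrees divisible by five. -/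
theorem balanced_of_oddConn {s t : E → V} {S : Finset E} (hS : PlanarEdges s t S)
    (ho : OddConn s t S) : Balanced s t S := by
  induction hn : S.card using Nat.strong_induction_on generalizing s t S with
  | _ n ih =>
  subst hn
  by_cases hl : ∀ e ∈ S, s e ≠ t e
  swap
  · push Not at hl
    obtain ⟨e, he, hst⟩ := hl
    exact Balanced.of_erase_loop hst
      (ih _ (card_erase_lt_of_mem he) (hS.erase e) (ho.erase_loop hst) rfl)
  by_cases hc : ∃ (v : V) (Y : Finset V), v ∉ Y ∧ (∀ e ∈ S, ∀ a ∈ Y, ∀ b, Joins s t e a b → b ∈ Y ∨ b = v) ∧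
      (∃ e ∈ S, s e ∈ Y ∨ t e ∈ Y) ∧ ∃ e ∈ S, ¬ (s e ∈ Y ∨ t e ∈ Y)
  -- The edges meeting `Y` and the others share at most the vertex `v`, so the two parts are
  -- oriented independently. Disconnected graphs are included, as no edge at `v` is required.
  · obtain ⟨v, Y, hv, hY, ⟨e, he, heY⟩, e', he', heY'⟩ := hc
    obtain ⟨h1, h2⟩ := ho.filter hv hY
    refine Balanced.union (fun e => s e ∈ Y ∨ t e ∈ Y)
      (ih _ ?_ (hS.mono (filter_subset _ _)) h1 rfl) (ih _ ?_ (hS.mono (filter_subset _ _)) h2 rfl)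
    · exact card_lt_card (filter_ssubset.2 ⟨e', he', heY'⟩)
    · exact card_lt_card (filter_ssubset.2 ⟨e, he, not_not.2 heY⟩)
  push Not at hc
  set U : Finset V := univ.filter fun v => ∃ e ∈ S, s e = v ∨ t e = v with hU
  have hsU : ∀ e ∈ S, s e ∈ U := fun e he => mem_filter.2 ⟨mem_univ _, e, he, Or.inl rfl⟩
  have htU : ∀ e ∈ S, t e ∈ U := fun e he => mem_filter.2 ⟨mem_univ _, e, he, Or.inr rfl⟩
  by_cases heven : ∃ v ∈ U, Even (cut s t S {v})
  · obtain ⟨v, hvU, hv⟩ := heven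
    have hpos : 0 < cut s t S {v} := by
      obtain ⟨e, he, hev⟩ := (mem_filter.1 hvU).2
      refine sum_pos' (fun _ _ => Nat.zero_le _) ⟨e, he, ?_⟩
      have := hl e he
      rcases hev with rfl | rfl
      · simp [this.symm]
      · simp [this]
    have hconn : ConnectedOn s t S (U.erase v) := by
      intro Y hY hYn hYne
      by_contra! hcon
      obtain ⟨y, hy⟩ := hYn
      obtain ⟨x, hx, hxY⟩ := exists_of_ssubset (hY.ssubset_of_ne hYne)
      have hY' : ∀ e ∈ S, ∀ a ∈ Y, ∀ b, Joins s t e a b → b ∈ Y ∨ b = v := by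
        intro e he a ha b hj
        by_contra! hb
        refine hcon e he a ha b (mem_sdiff.2 ⟨mem_erase.2 ⟨hb.2, ?_⟩, hb.1⟩) hj
        rcases hj with ⟨-, rfl⟩ | ⟨rfl, -⟩
        · exact htU e he
        · exact hsU e he
      have hvY : v ∉ Y := fun h => by simpa using hY h
      have h1 := hc v Y hvY hY' (by
        obtain ⟨e, he, hey⟩ := (mem_filter.1 (mem_of_mem_erase (hY hy))).2
        rcases hey with h | h
        · exact ⟨e, he, Or.inl (h ▸ hy)⟩
        · exact ⟨e, he, Or.inr (h ▸ hy)⟩)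
      obtain ⟨e, he, hex⟩ := (mem_filter.1 (mem_of_mem_erase hx)).2
      have hxv := (mem_erase.1 hx).1
      rcases hex with rfl | rfl
      · have h2 := (h1 e he).resolve_left hxY
        exact (hY' e he _ h2 _ (Or.inr ⟨rfl, rfl⟩)).elim hxY hxv
      · have h2 := (h1 e he).resolve_right hxY
        exact (hY' e he _ h2 _ (Or.inl ⟨rfl, rfl⟩)).elim hxY hxv
    obtain ⟨e, he, e', he', hne, x, x', hj, hj', hp, ho'⟩ := exists_lift hS hl ho
      (by simp : v ∉ U.erase v) hconn (fun e he x hj => by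
        have := hl e he
        rcases hj with ⟨rfl, rfl⟩ | ⟨rfl, rfl⟩
        · exact mem_erase.2 ⟨this.symm, htU e he⟩
        · exact mem_erase.2 ⟨this, hsU e he⟩) hv hpos
    exact Balanced.of_lift hne he he' hj hj' (ih _ (card_erase_lt_of_mem he') hp ho' rfl)
  · push Not at heven
    rcases S.eq_empty_or_nonempty with rfl | ⟨e₀, he₀⟩
    · exact ⟨fun _ => 1, fun _ => Or.inl rfl, fun v => by simp [net]⟩
    -- The set of all non-isolated vertices has an empty cut and is a candidate.
    have hfam : (univ.filter fun X : Finset V =>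
        X ⊆ U ∧ X.Nonempty ∧ cut s t S X ≤ 10).Nonempty := by
      refine ⟨U, ?_⟩
      simp only [mem_filter, mem_univ, true_and]
      refine ⟨Subset.rfl, ⟨_, hsU e₀ he₀⟩, ?_⟩
      rw [cut, sum_eq_zero]
      · omega
      · intro e he; simp [hsU e he, htU e he]
    obtain ⟨X, hX, hmin⟩ := exists_min_image _ Finset.card hfam
    simp only [mem_filter, mem_univ, true_and] at hX hmin
    obtain ⟨hXU, ⟨r, hr⟩, hX10⟩ := hX
    have hd := dense_of_cut hl hX10 (fun Y hY hYn => by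
      by_contra! hlt
      have := hmin Y ⟨hY.subset.trans hXU, hYn, by omega⟩
      have := card_lt_card hY
      omega)
    -- All degrees are odd, hence at least 11, so a set with at most 10 leaving edges is no single
    -- vertex. The contraction thus removes an edge.
    have hXr : X ≠ {r} := by
      rintro rfl
      have h1 := ho {r} (Nat.not_even_iff_odd.1 (heven r (hXU hr)))
      omega
    have hconn : ConnectedOn s t S X := by
      intro Y hY hYn hYne
      obtain ⟨y, hy, x, hx, hyx⟩ := hd.exists_edge hY hYn hYne (mult_symm s t _)
      obtain ⟨e, he, hj⟩ := exists_joins_of_mult_pos hyx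
      exact ⟨e, (mem_filter.1 he).1, y, hy, x, hx, hj⟩
    have hsc := stronglyConn_of_dense (E := E) (mult_symm s t _)
      ⟨s, t, S, hS, fun x hx y hy _ h0 => by
        obtain ⟨e, he, hj⟩ := exists_joins_of_mult_pos h0
        exact ⟨e, (mem_filter.1 he).1, hj⟩⟩ hd
    refine Balanced.of_contract hl hr hsc (ih _ ?_ (hS.contract hr hconn) ho.contract rfl)
    obtain ⟨e, he, y, hy, x, hx, hj⟩ := hconn {r} (by simpa using hr) (by simp) (Ne.symm hXr)
    rw [mem_singleton] at hy
    subst hy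
    replace hx := (mem_sdiff.1 hx).1
    refine card_lt_card (filter_ssubset.2 ⟨e, he, not_not.2 ?_⟩)
    rcases hj with ⟨rfl, rfl⟩ | ⟨rfl, rfl⟩
    · exact ⟨hr, hx⟩
    · exact ⟨hx, hr⟩

end

section

variable {V E : Type*} [Fintype V] [DecidableEq V] [Fintype E] [DecidableEq E]

/-! ### Rotation systems of genus zero -/

theorem zmod_two_add_eq_zero : ∀ {a b : ZMod 2}, a + b = 0 ↔ a = b := by decide

theorem sum_ite_eq_apply {W M : Type*} [Fintype W] [AddCommMonoid M] (a : W) (f : W → M)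
    [∀ x, Decidable (a = x)] : ∑ x, (if a = x then f x else 0) = f a := by
  rw [Fintype.sum_eq_single a fun x hx => if_neg hx.symm, if_pos rfl]

theorem eq_of_orbitRel {D : Type*} {next flip : Equiv.Perm D} {f : D → ZMod 2}
    (hn : ∀ d, f (next d) = f d) (hf : ∀ d, f (flip d) = f d) {d d' : D}
    (h : (Quotient.mk'' d : MulAction.orbitRel.Quotient (Subgroup.closure {next, flip}) D) =
      Quotient.mk'' d') : f d = f d' := by
  have key : ∀ g ∈ Subgroup.closure ({next, flip} : Set (Equiv.Perm D)), ∀ x, f (g x) = f x := by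
    intro g hg
    induction hg using Subgroup.closure_induction with
    | mem g hg =>
      rcases hg with rfl | rfl
      · exact hn
      · exact hf
    | one => intro x; rfl
    | mul a b _ _ ha hb => intro x; rw [Equiv.Perm.mul_apply, ha, hb]
    | inv a _ ha =>
      intro x
      have := ha (a⁻¹ x)
      rw [← this]
      exact congrArg f (Equiv.apply_symm_apply a x)
  obtain ⟨g, hg⟩ := MulAction.orbitRel_apply.1 (Quotient.exact' h)
  rw [← hg]
  exact key g g.2 _

/-- A space of functions on classes of darts that are invariant under the rotation and the flip has
dimension at most the number of components. -/
theorem finrank_le_card_components {D W : Type*} [Finite D] [Fintype W] {next flip : Equiv.Perm D}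
    {q : D → W} (hq : Function.Surjective q) (K : Submodule (ZMod 2) (W → ZMod 2))
    (hn : ∀ c ∈ K, ∀ d, c (q (next d)) = c (q d)) (hf : ∀ c ∈ K, ∀ d, c (q (flip d)) = c (q d)) :
    Module.finrank (ZMod 2) K ≤
      Nat.card (MulAction.orbitRel.Quotient (Subgroup.closure {next, flip}) D) := by
  classical
  set Ω := MulAction.orbitRel.Quotient (Subgroup.closure {next, flip}) D with hΩ
  have : Finite Ω := Quotient.finite _
  have := Fintype.ofFinite Ω
  choose r hr using hq
  let P : (Ω → ZMod 2) →ₗ[ZMod 2] (W → ZMod 2) :=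
    LinearMap.funLeft (ZMod 2) (ZMod 2) fun w => (Quotient.mk'' (r w) : Ω)
  have h1 : K ≤ LinearMap.range P := by
    intro c hc
    refine ⟨fun ω => c (q ω.out), ?_⟩
    ext w
    simp only [P, LinearMap.funLeft_apply]
    conv_rhs => rw [← hr w]
    refine eq_of_orbitRel (f := fun d => c (q d)) (hn c hc) (hf c hc) ?_
    exact Quotient.out_eq' _
  calc Module.finrank (ZMod 2) K ≤ Module.finrank (ZMod 2) (LinearMap.range P) :=
        Submodule.finrank_mono h1
    _ ≤ Module.finrank (ZMod 2) (Ω → ZMod 2) := LinearMap.finrank_range_le P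
    _ = Nat.card Ω := by rw [Module.finrank_fintype_fun_eq_card, Nat.card_eq_fintype_card]

/-- The faces of a rotation system of genus zero form a two-cover of the cycle space. -/
theorem planarEdges_of_rotation {D : Type*} [Fintype D] {s t : E → V} (σ : E × Bool ≃ D)
    (tail : D → V) (next flip : Equiv.Perm D) (htrue : ∀ e, tail (σ (e, true)) = s e)
    (hfalse : ∀ e, tail (σ (e, false)) = t e) (hflip : ∀ e b, flip (σ (e, b)) = σ (e, !b))
    (hnext : ∀ d d', next.SameCycle d d' ↔ tail d = tail d')
    (heul : (Nat.card (Quotient (Equiv.Perm.SameCycle.setoid next)) : ℤ) - (Fintype.card E : ℤ) +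
      (Nat.card (Quotient (Equiv.Perm.SameCycle.setoid (next * flip))) : ℤ) =
        2 * (Nat.card (MulAction.orbitRel.Quotient (Subgroup.closure {next, flip}) D) : ℤ)) :
    PlanarEdges s t (univ : Finset E) := by
  classical
  set Φ := Quotient (Equiv.Perm.SameCycle.setoid (next * flip)) with hΦ
  set A := Quotient (Equiv.Perm.SameCycle.setoid next) with hA
  have : Finite Φ := Quotient.finite _
  have : Finite A := Quotient.finite _
  have := Fintype.ofFinite Φ
  have := Fintype.ofFinite A
  let fc : D → Φ := Quotient.mk _
  let vc : D → A := Quotient.mk _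
  have hfc : Function.Surjective fc := Quotient.mk_surjective
  have hvc : Function.Surjective vc := Quotient.mk_surjective
  have hff : ∀ d, flip (flip d) = d := by
    intro d
    obtain ⟨⟨e, b⟩, rfl⟩ := σ.surjective d
    rw [hflip, hflip, Bool.not_not]
  have hfcp : ∀ d, fc (next (flip d)) = fc d := fun d =>
    Quotient.sound (Equiv.Perm.SameCycle.symm (Equiv.Perm.sameCycle_apply_right.2
      (Equiv.Perm.SameCycle.refl (next * flip) d)))
  have hvcn : ∀ d, vc (next d) = vc d := fun d =>
    Quotient.sound (Equiv.Perm.SameCycle.symm (Equiv.Perm.sameCycle_apply_right.2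
      (Equiv.Perm.SameCycle.refl next d)))
  have hvct : ∀ d d', vc d = vc d' ↔ tail d = tail d' := fun d d' => by
    rw [← hnext]; exact Quotient.eq
  have htn : ∀ d, tail (next d) = tail d := fun d => (hvct _ _).1 (hvcn d)
  -- A set of faces is mapped to the sum of their boundaries. An edge with the same face on both
  -- sides cancels.
  let T : (Φ → ZMod 2) →ₗ[ZMod 2] (E → ZMod 2) :=
    LinearMap.funLeft (ZMod 2) (ZMod 2) (fun e => fc (σ (e, true))) +
      LinearMap.funLeft (ZMod 2) (ZMod 2) (fun e => fc (σ (e, false)))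
  have hT : ∀ c e, T c e = c (fc (σ (e, true))) + c (fc (σ (e, false))) := fun c e => rfl
  have hTcycle : ∀ c, bdry s t (T c) = 0 := by
    intro c
    ext v
    have h1 : bdry s t (T c) v = ∑ d, ((if tail d = v then c (fc d) else 0) +
        (if tail (flip d) = v then c (fc d) else 0)) := by
      rw [bdry_apply, ← σ.sum_comp, Fintype.sum_prod_type]
      refine sum_congr rfl fun e _ => ?_
      rw [Fintype.sum_bool]
      simp only [hflip, Bool.not_true, Bool.not_false, htrue, hfalse, hT]
      split_ifs <;> ring
    -- The face permutation preserves faces and carries a dart to one that leaves from its head. So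
    -- arrivals and departures of each face at `v` balance.
    have h2 : ∑ d, (if tail (flip d) = v then c (fc d) else 0) =
        ∑ d, if tail d = v then c (fc d) else 0 := by
      rw [← Equiv.sum_comp (next * flip) fun d => if tail d = v then c (fc d) else 0]
      refine sum_congr rfl fun d _ => ?_
      rw [Equiv.Perm.mul_apply, htn, hfcp]
    rw [h1, sum_add_distrib, h2, CharTwo.add_self_eq_zero]
    rfl
  have hkerT : Module.finrank (ZMod 2) (LinearMap.ker T) ≤
      Nat.card (MulAction.orbitRel.Quotient (Subgroup.closure {next, flip}) D) := by
    have hf : ∀ c ∈ LinearMap.ker T, ∀ d, c (fc (flip d)) = c (fc d) := by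
      intro c hc d
      obtain ⟨⟨e, b⟩, rfl⟩ := σ.surjective d
      have := congrFun (LinearMap.mem_ker.1 hc) e
      rw [hT, Pi.zero_apply, zmod_two_add_eq_zero] at this
      rw [hflip]
      cases b
      · exact this
      · exact this.symm
    refine finrank_le_card_components hfc _ (fun c hc d => ?_) hf
    have := hfcp (flip d)
    rw [hff] at this
    rw [this, hf c hc]
  -- The incidence matrix, with a column for each vertex that carries darts.
  let M : Matrix E A (ZMod 2) := fun e u =>
    (if vc (σ (e, true)) = u then 1 else 0) + (if vc (σ (e, false)) = u then 1 else 0)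
  have hkerM : Module.finrank (ZMod 2) (LinearMap.ker M.mulVecLin) ≤
      Nat.card (MulAction.orbitRel.Quotient (Subgroup.closure {next, flip}) D) := by
    refine finrank_le_card_components hvc _ (fun c hc d => by rw [hvcn]) fun c hc d => ?_
    obtain ⟨⟨e, b⟩, rfl⟩ := σ.surjective d
    have := congrFun (LinearMap.mem_ker.1 hc) e
    have h2 : M.mulVecLin c e = c (vc (σ (e, true))) + c (vc (σ (e, false))) := by
      change ∑ u, M e u * c u = _
      simp only [M, add_mul, ite_mul, one_mul, zero_mul, sum_add_distrib]
      exact congrArg₂ _ (sum_ite_eq_apply _ c) (sum_ite_eq_apply _ c)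
    rw [h2, Pi.zero_apply, zmod_two_add_eq_zero] at this
    rw [hflip]
    cases b
    · exact this
    · exact this.symm
  have hker : LinearMap.ker (bdry s t) ≤ LinearMap.ker M.transpose.mulVecLin := by
    intro z hz
    rw [LinearMap.mem_ker] at hz ⊢
    ext u
    obtain ⟨d, rfl⟩ := hvc u
    have := congrFun hz (tail d)
    rw [bdry_apply] at this
    rw [Matrix.mulVecLin_apply, Matrix.mulVec, dotProduct]
    refine Eq.trans ?_ this
    refine sum_congr rfl fun e _ => ?_
    change M e (vc d) * z e = _
    simp only [M, hvct, htrue, hfalse, add_mul, ite_mul, one_mul, zero_mul]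
  have r1 := T.finrank_range_add_finrank_ker
  have r2 := M.mulVecLin.finrank_range_add_finrank_ker
  have r3 := M.transpose.mulVecLin.finrank_range_add_finrank_ker
  have r4 : Module.finrank (ZMod 2) (LinearMap.range M.transpose.mulVecLin) =
      Module.finrank (ZMod 2) (LinearMap.range M.mulVecLin) := M.rank_transpose
  have r5 := Submodule.finrank_mono hker
  rw [Module.finrank_fintype_fun_eq_card] at r1 r2 r3
  rw [Nat.card_eq_fintype_card (α := Φ), Nat.card_eq_fintype_card (α := A)] at heul
  -- With `c` components, the range of `T` has dimension at least `|F| - c` and the cycle space at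
  -- most `|E| - |V| + c`. Genus zero makes these numbers equal, so the faces span.
  have hrange : LinearMap.range T = LinearMap.ker (bdry s t) := by
    refine Submodule.eq_of_le_of_finrank_le ?_ (by omega)
    rintro _ ⟨c, rfl⟩
    exact LinearMap.mem_ker.2 (hTcycle c)
  let τ : Fin (Fintype.card Φ) ≃ Φ := (Fintype.equivFin Φ).symm
  have hTb : ∀ c : Φ → ZMod 2, T c = ∑ i, c (τ i) • T (Pi.single (τ i) 1) := by
    intro c
    rw [τ.sum_comp fun φ => c φ • T (Pi.single φ 1)]
    simp_rw [← map_smul]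
    rw [← map_sum]
    congr 1
    ext φ
    simp only [Finset.sum_apply, Pi.single_apply, Pi.smul_apply, smul_eq_mul, mul_ite, mul_one,
      mul_zero]
    exact (sum_ite_eq_apply φ c).symm
  refine ⟨Fintype.card Φ, fun i => T (Pi.single (τ i) 1), ⟨fun i => ⟨by simp, hTcycle _⟩, ?_, ?_, ?_⟩⟩
  · have h1 := hTb fun _ => 1
    simp only [one_smul] at h1
    rw [← h1]
    ext e
    rw [hT]
    exact CharTwo.add_self_eq_zero _
  · rintro z ⟨-, hz⟩
    have : z ∈ LinearMap.range T := by rw [hrange]; exact LinearMap.mem_ker.2 hz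
    obtain ⟨c, rfl⟩ := this
    exact ⟨fun i => c (τ i), hTb c⟩
  · intro e
    calc _ ≤ ({τ.symm (fc (σ (e, true))), τ.symm (fc (σ (e, false)))} : Finset _).card := by
          refine card_le_card fun i hi => ?_
          simp only [mem_filter, mem_univ, true_and, hT, Pi.single_apply] at hi
          simp only [mem_insert, mem_singleton, Equiv.eq_symm_apply]
          by_contra! hne
          rw [if_neg hne.1.symm, if_neg hne.2.symm] at hi
          simp at hi
      _ ≤ 2 := card_le_two

/-! ### Circular flows -/

/-- An orientation with net out-degrees divisible by five yields an integer flow with values `2`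
and `-3`. -/
theorem exists_circular_flow {s t : E → V} (hl : ∀ e, s e ≠ t e)
    (h : ∀ v, ∃ k : ℤ, ((univ.filter fun e => s e = v).card : ℤ) -
      ((univ.filter fun e => t e = v).card : ℤ) = 5 * k) :
    ∃ f : E → ℤ, (∀ e, f e = 2 ∨ f e = -3) ∧
      ∀ v, ∑ e ∈ univ.filter (fun e => s e = v), f e = ∑ e ∈ univ.filter (fun e => t e = v), f e := by
  choose k hk using h
  have hs : ∀ X : Finset V, ∑ v ∈ X, ((univ.filter fun e => s e = v).card : ℤ) =
      ((univ.filter fun e => s e ∈ X).card : ℤ) := by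
    intro X
    rw [← Nat.cast_sum, card_eq_sum_card_fiberwise (f := s) (t := X) (by intro e; simp)]
    congr 1
    refine sum_congr rfl fun v hv => ?_
    congr 1
    ext e
    simp only [mem_filter, mem_univ, true_and]
    exact ⟨fun h => ⟨h ▸ hv, h⟩, fun h => h.2⟩
  have ht : ∀ X : Finset V, ∑ v ∈ X, ((univ.filter fun e => t e = v).card : ℤ) =
      ((univ.filter fun e => t e ∈ X).card : ℤ) := by
    intro X
    rw [← Nat.cast_sum, card_eq_sum_card_fiberwise (f := t) (t := X) (by intro e; simp)]
    congr 1
    refine sum_congr rfl fun v hv => ?_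
    congr 1
    ext e
    simp only [mem_filter, mem_univ, true_and]
    exact ⟨fun h => ⟨h ▸ hv, h⟩, fun h => h.2⟩
  -- Each edge will select one of its ends, with value 2 if this is the tail and -3 if it is the
  -- head. Flow conservation at `v` then says that `v` is selected `p v` times, where `5 p v = 3
  -- d⁺(v) + 2 d⁻(v)`.
  set p : V → ℤ := fun v => ((univ.filter fun e => s e = v).card : ℤ) - 2 * k v with hp
  have hpX : ∀ X : Finset V, ((univ.filter fun e => s e ∈ X ∧ t e ∈ X).card : ℤ) ≤
      ∑ v ∈ X, p v := by
    intro X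
    have h1 : 5 * ∑ v ∈ X, p v = 3 * ((univ.filter fun e => s e ∈ X).card : ℤ) +
        2 * ((univ.filter fun e => t e ∈ X).card : ℤ) := by
      rw [← hs, ← ht, mul_sum, mul_sum, mul_sum, ← sum_add_distrib]
      refine sum_congr rfl fun v _ => ?_
      have := hk v
      simp only [hp]
      linarith
    have h2 : ((univ.filter fun e => s e ∈ X ∧ t e ∈ X).card) ≤
        (univ.filter fun e => s e ∈ X).card :=
      card_le_card fun e he => by simp at he ⊢; exact he.1
    have h3 : ((univ.filter fun e => s e ∈ X ∧ t e ∈ X).card) ≤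
        (univ.filter fun e => t e ∈ X).card :=
      card_le_card fun e he => by simp at he ⊢; exact he.2
    omega
  have hp0 : ∀ v, 0 ≤ p v := fun v => by
    have := hpX {v}
    rw [sum_singleton] at this
    omega
  have hptot : ∑ v, p v = Fintype.card E := by
    have h1 : 5 * ∑ v, p v = 3 * ((univ.filter fun e => s e ∈ univ).card : ℤ) +
        2 * ((univ.filter fun e => t e ∈ univ).card : ℤ) := by
      rw [← hs, ← ht, mul_sum, mul_sum, mul_sum, ← sum_add_distrib]
      refine sum_congr rfl fun v _ => ?_
      have := hk v
      simp only [hp]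
      linarith
    simp at h1
    omega
  let slots : E → Finset (Σ v : V, Fin (p v).toNat) := fun e =>
    univ.filter fun x => x.1 = s e ∨ x.1 = t e
  have hcardσ : ∀ X : Finset V,
      ((univ.filter fun x : Σ v : V, Fin (p v).toNat => x.1 ∈ X).card : ℤ) = ∑ v ∈ X, p v := by
    intro X
    have : (univ.filter fun x : Σ v : V, Fin (p v).toNat => x.1 ∈ X) =
        X.sigma fun v => univ := by
      ext x; simp
    rw [this, card_sigma]
    push_cast
    refine sum_congr rfl fun v _ => ?_
    simp [hp0 v]
  -- Each vertex offers `p v` slots and each edge takes a slot at one of its ends. Hall's condition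
  -- holds because the edges inside `X` are counted in both its out-degree and its in-degree sums.
  obtain ⟨φ, hφ, hφm⟩ := (all_card_le_biUnion_card_iff_exists_injective slots).1 (by
    intro F
    set X := F.image s ∪ F.image t with hX
    have h1 : F.card ≤ (univ.filter fun e => s e ∈ X ∧ t e ∈ X).card := by
      refine card_le_card fun e he => ?_
      simp only [mem_filter, mem_univ, true_and, hX, mem_union]
      exact ⟨Or.inl (mem_image_of_mem _ he), Or.inr (mem_image_of_mem _ he)⟩
    have h2 : F.biUnion slots = univ.filter fun x : Σ v : V, Fin (p v).toNat => x.1 ∈ X := by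
      ext x
      simp only [mem_biUnion, slots, mem_filter, mem_univ, true_and, hX, mem_union, mem_image]
      constructor
      · rintro ⟨e, he, h | h⟩
        · exact Or.inl ⟨e, he, h.symm⟩
        · exact Or.inr ⟨e, he, h.symm⟩
      · rintro (⟨e, he, h⟩ | ⟨e, he, h⟩)
        · exact ⟨e, he, Or.inl h.symm⟩
        · exact ⟨e, he, Or.inr h.symm⟩
    rw [h2]
    have h3 := hcardσ X
    have h4 := hpX X
    omega)
  -- There are exactly as many slots as edges, so all slots are taken.
  have hbij : Function.Bijective φ := by
    rw [Fintype.bijective_iff_injective_and_card]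
    refine ⟨hφ, ?_⟩
    have h3 := hcardσ univ
    rw [hptot] at h3
    simp only [mem_univ, filter_true, card_univ] at h3
    exact_mod_cast h3.symm
  have hend : ∀ e, (φ e).1 = s e ∨ (φ e).1 = t e := fun e => by
    have := hφm e
    simpa [slots] using this
  have hcount : ∀ v, ((univ.filter fun e => (φ e).1 = v).card : ℤ) = p v := by
    intro v
    have h1 := hcardσ {v}
    rw [sum_singleton] at h1
    rw [← h1]
    congr 1
    refine card_bij (fun e _ => φ e) (by simp) (fun a _ b _ hab => hφ hab) ?_
    intro x hx
    obtain ⟨e, rfl⟩ := hbij.2 x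
    exact ⟨e, by simpa using hx, rfl⟩
  refine ⟨fun e => if (φ e).1 = s e then 2 else -3, fun e => ?_, fun v => ?_⟩
  · dsimp only; split_ifs <;> simp
  · have e1 : ∀ P : E → Prop, ∀ [DecidablePred P],
        ∑ e ∈ univ.filter P, (if (φ e).1 = s e then (2 : ℤ) else -3) =
        2 * ((univ.filter P).card : ℤ) -
          5 * ((univ.filter fun e => P e ∧ (φ e).1 ≠ s e).card : ℤ) := by
      intro P _
      have : ∀ e, (if (φ e).1 = s e then (2 : ℤ) else -3) =
          2 - 5 * (if (φ e).1 ≠ s e then 1 else 0) := by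
        intro e; by_cases h : (φ e).1 = s e <;> simp [h]
      simp only [this]
      rw [sum_sub_distrib, ← mul_sum, sum_const, nsmul_eq_mul, sum_boole, filter_filter]
      ring
    rw [e1, e1]
    have e2 : ((univ.filter fun e => (φ e).1 = v).card : ℤ) +
        ((univ.filter fun e => s e = v ∧ (φ e).1 ≠ s e).card : ℤ) =
        ((univ.filter fun e => s e = v).card : ℤ) +
          ((univ.filter fun e => t e = v ∧ (φ e).1 ≠ s e).card : ℤ) := by
      simp only [card_filter, Nat.cast_sum, ← sum_add_distrib]
      refine sum_congr rfl fun e _ => ?_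
      have hle := hl e
      rcases hend e with h1 | h1
      · simp [h1]
      · have : t e ≠ s e := hle.symm
        simp only [h1, this, ne_eq, not_false_eq_true, and_true]
        ring
    rw [hcount] at e2
    have e3 := hk v
    simp only [hp] at e2
    linarith

end

section

/-! ### Multigraphs -/

section

variable {α β : Type*} {G : Graph α β}

/-- The two darts of each edge with chosen ends. -/
def dartOf {s t : G.edgeSet → G.vertexSet}
    (hst : ∀ e : G.edgeSet, G.IsLink e (s e) (t e)) :
    G.edgeSet × Bool → G.Dart
  | (e, true) => ⟨e, s e, t e, hst e⟩
  | (e, false) => ⟨e, t e, s e, (hst e).symm⟩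

theorem dartOf_bijective (hl : G.Loopless) {s t : G.edgeSet → G.vertexSet}
    (hst : ∀ e : G.edgeSet, G.IsLink e (s e) (t e)) : Function.Bijective (dartOf hst) := by
  constructor
  · rintro ⟨e, b⟩ ⟨e', b'⟩ h
    have he : e = e' := by
      have := congrArg Graph.Dart.edge h
      cases b <;> cases b' <;> exact Subtype.ext this
    subst he
    have hne : (s e : α) ≠ t e := (hst e).ne
    have ht := congrArg Graph.Dart.tail h
    cases b <;> cases b'
    · rfl
    · exact absurd ht.symm hne
    · exact absurd ht hne
    · rfl
  · intro d
    rcases d.isLink.eq_and_eq_or_eq_and_eq (hst ⟨d.edge, d.isLink.edge_mem⟩) with ⟨h1, h2⟩ | ⟨h1, h2⟩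
    · exact ⟨(⟨d.edge, d.isLink.edge_mem⟩, true), Graph.Dart.ext rfl h1.symm h2.symm⟩
    · exact ⟨(⟨d.edge, d.isLink.edge_mem⟩, false), Graph.Dart.ext rfl h1.symm h2.symm⟩

theorem planarEdges_of_isPlanar (hl : G.Loopless) (hp : G.IsPlanar) [Fintype G.vertexSet]
    [DecidableEq G.vertexSet] [Fintype G.edgeSet] [DecidableEq G.edgeSet]
    {s t : G.edgeSet → G.vertexSet}
    (hst : ∀ e : G.edgeSet, G.IsLink e (s e) (t e)) :
    PlanarEdges s t univ := by
  obtain ⟨R, hR⟩ := hp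
  let σ : G.edgeSet × Bool ≃ G.Dart := Equiv.ofBijective _ (dartOf_bijective hl hst)
  have : Fintype G.Dart := Fintype.ofEquiv _ σ
  refine planarEdges_of_rotation σ (fun d => ⟨d.tail, d.isLink.left_mem⟩) R.next G.flip
    (fun e => rfl) (fun e => rfl) (fun e b => by cases b <;> rfl) (fun d d' => ?_) ?_
  · rw [R.sameCycle_iff, Subtype.mk.injEq]
  · have h1 : G.edgeSet.ncard = Fintype.card G.edgeSet := by
      rw [← Nat.card_coe_set_eq, Nat.card_eq_fintype_card]
    have h2 : (R.numVertices : ℤ) - (G.edgeSet.ncard : ℤ) + (R.numFaces : ℤ) =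
      2 * (R.numComponents : ℤ) := hR
    rw [h1] at h2
    exact h2

theorem cut_eq_cutSize [Fintype G.vertexSet] [DecidableEq G.vertexSet] [Fintype G.edgeSet]
    [DecidableEq G.edgeSet] {s t : G.edgeSet → G.vertexSet}
    (hst : ∀ e : G.edgeSet, G.IsLink e (s e) (t e))
    (X : Finset G.vertexSet) : cut s t univ X = G.cutSize (Subtype.val '' (X : Set G.vertexSet)) := by
  have h1 : G.edgeCut (Subtype.val '' (X : Set G.vertexSet)) =
      Subtype.val '' ((univ.filter fun e => ¬ (s e ∈ X ↔ t e ∈ X) : Finset G.edgeSet) :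
        Set G.edgeSet) := by
    have hmem : ∀ v : G.vertexSet, (v : α) ∈ Subtype.val '' (X : Set G.vertexSet) ↔ v ∈ X := by
      intro v
      simp
    ext e
    constructor
    · rintro ⟨x, y, hxy, hx, hy⟩
      refine ⟨⟨e, hxy.edge_mem⟩, ?_, rfl⟩
      have h2 := hst ⟨e, hxy.edge_mem⟩
      rw [mem_coe, mem_filter]
      refine ⟨mem_univ _, ?_⟩
      rcases hxy.eq_and_eq_or_eq_and_eq h2 with ⟨h3, h4⟩ | ⟨h3, h4⟩
      · rw [h3, hmem] at hx
        rw [h4, hmem] at hy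
        simp [hx, hy]
      · rw [h3, hmem] at hx
        rw [h4, hmem] at hy
        simp [hx, hy]
    · rintro ⟨e, he, rfl⟩
      rw [mem_coe, mem_filter] at he
      have he := he.2
      by_cases h3 : s e ∈ X
      · exact ⟨s e, t e, hst e, (hmem _).2 h3, fun h => he (by simp [h3, (hmem _).1 h])⟩
      · refine ⟨t e, s e, (hst e).symm, (hmem _).2 ?_, fun h => h3 ((hmem _).1 h)⟩
        by_contra h4
        exact he (by simp [h3, h4])
  rw [Graph.cutSize, h1, Set.ncard_image_of_injective _ Subtype.val_injective, Set.ncard_coe_finset,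
    card_filter, cut]
  exact sum_congr rfl fun e _ => by split_ifs <;> rfl

theorem hasModuloOrientation (hV : G.vertexSet.Finite) (hE : G.edgeSet.Finite) (hl : G.Loopless)
    (hp : G.IsPlanar) (ho : G.IsOddEdgeConnected 11) : G.HasModuloOrientation 5 := by
  classical
  have := hV.fintype
  have := hE.fintype
  have hends : ∀ e : G.edgeSet, ∃ x y : G.vertexSet, G.IsLink e x y := by
    intro e
    obtain ⟨x, y, h⟩ := G.exists_isLink_of_mem_edgeSet e.2
    exact ⟨⟨x, h.left_mem⟩, ⟨y, h.right_mem⟩, h⟩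
  choose s t hst using hends
  obtain ⟨ε, h1, h2⟩ := balanced_of_oddConn (planarEdges_of_isPlanar hl hp hst) (fun X => by
    rw [cut_eq_cutSize hst]
    exact ho _ (by rintro _ ⟨v, -, rfl⟩; exact v.2))
  refine ⟨⟨fun e => if ε e = 1 then s e else t e, fun e => if ε e = 1 then t e else s e,
    fun e => ?_⟩, fun v hv => ?_⟩
  · split_ifs
    · exact hst e
    · exact (hst e).symm
  · have h3 := h2 ⟨v, hv⟩
    rw [← ZMod.intCast_eq_intCast_iff, Int.cast_zero, Graph.Orientation.outDegree,
      Graph.Orientation.inDegree, Set.ncard_eq_toFinset_card', Set.ncard_eq_toFinset_card',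
      Set.toFinset_ofPred, Set.toFinset_ofPred]
    push_cast
    rw [card_filter, card_filter, ← h3, net]
    push_cast
    rw [← sum_sub_distrib]
    refine sum_congr rfl fun e _ => ?_
    have hs : ((s e : α) = v) ↔ s e = ⟨v, hv⟩ := by rw [Subtype.ext_iff]
    have ht : ((t e : α) = v) ↔ t e = ⟨v, hv⟩ := by rw [Subtype.ext_iff]
    have hne : (-1 : ZMod 5) ≠ 1 := by decide
    rcases h1 e with h4 | h4
    · simp only [h4, if_true, hs, ht, edgeNet]
    · simp only [h4, hne, if_false, hs, ht, edgeNet]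
      split_ifs <;> simp

/-- An odd cut is nonempty, hence defined by a nonempty proper set, and an odd number that is at
least 10 is at least 11. -/
theorem _root_.Graph.IsEdgeConnected.isOddEdgeConnected (h : G.IsEdgeConnected 10) :
    G.IsOddEdgeConnected 11 := by
  intro X hX hodd
  have hne : X.Nonempty := by
    rw [Set.nonempty_iff_ne_empty]
    rintro rfl
    have : G.edgeCut ∅ = ∅ := by
      ext e; simp [Graph.edgeCut]
    simp [Graph.cutSize, this] at hodd
  have hpr : X ≠ G.vertexSet := by
    rintro rfl
    have : G.edgeCut G.vertexSet = ∅ := by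
      rw [Set.eq_empty_iff_forall_notMem]
      rintro e ⟨x, y, hxy, -, hy⟩
      exact hy hxy.right_mem
    simp [Graph.cutSize, this] at hodd
  have := h X (hX.ssubset_of_ne hpr) hne
  obtain ⟨a, ha⟩ := hodd
  omega

theorem hasCircularFlow (hV : G.vertexSet.Finite) (hE : G.edgeSet.Finite) (hl : G.Loopless)
    (h : G.HasModuloOrientation 5) : G.HasCircularFlow 5 2 := by
  classical
  have := hV.fintype
  have := hE.fintype
  obtain ⟨D, hD⟩ := h
  let s : G.edgeSet → G.vertexSet := fun e => ⟨D.tail e, (D.isLink e).left_mem⟩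
  let t : G.edgeSet → G.vertexSet := fun e => ⟨D.head e, (D.isLink e).right_mem⟩
  have hs : ∀ v : G.vertexSet, (univ.filter fun e => s e = v) =
      {e : G.edgeSet | D.tail e = v}.toFinset := by
    intro v; ext e; simp [s, Subtype.ext_iff]
  have ht : ∀ v : G.vertexSet, (univ.filter fun e => t e = v) =
      {e : G.edgeSet | D.head e = v}.toFinset := by
    intro v; ext e; simp [t, Subtype.ext_iff]
  obtain ⟨f, hf, hflow⟩ := exists_circular_flow (s := s) (t := t)
    (fun e he => (D.isLink e).ne (congrArg Subtype.val he)) (fun v => by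
      obtain ⟨k, hk⟩ := (Int.modEq_zero_iff_dvd.1 (hD v v.2))
      refine ⟨k, ?_⟩
      rw [hs, ht, ← Set.ncard_eq_toFinset_card', ← Set.ncard_eq_toFinset_card']
      exact_mod_cast hk)
  refine ⟨D, f, fun v hv => ?_, fun e => ?_⟩
  · have h1 := hflow ⟨v, hv⟩
    rw [hs, ht] at h1
    rw [finsum_mem_eq_toFinset_sum, finsum_mem_eq_toFinset_sum]
    exact h1
  · rcases hf e with h1 | h1 <;> rw [h1] <;> norm_num

end

end

end PlanarFlow

theorem mainTheorem1 {α β : Type*} (G : Graph α β) (hV : G.vertexSet.Finite)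
    (hE : G.edgeSet.Finite) (hloopless : G.Loopless) (hplanar : G.IsPlanar) :
    (G.IsOddEdgeConnected 11 → G.HasModuloOrientation 5) ∧
    (G.IsEdgeConnected 10 → G.HasModuloOrientation 5 ∧ G.HasCircularFlow 5 2) := by
  have key := PlanarFlow.hasModuloOrientation hV hE hloopless hplanar
  refine ⟨key, fun h => ?_⟩
  have hm := key h.isOddEdgeConnected
  exact ⟨hm, PlanarFlow.hasCircularFlow hV hE hloopless hm⟩
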